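/- Let $d\ge 2$, $R\ge 1$ and $m,s,t\ge 0$ be integers, put $n=m+s+t$, and let $\mathbf F=(F_1,\dots,F_R)$ be homogeneous polynomials of degree $d$ with integer coefficients in the $n$ variables $\mathbf x=(\mathbf y,\mathbf z,\mathbf w)$, where $\mathbf y$, $\mathbf z$, $\mathbf w$ have $m$, $s$, $t$ coordinates. Each $F_i$ is uniquely of the form $$F_i(\mathbf y,\mathbf z,\mathbf w)=f_i(\mathbf y)+g_i(\mathbf y,\mathbf z)+h_i(\mathbf y,\mathbf z,\mathbf w)$$ with $f_i,g_i$ homogeneous of degree $d$ (or zero), $\deg_{\mathbf y}g_i<d$ and $\deg_{(\mathbf y,\mathbf z)}h_i<d$. For a system $\mathbf G=(G_1,\dots,G_R)$ of homogeneous polynomials in $k$ variables write $V^*_{\mathbf G}=\{\mathbf x\in\mathbb C^k:\operatorname{rank}(\partial G_i/\partial x_j(\mathbf x))_{i,j}<R\}$; thus $V^*_{\mathbf f}\subseteq\mathbb C^m$ and $V^*_{\mathbf g}\subseteq\mathbb C^{m+s}$. There are constants $C$ and $P_0$, depending only on $\mathbf F$ and on the splitting of the variables, such that the following holds. Let $\kappa_1,\kappa_2$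 be real numbers with $\min(\kappa_1,\kappa_2)>2^{d-1}(d-1)R(R+1)$ and $$m-\dim V^*_{\mathbf f}\ge\kappa_1,\qquad m+s-\dim V^*_{\mathbf g}\ge\kappa_2 .$$ Let $\lambda_1,\dots,\lambda_n$ be real sequences with $|\lambda_j(x)|\le\log x$ for all integers $x\ge 1$; for a vector, $\lambda(\cdot)$ denotes the product of the values of the sequences attached to its coordinates. Let $P\ge P_0$, let $0<X\le\frac14P^{Rd/(R+1)}$, and let $\mathfrak n\subseteq[0,2]^R$ be measurable with Lebesgue measure $|\mathfrak n|$. With $e(z)=e^{2\pi iz}$ and sums over integer vectors all of whose coordinates lie in $[1,P]$, put $$S_{\mathbf F}(\boldsymbol\alpha)=\sum_{\mathbf y,\mathbf z,\mathbf w}\lambda(\mathbf y)\lambda(\mathbf z)\lambda(\mathbf w)\,e(\boldsymbol\alpha\cdot\mathbf F(\mathbf y,\mathbf z,\mathbf w)),\qquad \mathcal E_{\mathbf y,\mathbf z}(\boldsymbol\alpha)=\sum_{\mathbf w}\lambda(\mathbf w)\,e(\boldsymbol\alpha\cdot\mathbf h(\mathbf y,\mathbf z,\mathbf w)),$$ and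 let $\sup(\mathcal E)$ be the supremum of $|\mathcal E_{\mathbf y,\mathbf z}(\boldsymbol\alpha)|$ over $\boldsymbol\alpha\in\mathfrak n$ and over integer vectors $\mathbf y,\mathbf z$ with all coordinates in $[1,P]$ (and $0$ if there are none). Then $$\begin{aligned}\Big|\int_{\mathfrak n}S_{\mathbf F}(\boldsymbol\alpha)\,d\boldsymbol\alpha\Big|\le C\Big(&P^{n-\frac12Rd}(\log P)^{2n}X^{\frac12(R+1)-\frac{\kappa_1}{2^d(d-1)R}}|\mathfrak n|^{1/2}\\&+P^{n-\frac34Rd}(\log P)^{2n}X^{\frac34(R+1)-\frac{\kappa_2}{2^{d+1}(d-1)R}}|\mathfrak n|^{1/4}\\&+P^{m+s-Rd}(\log P)^{m+s}X^{R+1}\sup(\mathcal E)\Big).\end{aligned}$$ -/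

import Mathlib

namespace FormsPrime

noncomputable section

/-- The dimension of a nonempty Zariski closed subset `V` of the affine space `ℂ ^ σ`: the Krull
dimension of its coordinate ring `ℂ[σ] / I(V)`, as a natural number. -/
def affineDim {σ : Type*} (V : Set (σ → ℂ)) : ℕ :=
  ((ringKrullDim (MvPolynomial σ ℂ ⧸ MvPolynomial.vanishingIdeal ℂ V)).unbotD 0).toNat

/-- For nonempty `V` no information is lost in passing to a natural number. -/
theorem coe_affineDim {σ : Type*} [Finite σ] {V : Set (σ → ℂ)} (hV : V.Nonempty) :
    ((affineDim V : ℕ) : WithBot ℕ∞) =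
      ringKrullDim (MvPolynomial σ ℂ ⧸ MvPolynomial.vanishingIdeal ℂ V) := by
  have hne : Nontrivial (MvPolynomial σ ℂ ⧸ MvPolynomial.vanishingIdeal ℂ V) := by
    rw [Ideal.Quotient.nontrivial_iff, Ne, Ideal.eq_top_iff_one]
    intro h
    obtain ⟨x, hx⟩ := hV
    simpa using h x hx
  have h0 := ringKrullDim_nonneg_of_nontrivial
    (R := MvPolynomial σ ℂ ⧸ MvPolynomial.vanishingIdeal ℂ V)
  have h1 : ringKrullDim (MvPolynomial σ ℂ ⧸ MvPolynomial.vanishingIdeal ℂ V) ≤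
      ((Nat.card σ : ℕ) : WithBot ℕ∞) := by
    refine (ringKrullDim_quotient_le _).trans ?_
    rw [MvPolynomial.ringKrullDim_of_isNoetherianRing]
    simp [ringKrullDim_eq_zero_of_field]
  unfold affineDim
  generalize ringKrullDim (MvPolynomial σ ℂ ⧸ MvPolynomial.vanishingIdeal ℂ V) = D at h0 h1
  cases D with
  | bot => simp at h0
  | coe D =>
    have h2 : D ≤ ((Nat.card σ : ℕ) : ℕ∞) := by exact_mod_cast h1
    have h3 : D ≠ ⊤ := fun h => by simp [h] at h2
    obtain ⟨k, rfl⟩ := ENat.ne_top_iff_exists.mp h3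
    rfl

/-- The Jacobian matrix `(∂G_i / ∂x_j)(x)` of a system of `R` integral polynomials at a complex
point `x`. -/
def jacobian {σ : Type*} {R : ℕ} (G : Fin R → MvPolynomial σ ℤ) (x : σ → ℂ) :
    Matrix (Fin R) σ ℂ :=
  Matrix.of fun i j => MvPolynomial.aeval x (MvPolynomial.pderiv j (G i))

/-- The singular locus in the sense of Birch: the points of affine space at which the Jacobian
matrix has rank smaller than `R`. -/
def singularLocus {σ : Type*} [Fintype σ] {R : ℕ} (G : Fin R → MvPolynomial σ ℤ) :
    Set (σ → ℂ) :=
  {x | (jacobian G x).rank < R}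

/-- `F_i(y,z,w) = f_i(y) + g_i(y,z) + h_i(y,z,w)`, where `f_i` and `g_i` are homogeneous of degree
`d`, the degree of `g_i` in `y` is smaller than `d`, and the degree of `h_i` in `(y,z)` is smaller
than `d`. The three summands of the index type hold the variables `y`, `z` and `w`. -/
structure IsSplitting {m s t R : ℕ} (d : ℕ)
    (F : Fin R → MvPolynomial ((Fin m ⊕ Fin s) ⊕ Fin t) ℤ)
    (f : Fin R → MvPolynomial (Fin m) ℤ)
    (g : Fin R → MvPolynomial (Fin m ⊕ Fin s) ℤ)
    (h : Fin R → MvPolynomial ((Fin m ⊕ Fin s) ⊕ Fin t) ℤ) : Prop where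
  eq_add : ∀ i, F i = MvPolynomial.rename (fun j => Sum.inl (Sum.inl j)) (f i) +
    MvPolynomial.rename Sum.inl (g i) + h i
  homogeneous_f : ∀ i, (f i).IsHomogeneous d
  homogeneous_g : ∀ i, (g i).IsHomogeneous d
  degree_g : ∀ i,
    (g i).weightedTotalDegree (Sum.elim (fun _ => 1) (fun _ => 0) : Fin m ⊕ Fin s → ℕ) < d
  degree_h : ∀ i,
    (h i).weightedTotalDegree
      (Sum.elim (fun _ => 1) (fun _ => 0) : (Fin m ⊕ Fin s) ⊕ Fin t → ℕ) < d

/-- `e(z) = exp(2πiz)`. -/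
def e (z : ℝ) : ℂ := Complex.exp (2 * Real.pi * Complex.I * z)

/-- The points `x` with positive integer coordinates `1 ≤ x_j ≤ P`. -/
def box (σ : Type*) [Fintype σ] [DecidableEq σ] (P : ℝ) : Finset (σ → ℕ) :=
  Fintype.piFinset fun _ => Finset.Icc 1 ⌊P⌋₊

/-- `α · G(x) = ∑ i, α_i G_i(x)`. -/
def phase {σ : Type*} {R : ℕ} (G : Fin R → MvPolynomial σ ℤ) (α : Fin R → ℝ) (x : σ → ℕ) : ℝ :=
  ∑ i, α i * ((MvPolynomial.eval (fun j => (x j : ℤ)) (G i) : ℤ) : ℝ)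

/-- `S_F(α)`, the sum of `λ(x) e(α · F(x))` over `1 ≤ x ≤ P`, where `λ(x)` is the product of the
`λ_j(x_j)`. -/
def expSum {σ : Type*} [Fintype σ] [DecidableEq σ] {R : ℕ} (lam : σ → ℕ → ℝ)
    (F : Fin R → MvPolynomial σ ℤ) (P : ℝ) (α : Fin R → ℝ) : ℂ :=
  ∑ x ∈ box σ P, ((∏ j, lam j (x j) : ℝ) : ℂ) * e (phase F α x)

/-- The inner sum of `λ(w) e(α · h(y,z,w))` over `1 ≤ w ≤ P`; here `v = (y,z)`. -/
def innerSum {m s t R : ℕ} (lam : (Fin m ⊕ Fin s) ⊕ Fin t → ℕ → ℝ)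
    (h : Fin R → MvPolynomial ((Fin m ⊕ Fin s) ⊕ Fin t) ℤ) (P : ℝ)
    (v : Fin m ⊕ Fin s → ℕ) (α : Fin R → ℝ) : ℂ :=
  ∑ w ∈ box (Fin t) P,
    ((∏ j, lam (Sum.inr j) (w j) : ℝ) : ℂ) * e (phase h α (Sum.elim v w))

/-- The supremum of the absolute values of the inner sums over `α ∈ 𝔫` and over all `(y,z)` with
`1 ≤ y ≤ P` and `1 ≤ z ≤ P`. The set is bounded whenever the `λ_j` are; the supremum of the empty
set is `0`. -/
def supInner {m s t R : ℕ} (lam : (Fin m ⊕ Fin s) ⊕ Fin t → ℕ → ℝ)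
    (h : Fin R → MvPolynomial ((Fin m ⊕ Fin s) ⊕ Fin t) ℤ) (P : ℝ)
    (𝔫 : Set (Fin R → ℝ)) : ℝ :=
  sSup {r : ℝ | ∃ α ∈ 𝔫, ∃ v ∈ box (Fin m ⊕ Fin s) P, r = ‖innerSum lam h P v α‖}

end

end FormsPrime

/-! ### Krull dimension: integral extensions and polynomial subrings -/

namespace FormsPrime
open MvPolynomial Cardinal

/-! Write `S_F(α) = ∑_y λ(y) e(α·f(y)) T_y(α)`, where `T_y` (`middleSum`) carries the sums over `z`
and `w`. Cauchy–Schwarz in `y` removes `λ(y)` and leaves `∑_y |∫ e(α·f(y)) T_y(α) dα|²`. Opened up,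
this is a double integral over `α, β` of `∑_y e((α-β)·f(y)) T_y(α) conj(T_y(β))`. Since `g` and `h`
have degree below `d` in `y`, each `T_y` is a weighted sum of polynomial phases of degree at most `k
= d - 1` in `y`. Weyl's inequality for forms of degree `d` does not see such phases, so the factors
`T_y` cost only their trivial size (`IsTame`).

When `γ = α - β` lies off the major arcs, Weyl's inequality applies. A dyadic decomposition of the
arcs majorizes the bound by a function of `γ` with integral `≪ X^(R+1-A) P^(-Rd)` up to the
normalization of the sum; here the Weyl exponent `A` exceeds `R + 1`, which is the hypothesis on
`κ₁, κ₂`. When `γ` lies on the major arcs, a set of measure `≪ X^(R+1) P^(-Rd)`, the inequality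
`|ab| ≤ (|a|² + |b|²)/2` and Schur's test leave the energy `J = ∑_y ∫ |T_y|²`. This is the large
sieve `exists_sum_norm_integral_sq_le`.

To bound `J`, one of the two factors `T_y` is opened as a sum over `z`. After Cauchy–Schwarz in `(y,
z)` the same sieve applies to the system `g` with amplitude `ℰ · conj(T_y)`, and its major arc term
is at most `sup(ℰ)² P^s J`. The outcome is a quadratic inequality `J² ≤ W² + V J`, so `J ≤ W + V`.
The minor arcs of `f`, the minor arcs of `g` and the major arcs of both give the three terms of the
theorem.

Weyl's inequality (`exists_norm_sum_le`) is Birch's. Differencing `k` times reduces the sum to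
counting tuples of directions at which all polar forms of `γ·G` are nearly integral, and Davenport's
lemma (`exists_nearCount_le`) shrinks the directions to size `Y`. If an `R × R` minor of the matrix
of polar forms is nonzero at a counted tuple, Cramer's rule (`exists_approx_of_det_ne_zero`) puts
`γ` on a major arc. Otherwise the tuples lie on a variety whose intersection with the diagonal is
the singular locus, and each of the `(k-1)N` equations of the diagonal lowers the dimension by at
most one.

The integral points of that variety are counted with Hilbert functions. Points in a grid are
separated by polynomials of controlled degree (`card_le_hilbertFun`), the growth of a Hilbert
function is governed by the sets of variables independent modulo the ideal (`exists_hilbertFun_le`),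
and a linear section lowers the growth exponent by at most one. -/

theorem ringKrullDim_le_of_isIntegral_of_injective {A B : Type*} [CommRing A] [CommRing B]
    (f : A →+* B) (hf : Function.Injective f) (hi : f.IsIntegral) :
    ringKrullDim A ≤ ringKrullDim B := by
  algebraize [f]
  have : Algebra.IsIntegral A B := ⟨hi⟩
  -- Lying over lifts the bottom prime of a chain; going up then extends the lifted chain one prime
  -- at a time.
  have key : ∀ n : ℕ, ∀ l : LTSeries (PrimeSpectrum A), l.length = n →
      ∃ l' : LTSeries (PrimeSpectrum B), l'.length = n ∧
        l'.last.comap (algebraMap A B) = l.last := by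
    intro n
    induction n with
    | zero =>
      intro l hl
      obtain ⟨Q, -, hQ, hQP⟩ := Ideal.exists_ideal_over_prime_of_isIntegral
        l.last.asIdeal (⊥ : Ideal B) (by
          exact (Ideal.comap_bot_of_injective f hf).le.trans bot_le)
      refine ⟨RelSeries.singleton _ ⟨Q, hQ⟩, rfl, ?_⟩
      ext1
      exact hQP
    | succ n ih =>
      intro l hl
      obtain ⟨l', hl', hlast⟩ := ih l.eraseLast (by simp [hl])
      have hlt : l.eraseLast.last < l.last := by
        apply l.eraseLast_last_rel_last
        omega
      obtain ⟨Q, hle, hQ, hQP⟩ := Ideal.exists_ideal_over_prime_of_isIntegral_of_isPrime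
        l.last.asIdeal l'.last.asIdeal (by
          have := congrArg PrimeSpectrum.asIdeal hlast
          change Ideal.comap _ _ = _ at this
          rw [this]; exact hlt.le)
      -- The inclusion is strict because the two primes contract to different primes of `A`.
      have hQlt : l'.last < ⟨Q, hQ⟩ := by
        refine lt_of_le_of_ne hle ?_
        intro h1
        have h2 : l.eraseLast.last = l.last := by
          rw [← hlast, h1]; ext1; exact hQP
        exact hlt.ne h2
      refine ⟨l'.snoc ⟨Q, hQ⟩ hQlt, by simp [hl'], ?_⟩
      · rw [RelSeries.last_snoc]; ext1; exact hQP
  unfold ringKrullDim Order.krullDim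
  refine iSup_le fun l => ?_
  obtain ⟨l', h1, -⟩ := key _ l rfl
  exact le_iSup_of_le l' (by rw [h1])

/-- Some prime `p` of `A` contracts to zero, so the polynomial ring embeds in the domain `A ⧸ p`.
Noether normalization makes `A ⧸ p` integral over `s` variables. Its transcendence degree is then
`s`, which is at least the number of variables of `ι` and at most the dimension of `A`. -/
theorem card_le_ringKrullDim_of_injective {K A ι : Type*} [Field K] [CommRing A] [Algebra K A]
    [Algebra.FiniteType K A] [Fintype ι] (φ : MvPolynomial ι K →ₐ[K] A)
    (hφ : Function.Injective φ) : ((Fintype.card ι : ℕ) : WithBot ℕ∞) ≤ ringKrullDim A := by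
  -- `A` need not be a domain; minimal primes of a subring are always contractions of primes.
  have hb : (⊥ : Ideal (MvPolynomial ι K)) ∈ minimalPrimes (MvPolynomial ι K) := by
    rw [IsDomain.minimalPrimes_eq_singleton_bot]; rfl
  obtain ⟨p, hp, hpb⟩ := Ideal.exists_comap_eq_of_mem_minimalPrimes_of_injective
    (f := (φ : MvPolynomial ι K →+* A)) hφ ⊥ hb
  have : Nontrivial (A ⧸ p) := Ideal.Quotient.nontrivial_iff.mpr hp.ne_top
  obtain ⟨s, g, hg, hgi⟩ := exists_integral_inj_algHom_of_fg K (A ⧸ p)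
  let ψ : MvPolynomial ι K →ₐ[K] A ⧸ p := (Ideal.Quotient.mkₐ K p).comp φ
  have hψ : Function.Injective ψ := by
    rw [injective_iff_map_eq_zero]
    intro x hx
    have : φ x ∈ p := Ideal.Quotient.eq_zero_iff_mem.mp hx
    have h2 : x ∈ (p.comap (φ : MvPolynomial ι K →+* A)) := this
    rw [hpb] at h2
    exact h2
  have h1 : AlgebraicIndependent K (fun i => ψ (X i)) := by
    rw [algebraicIndependent_iff_injective_aeval]
    have : aeval (fun i => ψ (X i)) = ψ := by ext; simp
    rw [this]; exact hψ
  have h2 : AlgebraicIndependent K (fun i => g (X i)) := by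
    rw [algebraicIndependent_iff_injective_aeval]
    have : aeval (fun i => g (X i)) = g := by ext; simp
    rw [this]; exact hg
  have hint : Algebra.IsIntegral (Algebra.adjoin K (Set.range fun i => g (X i))) (A ⧸ p) := by
    constructor
    intro x
    obtain ⟨q, hq, hqx⟩ := hgi x
    let g' : MvPolynomial (Fin s) K →+* Algebra.adjoin K (Set.range fun i => g (X i)) :=
      (g.codRestrict (Algebra.adjoin K (Set.range fun i => g (X i))) (by
        intro y
        rw [Algebra.adjoin_range_eq_range_aeval]
        refine ⟨y, ?_⟩
        have : aeval (fun i => g (X i)) = g := by ext; simp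
        exact congrArg (fun f : MvPolynomial (Fin s) K →ₐ[K] A ⧸ p => f y) this)).toRingHom
    refine ⟨q.map g', hq.map _, ?_⟩
    rw [Polynomial.eval₂_map]
    exact hqx
  have h3 : IsTranscendenceBasis K (fun i => g (X i)) :=
    isTranscendenceBasis_iff_algebraicIndependent_isAlgebraic.mpr ⟨h2, inferInstance⟩
  have h4 := h1.lift_cardinalMk_le_trdeg
  have h5 := h3.lift_cardinalMk_eq_trdeg
  have h6 : Fintype.card ι ≤ s := by
    simp only [mk_fintype, Fintype.card_fin, lift_natCast] at h4 h5
    rw [← Cardinal.lift_inj.{_, 0}] at h5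
    simp at h4 h5
    rw [← h5] at h4
    exact_mod_cast h4
  calc ((Fintype.card ι : ℕ) : WithBot ℕ∞) ≤ (s : ℕ) := by exact_mod_cast h6
    _ = ringKrullDim (MvPolynomial (Fin s) K) := by
        rw [MvPolynomial.ringKrullDim_of_isNoetherianRing]
        simp [ringKrullDim_eq_zero_of_field]
    _ ≤ ringKrullDim (A ⧸ p) := ringKrullDim_le_of_isIntegral_of_injective g.toRingHom hg hgi
    _ ≤ ringKrullDim A := ringKrullDim_quotient_le p

end FormsPrime

/-! ### Hilbert functions: interpolation on grids and linear sections -/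

namespace FormsPrime
open MvPolynomial

noncomputable section

/-- The dimension of the space of polynomials of degree at most `n` modulo `I`. -/
def hilbertFun {τ K : Type*} [Field K] (I : Ideal (MvPolynomial τ K)) (n : ℕ) : ℕ :=
  Module.finrank K ((restrictTotalDegree τ K n).map (Ideal.Quotient.mkₐ K I).toLinearMap)

/-- Evaluation at the points of `Z` factors through the quotient by `I`. It is onto `K ^ Z` already
on polynomials of degree at most `|τ| |S|`, by interpolation on the grid `S ^ τ`. -/
theorem card_le_hilbertFun {τ K : Type*} [Field K] [Fintype τ]
    (I : Ideal (MvPolynomial τ K)) (S : Finset K) (Z : Finset (τ → K))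
    (hS : ∀ z ∈ Z, ∀ i, z i ∈ S) (hI : ∀ z ∈ Z, ∀ p ∈ I, eval z p = 0) :
    Z.card ≤ hilbertFun I (Fintype.card τ * S.card) := by
  classical
  let ev0 : MvPolynomial τ K →ₐ[K] (Z → K) := AlgHom.pi fun z => aeval z.1
  have hev0 : ∀ p z, ev0 p z = eval z.1 p := fun p z => by
    rw [← MvPolynomial.coe_aeval_eq_eval]; rfl
  let ev : (MvPolynomial τ K ⧸ I) →ₐ[K] (Z → K) := Ideal.Quotient.liftₐ I ev0 (by
    intro p hp
    funext z
    rw [hev0]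
    exact hI z.1 z.2 p hp)
  have hev : ∀ p z, ev (Ideal.Quotient.mkₐ K I p) z = eval z.1 p := by
    intro p z
    rw [← hev0]; rfl
  set n := Fintype.card τ * S.card
  set W := (restrictTotalDegree τ K n).map (Ideal.Quotient.mkₐ K I).toLinearMap with hW
  have htop : W.map ev.toLinearMap = ⊤ := by
    rw [eq_top_iff]
    intro f _
    rw [← Finset.univ_sum_single f]
    refine Submodule.sum_mem _ fun z _ => ?_
    -- An interpolation polynomial: among the points of the grid it is nonzero only at `z`.
    let q : MvPolynomial τ K := ∏ i, ∏ a ∈ S.erase (z.1 i), (X i - C a)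
    have hqdeg : q.totalDegree ≤ n := by
      refine (totalDegree_finsetProd _ _).trans ?_
      calc ∑ i, (∏ a ∈ S.erase (z.1 i), (X i - C a : MvPolynomial τ K)).totalDegree
          ≤ ∑ i : τ, S.card := by
            refine Finset.sum_le_sum fun i _ => ?_
            refine (totalDegree_finsetProd _ _).trans ?_
            calc ∑ a ∈ S.erase (z.1 i), (X i - C a : MvPolynomial τ K).totalDegree
                ≤ ∑ a ∈ S.erase (z.1 i), 1 := by
                  refine Finset.sum_le_sum fun a _ => ?_
                  refine (totalDegree_sub_C_le _ _).trans ?_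
                  simp
              _ ≤ S.card := by simpa using Finset.card_erase_le
        _ = n := by simp [n]
    have hq1 : eval z.1 q ≠ 0 := by
      simp only [q, map_prod, map_sub, eval_X, eval_C]
      refine Finset.prod_ne_zero_iff.mpr fun i _ => Finset.prod_ne_zero_iff.mpr fun a ha => ?_
      rw [sub_ne_zero]
      exact (Finset.ne_of_mem_erase ha).symm
    have hq0 : ∀ z' : Z, z' ≠ z → eval z'.1 q = 0 := by
      intro z' hz'
      have : ∃ i, z'.1 i ≠ z.1 i := by
        by_contra! h
        exact hz' (Subtype.ext (funext h))
      obtain ⟨i, hi⟩ := this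
      simp only [q, map_prod, map_sub, eval_X, eval_C]
      refine Finset.prod_eq_zero (Finset.mem_univ i) ?_
      exact Finset.prod_eq_zero (Finset.mem_erase.mpr ⟨hi, hS _ z'.2 i⟩) (sub_self _)
    refine ⟨Ideal.Quotient.mkₐ K I ((f z / eval z.1 q) • q), ⟨_, ?_, rfl⟩, ?_⟩
    · rw [SetLike.mem_coe, mem_restrictTotalDegree]
      exact (totalDegree_smul_le _ _).trans hqdeg
    · funext z'
      have h1 := hev ((f z / eval z.1 q) • q) z'
      refine h1.trans ?_
      rw [smul_eval]
      by_cases hz : z' = z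
      · subst hz
        rw [Pi.single_eq_same, div_mul_cancel₀ _ hq1]
      · rw [Pi.single_eq_of_ne hz, hq0 z' hz, mul_zero]
  have h1 : Module.finrank K (W.map ev.toLinearMap) ≤ Module.finrank K W :=
    Submodule.finrank_map_le _ _
  rw [htop, finrank_top] at h1
  rw [Module.finrank_pi, Fintype.card_coe] at h1
  exact h1

/-- Right exactness in bounded degree: what dies modulo `l` in degree at most `n + 1` is `l` times
something of degree at most `n`. Homogeneity of `I` is what allows the cofactor of `l` to be
truncated. -/
theorem hilbertFun_succ_le {τ K : Type*} [Field K] [Fintype τ] (I : Ideal (MvPolynomial τ K))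
    (hI : ∀ p ∈ I, ∀ j, homogeneousComponent j p ∈ I) (l : MvPolynomial τ K)
    (hl : l.IsHomogeneous 1) (n : ℕ) :
    hilbertFun I (n + 1) ≤ hilbertFun I n + hilbertFun (I ⊔ Ideal.span {l}) (n + 1) := by
  classical
  set I' := I ⊔ Ideal.span {l}
  have hII' : I ≤ I' := le_sup_left
  let π : (MvPolynomial τ K ⧸ I) →ₐ[K] (MvPolynomial τ K ⧸ I') := Ideal.Quotient.factorₐ K hII'
  let M : ℕ → Submodule K (MvPolynomial τ K ⧸ I) := fun n =>
    (restrictTotalDegree τ K n).map (Ideal.Quotient.mkₐ K I).toLinearMap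
  let μ : (MvPolynomial τ K ⧸ I) →ₗ[K] (MvPolynomial τ K ⧸ I) :=
    LinearMap.mulLeft K (Ideal.Quotient.mkₐ K I l)
  have hMmap : (M (n + 1)).map π.toLinearMap =
      (restrictTotalDegree τ K (n + 1)).map (Ideal.Quotient.mkₐ K I').toLinearMap := by
    rw [← Submodule.map_comp]
    rfl
  have hker : M (n + 1) ⊓ LinearMap.ker π.toLinearMap ≤ (M n).map μ := by
    rintro _ ⟨⟨p, hp, rfl⟩, hpk⟩
    rw [SetLike.mem_coe, mem_restrictTotalDegree] at hp
    have hpI' : p ∈ I' := by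
      have : Ideal.Quotient.mk I' p = 0 := hpk
      exact Ideal.Quotient.eq_zero_iff_mem.mp this
    obtain ⟨i, hi, r, hr, rfl⟩ := Submodule.mem_sup.mp hpI'
    obtain ⟨q, rfl⟩ := Ideal.mem_span_singleton'.mp hr
    -- The truncation of `q` to degree at most `n`. As `l` is linear, `q * l` and `q' * l` agree in
    -- degrees up to `n + 1`, so there the components of `i + q * l - q' * l` are those of `i`, and
    -- they lie in `I`.
    let q' : MvPolynomial τ K := ∑ j ∈ Finset.range (n + 1), homogeneousComponent j q
    have hcoef : ∀ m : τ →₀ ℕ, m.degree ≤ n → coeff m q' = coeff m q := by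
      intro m hm
      simp only [q', coeff_sum, coeff_homogeneousComponent]
      rw [Finset.sum_ite_eq]
      simp [Nat.lt_succ_of_le hm]
    have hq'deg : q'.totalDegree ≤ n := by
      refine totalDegree_finsetSum_le fun j hj => ?_
      exact (homogeneousComponent_isHomogeneous j q).totalDegree_le.trans
        (Nat.lt_succ_iff.mp (Finset.mem_range.mp hj))
    have hmul : ∀ j ≤ n + 1, homogeneousComponent j (q * l) = homogeneousComponent j (q' * l) := by
      intro j hj
      ext m
      rw [coeff_homogeneousComponent, coeff_homogeneousComponent]
      split_ifs with hm
      · rw [coeff_mul, coeff_mul]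
        refine Finset.sum_congr rfl fun x hx => ?_
        rw [Finset.HasAntidiagonal.mem_antidiagonal] at hx
        by_cases hx2 : coeff x.2 l = 0
        · rw [hx2, mul_zero, mul_zero]
        · have h1 : x.2.degree = 1 := by
            rw [Finsupp.degree_eq_weight_one]; exact hl hx2
          have h2 : x.1.degree + x.2.degree = m.degree := by rw [← hx]; simp
          rw [hcoef x.1 (by omega)]
      · rfl
    have hmem : (i + q * l) - q' * l ∈ I := by
      have hd : ((i + q * l) - q' * l).totalDegree ≤ n + 1 := by
        refine (totalDegree_sub _ _).trans (max_le hp ?_)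
        refine (totalDegree_mul _ _).trans (add_le_add hq'deg hl.totalDegree_le)
      rw [← sum_homogeneousComponent ((i + q * l) - q' * l)]
      refine Ideal.sum_mem _ fun j hj => ?_
      have hj' : j ≤ n + 1 := by
        have := Finset.mem_range.mp hj; omega
      rw [map_sub, map_add, hmul j hj', add_sub_cancel_right]
      exact hI i hi j
    refine ⟨Ideal.Quotient.mkₐ K I q', ⟨q', ?_, rfl⟩, ?_⟩
    · rw [SetLike.mem_coe, mem_restrictTotalDegree]; exact hq'deg
    · change Ideal.Quotient.mk I l * Ideal.Quotient.mk I q' = Ideal.Quotient.mk I _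
      rw [← map_mul, mul_comm l q']
      exact ((Ideal.Quotient.eq).mpr hmem).symm
  have hfin : ∀ n, FiniteDimensional K (M n) := fun n => by
    dsimp only [M]; infer_instance
  have h1 := LinearMap.finrank_range_add_finrank_ker (π.toLinearMap.domRestrict (M (n + 1)))
  have h2 : LinearMap.range (π.toLinearMap.domRestrict (M (n + 1))) =
      (M (n + 1)).map π.toLinearMap := by
    rw [LinearMap.range_domRestrict]
  have h3 : Module.finrank K (LinearMap.ker (π.toLinearMap.domRestrict (M (n + 1)))) ≤
      Module.finrank K (M n) := by
    have h4 : (LinearMap.ker (π.toLinearMap.domRestrict (M (n + 1)))).map (M (n + 1)).subtype ≤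
        (M n).map μ := by
      refine le_trans ?_ hker
      rintro _ ⟨x, hx, rfl⟩
      exact ⟨x.2, hx⟩
    calc _ = Module.finrank K ((LinearMap.ker (π.toLinearMap.domRestrict (M (n + 1)))).map
          (M (n + 1)).subtype) := (Submodule.finrank_map_subtype_eq _ _).symm
      _ ≤ Module.finrank K ((M n).map μ) := Submodule.finrank_mono h4
      _ ≤ _ := Submodule.finrank_map_le _ _
  rw [h2, hMmap] at h1
  change Module.finrank K (M (n + 1)) ≤ Module.finrank K (M n) + Module.finrank K _
  rw [← h1]
  omega

/-- Summation of the increments: a linear section lowers the growth exponent by at most one. -/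
theorem hilbertFun_le_of_sup_span {τ K : Type*} [Field K] [Fintype τ]
    (I : Ideal (MvPolynomial τ K)) (hI : ∀ p ∈ I, ∀ j, homogeneousComponent j p ∈ I)
    (l : MvPolynomial τ K) (hl : l.IsHomogeneous 1) (k C : ℕ)
    (h : ∀ n, hilbertFun (I ⊔ Ideal.span {l}) n ≤ C * (n + 1) ^ k) (n : ℕ) :
    hilbertFun I n ≤ (hilbertFun I 0 + C) * (n + 1) ^ (k + 1) := by
  induction n with
  | zero => simp
  | succ n ih =>
    have h1 := hilbertFun_succ_le I hI l hl n
    have h2 := h (n + 1)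
    have h3 : (n + 1) ^ (k + 1) ≤ (n + 1) * (n + 1 + 1) ^ k := by
      rw [pow_succ, mul_comm]
      exact Nat.mul_le_mul_left _ (Nat.pow_le_pow_left (by omega) _)
    calc hilbertFun I (n + 1) ≤ (hilbertFun I 0 + C) * ((n + 1) * (n + 1 + 1) ^ k) +
          C * (n + 1 + 1) ^ k := by
          refine h1.trans (add_le_add (ih.trans (Nat.mul_le_mul_left _ h3)) h2)
      _ ≤ (hilbertFun I 0 + C) * ((n + 1) * (n + 1 + 1) ^ k) +
          (hilbertFun I 0 + C) * (n + 1 + 1) ^ k := by gcongr; omega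
      _ = _ := by ring

end
end FormsPrime

/-! ### Growth of Hilbert functions through leading monomials -/

namespace FormsPrime
open MvPolynomial

/-- Standard monomials span: modulo `J`, a leading monomial is a combination of smaller ones, and
induction along the monomial order applies to these. The condition `hm` that the order refines the
degree keeps all of them in degree at most `n`. -/
theorem mk_monomial_mem_span_of_leading {τ K : Type*} [Field K] [Fintype τ] (m : MonomialOrder τ)
    (hm : ∀ u v : τ →₀ ℕ, m.toSyn v ≤ m.toSyn u → v.degree ≤ u.degree)
    (J : Ideal (MvPolynomial τ K)) (n : ℕ) (T : Finset (τ →₀ ℕ))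
    (hT : ∀ u : τ →₀ ℕ, u.degree ≤ n → (∀ p ∈ J, p ≠ 0 → m.degree p ≠ u) → u ∈ T) (s : m.syn) :
    ∀ u : τ →₀ ℕ, m.toSyn u = s → u.degree ≤ n →
      Ideal.Quotient.mkₐ K J (monomial u 1) ∈ Submodule.span K
        ((fun u => Ideal.Quotient.mkₐ K J (monomial u 1)) '' (T : Set (τ →₀ ℕ))) := by
  classical
  let mk := (Ideal.Quotient.mkₐ K J).toLinearMap
  have hlin : ∀ p : MvPolynomial τ K, mk p = 0 ↔ p ∈ J := fun p => Ideal.Quotient.eq_zero_iff_mem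
  induction s using WellFoundedLT.induction with
  | ind s ih =>
    intro u hs hu
    by_cases hU : ∀ p ∈ J, p ≠ 0 → m.degree p ≠ u
    · exact Submodule.subset_span (Set.mem_image_of_mem _ (Finset.mem_coe.mpr (hT u hu hU)))
    · push Not at hU
      obtain ⟨p, hpJ, hp0, hpu⟩ := hU
      have hc : coeff u p ≠ 0 := by
        rw [← hpu]
        exact m.coeff_degree_ne_zero_iff.mpr hp0
      have h1 : (coeff u p) • mk (monomial u 1) =
          - ∑ v ∈ p.support.erase u, coeff v p • mk (monomial v 1) := by
        rw [eq_neg_iff_add_eq_zero]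
        rw [Finset.add_sum_erase p.support (fun v => coeff v p • mk (monomial v 1))
          (mem_support_iff.mpr hc)]
        have h2 : ∑ v ∈ p.support, coeff v p • mk (monomial v 1) = mk p := by
          conv_rhs => rw [p.as_sum]
          rw [map_sum]
          refine Finset.sum_congr rfl fun v _ => ?_
          rw [← map_smul, smul_monomial, smul_eq_mul, mul_one]
        rw [h2, hlin]
        exact hpJ
      have h3 : mk (monomial u 1) = (coeff u p)⁻¹ •
          (- ∑ v ∈ p.support.erase u, coeff v p • mk (monomial v 1)) := by
        rw [← h1, smul_smul, inv_mul_cancel₀ hc, one_smul]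
      change mk (monomial u 1) ∈ _
      rw [h3]
      refine Submodule.smul_mem _ _ (Submodule.neg_mem _ (Submodule.sum_mem _ fun v hv => ?_))
      refine Submodule.smul_mem _ _ ?_
      obtain ⟨hvu, hvp⟩ := Finset.mem_erase.mp hv
      have hlt : m.toSyn v < m.toSyn u := by
        refine lt_of_le_of_ne ?_ fun h => hvu (m.toSyn.injective h)
        rw [← hpu]
        exact m.le_degree hvp
      exact ih _ (hs ▸ hlt) v rfl ((hm u v hlt.le).trans hu)

theorem hilbertFun_le_card_of_leading {τ K : Type*} [Field K] [Fintype τ] (m : MonomialOrder τ)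
    (hm : ∀ u v : τ →₀ ℕ, m.toSyn v ≤ m.toSyn u → v.degree ≤ u.degree)
    (J : Ideal (MvPolynomial τ K)) (n : ℕ) (T : Finset (τ →₀ ℕ))
    (hT : ∀ u : τ →₀ ℕ, u.degree ≤ n → (∀ p ∈ J, p ≠ 0 → m.degree p ≠ u) → u ∈ T) :
    hilbertFun J n ≤ T.card := by
  classical
  have hle : (restrictTotalDegree τ K n).map (Ideal.Quotient.mkₐ K J).toLinearMap ≤
      Submodule.span K ((T.image fun u => Ideal.Quotient.mkₐ K J (monomial u 1) :
        Finset (MvPolynomial τ K ⧸ J)) : Set (MvPolynomial τ K ⧸ J)) := by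
    rw [Submodule.map_le_iff_le_comap]
    intro p hp
    rw [mem_restrictTotalDegree] at hp
    rw [p.as_sum]
    refine Submodule.sum_mem _ fun v hv => ?_
    have : monomial v (coeff v p) = coeff v p • monomial v (1 : K) := by
      rw [smul_monomial, smul_eq_mul, mul_one]
    rw [this]
    refine Submodule.smul_mem _ _ ?_
    rw [Submodule.mem_comap, Finset.coe_image]
    refine mk_monomial_mem_span_of_leading m hm J n T hT _ v rfl ?_
    have h1 := le_totalDegree hv
    rw [Finsupp.degree_eq_sum]
    rw [Finsupp.sum_fintype _ _ (fun _ => rfl)] at h1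
    exact h1.trans hp
  unfold hilbertFun
  have h1 := Submodule.finrank_mono hle
  exact h1.trans ((finrank_span_finset_le_card _).trans Finset.card_image_le)

/-- Every set `B` of more than `k` variables supports a nonzero `p B ∈ J`. If `M` bounds all
exponents of the leading monomials of these polynomials, a standard monomial has at most `k`
exponents above `M`; otherwise the leading monomial of some `p B` would divide it. So at most `k`
exponents range up to `n`, and the others up to `M`. -/
theorem exists_hilbertFun_le {τ K : Type*} [Field K] [Fintype τ] (J : Ideal (MvPolynomial τ K))
    (k : ℕ) (h : ∀ B : Finset τ, (∀ p ∈ J, (p.vars : Set τ) ⊆ B → p = 0) → B.card ≤ k) :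
    ∃ C : ℕ, ∀ n, hilbertFun J n ≤ C * (n + 1) ^ k := by
  classical
  let _ : LinearOrder τ := LinearOrder.lift' (Fintype.equivFin τ) (Equiv.injective _)
  have : WellFoundedGT τ := Finite.to_wellFoundedGT
  let m := MonomialOrder.degLex (σ := τ)
  have hP : ∀ B : Finset τ, ∃ p : MvPolynomial τ K,
      k < B.card → p ∈ J ∧ (p.vars : Set τ) ⊆ B ∧ p ≠ 0 := by
    intro B
    by_cases hB : k < B.card
    · have := mt (h B) (not_le.mpr hB)
      push Not at this
      obtain ⟨p, h1, h2, h3⟩ := this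
      exact ⟨p, fun _ => ⟨h1, h2, h3⟩⟩
    · exact ⟨0, fun h => absurd h hB⟩
  choose p hp using hP
  let M : ℕ := (Finset.univ : Finset (Finset τ)).sup fun B =>
    Finset.univ.sup fun i => m.degree (p B) i
  have hM : ∀ B i, m.degree (p B) i ≤ M := fun B i =>
    le_trans (Finset.le_sup (f := fun i => m.degree (p B) i) (Finset.mem_univ i))
      (Finset.le_sup (f := fun B => Finset.univ.sup fun i => m.degree (p B) i)
        (Finset.mem_univ B))
  let F : ℕ → Finset τ → Finset (τ → ℕ) := fun n B =>
    Fintype.piFinset fun i => if i ∈ B then Finset.range (n + 1) else Finset.range (M + 1)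
  let T : ℕ → Finset (τ →₀ ℕ) := fun n =>
    ((Finset.univ.filter fun B : Finset τ => B.card ≤ k).biUnion (F n)).image
      Finsupp.equivFunOnFinite.symm
  refine ⟨Fintype.card (Finset τ) * (M + 1) ^ Fintype.card τ, fun n => ?_⟩
  have h1 : hilbertFun J n ≤ (T n).card := by
    refine hilbertFun_le_card_of_leading m
      (fun u v huv => Finsupp.DegLex.monotone_degree huv) J n (T n) fun u hu hU => ?_
    refine Finset.mem_image.mpr ⟨u, ?_, by ext; simp⟩
    -- The large exponents of `u`. If there were more than `k`, the leading monomial of `p B` would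
    -- divide the monomial of `u`, since it involves only variables from `B`, with exponents at most
    -- `M`.
    let B : Finset τ := Finset.univ.filter fun i => M < u i
    refine Finset.mem_biUnion.mpr ⟨B, Finset.mem_filter.mpr ⟨Finset.mem_univ _, ?_⟩, ?_⟩
    · by_contra hB
      obtain ⟨hpJ, hpv, hp0⟩ := hp B (not_le.mp hB)
      have hle : m.degree (p B) ≤ u := by
        intro i
        by_cases hi : i ∈ B
        · exact (hM B i).trans (Finset.mem_filter.mp hi).2.le
        · have : m.degree (p B) i = 0 := by
            by_contra hne
            apply hi
            apply hpv
            rw [Finset.mem_coe, mem_vars_iff_mem_support]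
            exact ⟨m.degree (p B), m.degree_mem_support hp0, Finsupp.mem_support_iff.mpr hne⟩
          rw [this]; exact Nat.zero_le _
      refine hU (monomial (u - m.degree (p B)) 1 * p B) (J.mul_mem_left _ hpJ) ?_ ?_
      · exact mul_ne_zero (by simp) hp0
      · rw [m.degree_mul (by simp) hp0, MonomialOrder.degree_monomial, if_neg one_ne_zero]
        exact tsub_add_cancel_of_le hle
    · refine Fintype.mem_piFinset.mpr fun i => ?_
      by_cases hi : i ∈ B
      · rw [if_pos hi, Finset.mem_range, Nat.lt_succ_iff]
        exact (Finsupp.le_degree i u).trans hu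
      · rw [if_neg hi, Finset.mem_range, Nat.lt_succ_iff]
        by_contra hlt
        exact hi (Finset.mem_filter.mpr ⟨Finset.mem_univ _, not_le.mp hlt⟩)
  refine h1.trans ?_
  calc (T n).card ≤ ∑ B ∈ Finset.univ.filter (fun B : Finset τ => B.card ≤ k), (F n B).card :=
        Finset.card_image_le.trans Finset.card_biUnion_le
    _ ≤ ∑ B ∈ Finset.univ.filter (fun B : Finset τ => B.card ≤ k),
        (M + 1) ^ Fintype.card τ * (n + 1) ^ k := by
        refine Finset.sum_le_sum fun B hB => ?_
        have hBk := (Finset.mem_filter.mp hB).2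
        simp only [F, Fintype.card_piFinset]
        calc ∏ i, (if i ∈ B then Finset.range (n + 1) else Finset.range (M + 1)).card
            ≤ ∏ i : τ, (M + 1) * (if i ∈ B then n + 1 else 1) := by
              refine Finset.prod_le_prod' fun i _ => ?_
              split_ifs
              · simp only [Finset.card_range]; nlinarith [Nat.zero_le (M * (n + 1))]
              · simp
          _ = (M + 1) ^ Fintype.card τ * (n + 1) ^ B.card := by
              rw [Finset.prod_mul_distrib, Finset.prod_const, Finset.prod_ite_mem]
              simp
          _ ≤ _ := by
              gcongr; omega
    _ ≤ Fintype.card (Finset τ) * ((M + 1) ^ Fintype.card τ * (n + 1) ^ k) := by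
        rw [Finset.sum_const, smul_eq_mul]
        exact Nat.mul_le_mul_right _ (Finset.card_le_univ _)
    _ = _ := by ring

end FormsPrime

/-! ### Polar forms -/

namespace FormsPrime
open MvPolynomial

noncomputable section

/-- The exponent of the monomial `x_j ∏ x_{J a}`. -/
def polarExp {σ : Type*} {k : ℕ} (J : Fin k → σ) (j : σ) : σ →₀ ℕ :=
  Finsupp.single j 1 + ∑ a, Finsupp.single (J a) 1

/-- The partial derivative of `p` along `x_j` and all `x_{J a}`, at the origin. -/
def polarCoeff {σ A : Type*} [Fintype σ] [CommRing A] {k : ℕ} (p : MvPolynomial σ A)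
    (J : Fin k → σ) (j : σ) : A :=
  (∏ i, ((polarExp J j i).factorial : A)) * coeff (polarExp J j) p

/-- The coefficient of `x_j` in the `k`-th iterated directional derivative of a form of
degree `k + 1` along `h`. -/
def polar {σ A : Type*} [Fintype σ] [CommRing A] {k : ℕ} (p : MvPolynomial σ A)
    (h : Fin k → σ → A) (j : σ) : A :=
  ∑ J : Fin k → σ, (∏ a, h a (J a)) * polarCoeff p J j

/-- The derivative of `p` in the direction `h`. -/
def dirDeriv {σ A : Type*} [Fintype σ] [CommRing A] (h : σ → A) (p : MvPolynomial σ A) :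
    MvPolynomial σ A :=
  ∑ i, C (h i) * pderiv i p

variable {σ A : Type*} [CommRing A]

theorem pderiv_comm' (i j : σ) (p : MvPolynomial σ A) :
    pderiv i (pderiv j p) = pderiv j (pderiv i p) := by
  classical
  ext m
  simp only [coeff_pderiv, Finsupp.add_apply]
  rw [add_right_comm m]
  by_cases hij : i = j
  · subst hij; ring
  · rw [Finsupp.single_eq_of_ne (by exact fun h => hij h.symm),
      Finsupp.single_eq_of_ne (by exact fun h => hij h)]
    push_cast
    ring

theorem polarExp_cons {k : ℕ} (i : σ) (J : Fin k → σ) (j : σ) :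
    polarExp (Fin.cons i J : Fin (k + 1) → σ) j = polarExp J j + Finsupp.single i 1 := by
  simp only [polarExp, Fin.sum_univ_succ, Fin.cons_zero, Fin.cons_succ]
  abel

variable [Fintype σ]

theorem polarCoeff_pderiv {k : ℕ} (p : MvPolynomial σ A) (i : σ) (J : Fin k → σ) (j : σ) :
    polarCoeff (pderiv i p) J j = polarCoeff p (Fin.cons i J : Fin (k + 1) → σ) j := by
  classical
  simp only [polarCoeff, polarExp_cons, coeff_pderiv, Finsupp.add_apply]
  have : ∏ l, (((polarExp J j l + Finsupp.single i 1 l).factorial : ℕ) : A) =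
      (polarExp J j i + 1) * ∏ l, ((polarExp J j l).factorial : A) := by
    rw [← Finset.mul_prod_erase _ _ (Finset.mem_univ i),
      ← Finset.mul_prod_erase Finset.univ (fun l => ((polarExp J j l).factorial : A))
        (Finset.mem_univ i), ← mul_assoc]
    congr 1
    · rw [Finsupp.single_eq_same, Nat.factorial_succ]; push_cast; ring
    · refine Finset.prod_congr rfl fun l hl => ?_
      rw [Finsupp.single_eq_of_ne (Finset.ne_of_mem_erase hl), add_zero]
  rw [this]
  ring

theorem polarCoeff_sum {ι : Type*} {k : ℕ} (s : Finset ι) (p : ι → MvPolynomial σ A)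
    (J : Fin k → σ) (j : σ) : polarCoeff (∑ i ∈ s, p i) J j = ∑ i ∈ s, polarCoeff (p i) J j := by
  simp only [polarCoeff, coeff_sum, Finset.mul_sum]

theorem polarCoeff_C_mul {k : ℕ} (c : A) (p : MvPolynomial σ A) (J : Fin k → σ) (j : σ) :
    polarCoeff (C c * p) J j = c * polarCoeff p J j := by
  simp only [polarCoeff, coeff_C_mul]; ring

theorem polarCoeff_map {B : Type*} [CommRing B] (φ : A →+* B) {k : ℕ} (p : MvPolynomial σ A)
    (J : Fin k → σ) (j : σ) : polarCoeff (map φ p) J j = φ (polarCoeff p J j) := by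
  simp [polarCoeff, coeff_map]

theorem polar_sum {ι : Type*} {k : ℕ} (s : Finset ι) (p : ι → MvPolynomial σ A)
    (h : Fin k → σ → A) (j : σ) : polar (∑ i ∈ s, p i) h j = ∑ i ∈ s, polar (p i) h j := by
  simp only [polar, polarCoeff_sum, Finset.mul_sum]
  exact Finset.sum_comm

theorem polar_C_mul {k : ℕ} (c : A) (p : MvPolynomial σ A) (h : Fin k → σ → A) (j : σ) :
    polar (C c * p) h j = c * polar p h j := by
  simp only [polar, polarCoeff_C_mul, Finset.mul_sum]
  exact Finset.sum_congr rfl fun _ _ => by ring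

theorem polar_map {B : Type*} [CommRing B] (φ : A →+* B) {k : ℕ} (p : MvPolynomial σ A)
    (h : Fin k → σ → A) (j : σ) :
    polar (map φ p) (fun a l => φ (h a l)) j = φ (polar p h j) := by
  simp [polar, polarCoeff_map, map_sum, map_mul, map_prod]

/-- This recursion matches one Weyl differencing step, whose leading part is the derivative along
the first direction. -/
theorem polar_succ {k : ℕ} (p : MvPolynomial σ A) (h : Fin (k + 1) → σ → A) (j : σ) :
    polar p h j = polar (dirDeriv (h 0) p) (Fin.tail h) j := by
  simp only [polar, dirDeriv, polarCoeff_sum, polarCoeff_C_mul, polarCoeff_pderiv]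
  rw [← (Fin.consEquiv (fun _ : Fin (k + 1) => σ)).sum_comp, Fintype.sum_prod_type_right]
  refine Finset.sum_congr rfl fun J _ => ?_
  rw [Finset.mul_sum]
  refine Finset.sum_congr rfl fun i _ => ?_
  simp only [Fin.consEquiv, Equiv.coe_fn_mk, Fin.prod_univ_succ, Fin.cons_zero, Fin.cons_succ,
    Fin.tail]
  ring

theorem dirDeriv_isHomogeneous {p : MvPolynomial σ A} {n : ℕ} (hp : p.IsHomogeneous (n + 1))
    (h : σ → A) : (dirDeriv h p).IsHomogeneous n := by
  refine IsHomogeneous.sum _ _ _ fun i _ => ?_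
  have := (isHomogeneous_C σ (h i)).mul (hp.pderiv (i := i))
  simpa using this

/-- Euler's identity, applied once for each direction. On the diagonal the matrix of polar forms is
thus the Jacobian up to the factor `k!`. -/
theorem polar_diagonal {k : ℕ} (p : MvPolynomial σ A) (hp : p.IsHomogeneous (k + 1)) (x : σ → A)
    (j : σ) : polar p (fun _ : Fin k => x) j = (k.factorial : A) * eval x (pderiv j p) := by
  classical
  induction k generalizing p with
  | zero =>
    have h1 : (pderiv j p).IsHomogeneous 0 := by simpa using hp.pderiv (i := j)
    have h2 := (totalDegree_eq_zero_iff_eq_C.mp (Nat.le_zero.mp h1.totalDegree_le))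
    rw [h2]
    have h3 : ∏ i, ((polarExp (default : Fin 0 → σ) j i).factorial : A) = 1 := by
      refine Finset.prod_eq_one fun i _ => ?_
      simp only [polarExp, Finset.univ_eq_empty, Finset.sum_empty, add_zero]
      by_cases h : j = i <;> simp [h]
    simp only [polar, Fintype.sum_unique, polarCoeff, h3]
    simp [polarExp, coeff_pderiv]
  | succ k ih =>
    rw [polar_succ, show Fin.tail (fun _ : Fin (k + 1) => x) = fun _ => x from rfl,
      ih _ (dirDeriv_isHomogeneous hp x)]
    have h1 : eval x (pderiv j (dirDeriv x p)) = (k + 1 : ℕ) * eval x (pderiv j p) := by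
      have h2 : (pderiv j p).IsHomogeneous (k + 1) := by simpa using hp.pderiv (i := j)
      have h3 := congrArg (eval x) h2.sum_X_mul_pderiv
      simp only [map_sum, map_mul, eval_X, nsmul_eq_mul, map_natCast] at h3
      rw [← h3]
      simp only [dirDeriv, map_sum, pderiv_C_mul, map_mul, eval_C]
      exact Finset.sum_congr rfl fun i _ => by rw [pderiv_comm']
    rw [h1, Nat.factorial_succ]
    push_cast
    ring

/-- The coefficient `polarCoeff p J j` depends only on the multiset of `j` and the `J a`, so `j` may
be exchanged with one `J a`. This is the symmetry that Davenport's lemma needs. -/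
theorem polar_update_single_symm [DecidableEq σ] {k : ℕ} (p : MvPolynomial σ A)
    (h : Fin k → σ → A) (a : Fin k) (i j : σ) :
    polar p (Function.update h a (Pi.single i 1)) j =
      polar p (Function.update h a (Pi.single j 1)) i := by
  have key : ∀ i j : σ, polar p (Function.update h a (Pi.single i 1)) j =
      ∑ J ∈ Finset.univ.filter (fun J : Fin k → σ => J a = i),
        (∏ b ∈ Finset.univ.erase a, h b (J b)) * polarCoeff p J j := by
    intro i j
    rw [polar, Finset.sum_filter]
    refine Finset.sum_congr rfl fun J _ => ?_
    rw [← Finset.mul_prod_erase _ _ (Finset.mem_univ a), Function.update_self]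
    have : ∏ b ∈ Finset.univ.erase a, Function.update h a (Pi.single i 1) b (J b) =
        ∏ b ∈ Finset.univ.erase a, h b (J b) :=
      Finset.prod_congr rfl fun b hb => by
        rw [Function.update_of_ne (Finset.ne_of_mem_erase hb)]
    rw [this]
    by_cases hJ : J a = i
    · rw [if_pos hJ, hJ, Pi.single_eq_same, one_mul]
    · rw [if_neg hJ, Pi.single_eq_of_ne hJ, zero_mul, zero_mul]
  rw [key, key]
  refine Finset.sum_nbij' (fun J => Function.update J a j) (fun J => Function.update J a i)
    ?_ ?_ ?_ ?_ ?_
  · intro J _; simp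
  · intro J _; simp
  · intro J hJ
    rw [Finset.mem_filter] at hJ
    simp [← hJ.2]
  · intro J hJ
    rw [Finset.mem_filter] at hJ
    simp [← hJ.2]
  · intro J hJ
    rw [Finset.mem_filter] at hJ
    have h1 : polarExp (Function.update J a j) i = polarExp J j := by
      simp only [polarExp]
      rw [← Finset.add_sum_erase _ _ (Finset.mem_univ a),
        ← Finset.add_sum_erase _ (fun b => Finsupp.single (J b) 1) (Finset.mem_univ a),
        Function.update_self, hJ.2, add_left_comm]
      congr 2
      refine Finset.sum_congr rfl fun b hb => ?_
      rw [Function.update_of_ne (Finset.ne_of_mem_erase hb)]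
    rw [polarCoeff, polarCoeff, h1]
    congr 1
    refine Finset.prod_congr rfl fun b hb => ?_
    rw [Function.update_of_ne (Finset.ne_of_mem_erase hb)]

theorem polar_update [DecidableEq σ] {k : ℕ} (p : MvPolynomial σ A)
    (h : Fin k → σ → A) (a : Fin k) (u : σ → A) (j : σ) :
    polar p (Function.update h a u) j =
      ∑ i, polar p (Function.update h a (Pi.single i 1)) j * u i := by
  simp only [polar, Finset.sum_mul]
  rw [Finset.sum_comm]
  refine Finset.sum_congr rfl fun J _ => ?_
  have key : ∀ v : σ → A, ∏ b, Function.update h a v b (J b) =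
      v (J a) * ∏ b ∈ Finset.univ.erase a, h b (J b) := by
    intro v
    rw [← Finset.mul_prod_erase _ _ (Finset.mem_univ a), Function.update_self]
    congr 1
    exact Finset.prod_congr rfl fun b hb => by
      rw [Function.update_of_ne (Finset.ne_of_mem_erase hb)]
  simp only [key]
  rw [Finset.sum_eq_single (J a)]
  · simp; ring
  · intro i _ hi
    rw [Pi.single_eq_of_ne hi.symm]; ring
  · simp

end
end FormsPrime

/-! ### Tuples of directions at which the polar matrix is degenerate -/

namespace FormsPrime
open MvPolynomial

noncomputable section

theorem rank_lt_of_minors_eq_zero {σ : Type*} [Fintype σ] {R : ℕ} (M : Matrix (Fin R) σ ℂ)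
    (h : ∀ e : Fin R → σ, (M.submatrix id e).det = 0) : M.rank < R := by
  by_contra hlt
  have hR : Module.finrank ℂ (Submodule.span ℂ (Set.range M.col)) = R := by
    rw [← Matrix.rank_eq_finrank_span_cols]
    exact le_antisymm (by simpa using M.rank_le_card_height) (not_lt.mp hlt)
  obtain ⟨f, hf, -, hli⟩ := Submodule.exists_fun_fin_finrank_span_eq ℂ (Set.range M.col)
  choose e he using hf
  let e' : Fin R → σ := fun i => e (Fin.cast hR.symm i)
  have hli' : LinearIndependent ℂ (M.submatrix id e').col := by
    have : (M.submatrix id e').col = f ∘ Fin.cast hR.symm := by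
      funext i
      rw [Function.comp_apply, ← he]
      rfl
    rw [this]
    exact hli.comp _ (Fin.cast_injective _)
  have := (Matrix.linearIndependent_cols_iff_isUnit.mp hli')
  rw [Matrix.isUnit_iff_isUnit_det, h e'] at this
  exact not_isUnit_zero this

theorem isHomogeneous_det {τ A : Type*} [CommRing A] {R d : ℕ}
    (M : Matrix (Fin R) (Fin R) (MvPolynomial τ A)) (hM : ∀ i j, (M i j).IsHomogeneous d) :
    M.det.IsHomogeneous (R * d) := by
  rw [Matrix.det_apply]
  refine IsHomogeneous.sum _ _ _ fun π _ => ?_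
  have h1 : (∏ i, M (π i) i).IsHomogeneous (∑ _i : Fin R, d) :=
    IsHomogeneous.prod _ _ _ fun i _ => hM _ _
  rw [Finset.sum_const, Finset.card_univ, Fintype.card_fin, smul_eq_mul] at h1
  rcases Int.units_eq_one_or (Equiv.Perm.sign π) with h | h
  · rw [h, one_smul]; exact h1
  · rw [h, Units.neg_smul, one_smul]; exact h1.neg

theorem homogeneousComponent_mem_span {τ K : Type*} [Field K] (S : Set (MvPolynomial τ K))
    (hS : ∀ p ∈ S, ∃ n, p.IsHomogeneous n) :
    ∀ p ∈ Ideal.span S, ∀ j, homogeneousComponent j p ∈ Ideal.span S := by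
  intro p hp j
  let _ := MvPolynomial.gradedAlgebra (σ := τ) (R := K)
  exact homogeneousComponent_mem_of_mem (Ideal.homogeneous_span _ _ fun q hq => hS q hq) hp j

/-- Used for the equations of the diagonal, this replaces the dimension theorem for intersections:
cutting with `L` hyperplanes through the origin costs at most `L` in the exponent. -/
theorem exists_hilbertFun_le_of_linear_section {τ K : Type*} [Field K] [Fintype τ] (L : ℕ) :
    ∀ (S : Set (MvPolynomial τ K)) (_ : ∀ p ∈ S, ∃ n, p.IsHomogeneous n)
      (l : Fin L → MvPolynomial τ K) (_ : ∀ i, (l i).IsHomogeneous 1) (k : ℕ)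
      (_ : ∃ C : ℕ, ∀ n, hilbertFun (Ideal.span (S ∪ Set.range l)) n ≤ C * (n + 1) ^ k),
      ∃ C : ℕ, ∀ n, hilbertFun (Ideal.span S) n ≤ C * (n + 1) ^ (k + L) := by
  induction L with
  | zero =>
    intro S _ l _ k h
    simpa using h
  | succ L ih =>
    intro S hS l hl k h
    obtain ⟨C, hC⟩ := ih (S ∪ {l 0}) (by
      rintro p (hp | hp)
      · exact hS p hp
      · rw [Set.mem_singleton_iff] at hp; exact ⟨1, hp ▸ hl 0⟩) (Fin.tail l) (fun i => hl _) k (by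
      have : S ∪ {l 0} ∪ Set.range (Fin.tail l) = S ∪ Set.range l := by
        rw [Set.union_assoc]
        congr 1
        conv_rhs => rw [← Fin.cons_self_tail l, Fin.range_cons]
        rfl
      rwa [this])
    refine ⟨_, hilbertFun_le_of_sup_span (Ideal.span S) (homogeneousComponent_mem_span S hS)
      (l 0) (hl 0) (k + L) C fun n => ?_⟩
    rw [← Ideal.span_union]
    exact hC n

/-- The matrix of polar forms with the directions as variables. -/
def genericPolar {σ : Type*} [Fintype σ] {R : ℕ} (k : ℕ) (G : Fin R → MvPolynomial σ ℤ) :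
    Matrix (Fin R) σ (MvPolynomial (Fin k × σ) ℂ) :=
  Matrix.of fun i j => polar (map (algebraMap ℤ (MvPolynomial (Fin k × σ) ℂ)) (G i))
    (fun a l => X (a, l)) j

theorem genericPolar_isHomogeneous {σ : Type*} [Fintype σ] {R : ℕ} (k : ℕ)
    (G : Fin R → MvPolynomial σ ℤ) (i : Fin R) (j : σ) :
    (genericPolar k G i j).IsHomogeneous k := by
  refine IsHomogeneous.sum _ _ _ fun J _ => ?_
  rw [polarCoeff_map]
  have h1 : (∏ a, (X (a, J a) : MvPolynomial (Fin k × σ) ℂ)).IsHomogeneous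
      (∑ _a : Fin k, 1) := IsHomogeneous.prod _ _ _ fun a _ => isHomogeneous_X _ _
  have h2 : (algebraMap ℤ (MvPolynomial (Fin k × σ) ℂ) (polarCoeff (G i) J j)).IsHomogeneous 0 := by
    have := isHomogeneous_C (Fin k × σ) ((polarCoeff (G i) J j : ℤ) : ℂ)
    simpa using this
  simpa using h1.mul h2

theorem eval_genericPolar {σ : Type*} [Fintype σ] {R : ℕ} (k : ℕ)
    (G : Fin R → MvPolynomial σ ℤ) (i : Fin R) (j : σ) (z : Fin k × σ → ℂ) :
    eval z (genericPolar k G i j) =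
      polar (map (algebraMap ℤ ℂ) (G i)) (fun a l => z (a, l)) j := by
  have h := polar_map (eval z) (map (algebraMap ℤ (MvPolynomial (Fin k × σ) ℂ)) (G i))
    (fun a l => X (a, l)) j
  rw [map_map] at h
  have h2 : (eval z).comp (algebraMap ℤ (MvPolynomial (Fin k × σ) ℂ)) = algebraMap ℤ ℂ :=
    RingHom.ext_int _ _
  simp only [eval_X] at h
  rw [h2] at h
  exact h.symm

theorem zero_mem_singularLocus {σ : Type*} [Fintype σ] {R d : ℕ} (hR : 1 ≤ R) (hd : 2 ≤ d)
    (G : Fin R → MvPolynomial σ ℤ) (hG : ∀ i, (G i).IsHomogeneous d) :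
    (0 : σ → ℂ) ∈ singularLocus G := by
  have : jacobian G 0 = 0 := by
    ext i j
    have h1 := (hG i).pderiv (i := j)
    simp only [jacobian, Matrix.of_apply, Matrix.zero_apply, aeval_zero]
    rw [constantCoeff_eq, h1.coeff_eq_zero, map_zero]
    simp; omega
  change (jacobian G 0).rank < R
  rw [this, Matrix.rank_zero]
  omega

/-- The diagonal has `(k - 1) N` equations, where `N` is the number of variables, so it suffices to
bound the exponent after cutting with it. There the zero locus is the singular locus. By the
Nullstellensatz, variables independent modulo the cut ideal remain independent in the coordinate
ring of the singular locus, so their number is at most its dimension. -/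
theorem exists_hilbertFun_minors_le {σ : Type*} [Fintype σ] {R k : ℕ} (hR : 1 ≤ R) (hk : 0 < k)
    (G : Fin R → MvPolynomial σ ℤ) (hG : ∀ i, (G i).IsHomogeneous (k + 1)) :
    ∃ C : ℕ, ∀ n, hilbertFun
      (Ideal.span (Set.range fun e : Fin R → σ => ((genericPolar k G).submatrix id e).det)) n ≤
      C * (n + 1) ^ (affineDim (singularLocus G) + (k - 1) * Fintype.card σ) := by
  classical
  set S := Set.range fun e : Fin R → σ => ((genericPolar k G).submatrix id e).det with hSdef
  have hS : ∀ p ∈ S, ∃ n, p.IsHomogeneous n := by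
    rintro _ ⟨e, rfl⟩
    exact ⟨_, isHomogeneous_det _ fun i j => genericPolar_isHomogeneous k G _ _⟩
  let a0 : Fin k := ⟨0, hk⟩
  let D := {a : Fin k // a ≠ a0} × σ
  have hD : Fintype.card D = (k - 1) * Fintype.card σ := by
    rw [Fintype.card_prod, Fintype.card_subtype_compl]
    simp
  -- The equations of the diagonal: every direction is compared with the one indexed by `a0`.
  let l : D → MvPolynomial (Fin k × σ) ℂ := fun t => X (t.1.1, t.2) - X (a0, t.2)
  let l' : Fin ((k - 1) * Fintype.card σ) → MvPolynomial (Fin k × σ) ℂ :=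
    fun i => l ((Fintype.equivFinOfCardEq hD).symm i)
  have hrange : Set.range l' = Set.range l :=
    (Fintype.equivFinOfCardEq hD).symm.surjective.range_comp l
  refine exists_hilbertFun_le_of_linear_section _ S hS l' (fun i =>
    (isHomogeneous_X _ _).sub (isHomogeneous_X _ _)) _ ?_
  rw [hrange]
  set I := Ideal.span (S ∪ Set.range l) with hI
  refine exists_hilbertFun_le I _ fun B hB => ?_
  have hVne : (singularLocus G).Nonempty := ⟨0, zero_mem_singularLocus hR (by omega) G hG⟩
  let V := vanishingIdeal ℂ (singularLocus G)
  let δ : MvPolynomial (Fin k × σ) ℂ →ₐ[ℂ] MvPolynomial σ ℂ := aeval fun t => X t.2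
  let φ : MvPolynomial B ℂ →ₐ[ℂ] MvPolynomial σ ℂ ⧸ V :=
    (Ideal.Quotient.mkₐ ℂ V).comp (δ.comp (rename Subtype.val))
  have hφ : Function.Injective φ := by
    rw [injective_iff_map_eq_zero]
    intro p hp
    set q := rename Subtype.val p with hq
    have hqV : δ q ∈ V := Ideal.Quotient.eq_zero_iff_mem.mp hp
    -- Each zero of `I` is a diagonal point over a point of the singular locus, where `δ q`
    -- vanishes. The Nullstellensatz then puts a power of `q` in `I`, and this power involves only
    -- variables from `B`.
    have hqvan : q ∈ vanishingIdeal ℂ (zeroLocus ℂ I) := by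
      intro z hz
      have hdiag : ∀ t : Fin k × σ, z t = z (a0, t.2) := by
        rintro ⟨a, j⟩
        by_cases ha : a = a0
        · rw [ha]
        · have := hz (l (⟨a, ha⟩, j)) (Ideal.subset_span (Or.inr ⟨_, rfl⟩))
          simp only [l, map_sub, aeval_X] at this
          exact sub_eq_zero.mp this
      let x : σ → ℂ := fun j => z (a0, j)
      have hzx : z = fun t => x t.2 := funext hdiag
      have hx : x ∈ singularLocus G := by
        refine rank_lt_of_minors_eq_zero _ fun e => ?_
        have h1 := hz (((genericPolar k G).submatrix id e).det)
          (Ideal.subset_span (Or.inl ⟨e, rfl⟩))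
        replace h1 : eval z ((genericPolar k G).submatrix id e).det = 0 := h1
        rw [RingHom.map_det] at h1
        have h2 : (eval z).mapMatrix ((genericPolar k G).submatrix id e) =
            (k.factorial : ℂ) • (jacobian G x).submatrix id e := by
          ext i j
          simp only [RingHom.mapMatrix_apply, Matrix.map_apply, Matrix.submatrix_apply, id,
            Matrix.smul_apply, smul_eq_mul]
          rw [eval_genericPolar, hzx]
          have h3 := polar_diagonal (map (algebraMap ℤ ℂ) (G i)) ((hG i).map _) x (e j)
          refine h3.trans ?_
          rw [pderiv_map, eval_map]
          rfl
        rw [h2, Matrix.det_smul] at h1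
        refine (mul_eq_zero.mp h1).resolve_left (pow_ne_zero _ ?_)
        exact_mod_cast k.factorial_ne_zero
      have h1 := hqV x hx
      have h2 : (aeval x : MvPolynomial σ ℂ →ₐ[ℂ] ℂ).comp δ = aeval z := by
        ext t
        simp [δ, hzx]
      rw [← h2]
      exact h1
    rw [vanishingIdeal_zeroLocus_eq_radical] at hqvan
    obtain ⟨r, hr⟩ := hqvan
    have hqvars : (q.vars : Set (Fin k × σ)) ⊆ B := by
      intro t ht
      have := vars_rename Subtype.val p ht
      obtain ⟨s, -, rfl⟩ := Finset.mem_image.mp this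
      exact s.2
    have h0 := hB (q ^ r) hr (fun t ht => hqvars (vars_pow q r ht))
    have hq0 : q = 0 := eq_zero_of_pow_eq_zero h0
    exact rename_injective _ Subtype.val_injective (by rw [← hq, hq0, map_zero])
  have h1 := card_le_ringKrullDim_of_injective φ hφ
  rw [← coe_affineDim hVne, Fintype.card_coe] at h1
  exact_mod_cast h1

/-- The tuples lie in the grid of integers of absolute value at most `Y`, whose side is at most `3
Y`, so their number is at most the Hilbert function of the minors at a degree proportional to `Y`.
-/
theorem exists_card_minors_eq_zero_le {σ : Type*} [Fintype σ] {R k : ℕ} (hR : 1 ≤ R) (hk : 0 < k)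
    (G : Fin R → MvPolynomial σ ℤ) (hG : ∀ i, (G i).IsHomogeneous (k + 1)) :
    ∃ C : ℝ, 0 ≤ C ∧ ∀ Y : ℝ, 1 ≤ Y → ∀ Z : Finset (Fin k → σ → ℤ),
      (∀ h ∈ Z, ∀ a j, |(h a j : ℝ)| ≤ Y) →
      (∀ h ∈ Z, ∀ e : Fin R → σ, (Matrix.of fun i j => polar (G i) h (e j)).det = 0) →
      (Z.card : ℝ) ≤ C * Y ^ (affineDim (singularLocus G) + (k - 1) * Fintype.card σ) := by
  classical
  obtain ⟨C, hC⟩ := exists_hilbertFun_minors_le hR hk G hG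
  set D := affineDim (singularLocus G) + (k - 1) * Fintype.card σ
  refine ⟨C * (3 * (Fintype.card (Fin k × σ)) + 1) ^ D, by positivity, fun Y hY Z hZ hdet => ?_⟩
  let ι : (Fin k → σ → ℤ) → (Fin k × σ → ℂ) := fun h t => (h t.1 t.2 : ℂ)
  have hι : Function.Injective ι := by
    intro h h' hh
    funext a j
    exact Int.cast_injective (congrFun hh (a, j))
  let S : Finset ℂ := (Finset.Icc (-⌊Y⌋) ⌊Y⌋).image fun n : ℤ => (n : ℂ)
  have hScard : (S.card : ℝ) ≤ 3 * Y := by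
    have h1 : S.card ≤ (⌊Y⌋ + 1 - -⌊Y⌋).toNat := by
      rw [← Int.card_Icc]; exact Finset.card_image_le
    have h0 : 0 ≤ ⌊Y⌋ := Int.floor_nonneg.mpr (by linarith)
    have h2 : ((⌊Y⌋ + 1 - -⌊Y⌋).toNat : ℤ) = 2 * ⌊Y⌋ + 1 := by omega
    have h3 : ((⌊Y⌋ + 1 - -⌊Y⌋).toNat : ℝ) = 2 * (⌊Y⌋ : ℝ) + 1 := by exact_mod_cast h2
    have h4 : (S.card : ℝ) ≤ ((⌊Y⌋ + 1 - -⌊Y⌋).toNat : ℝ) := by exact_mod_cast h1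
    have h5 := Int.floor_le Y
    linarith
  have hcard : (Z.image ι).card = Z.card := Finset.card_image_of_injective _ hι
  have h1 := card_le_hilbertFun
    (Ideal.span (Set.range fun e : Fin R → σ => ((genericPolar k G).submatrix id e).det)) S
    (Z.image ι) (by
      intro z hz t
      obtain ⟨h, hh, rfl⟩ := Finset.mem_image.mp hz
      refine Finset.mem_image.mpr ⟨h t.1 t.2, ?_, rfl⟩
      have h1 := abs_le.mp (hZ h hh t.1 t.2)
      rw [Finset.mem_Icc]
      have h2 : h t.1 t.2 ≤ ⌊Y⌋ := Int.le_floor.mpr h1.2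
      have h3 : -h t.1 t.2 ≤ ⌊Y⌋ := Int.le_floor.mpr (by push_cast; linarith)
      omega) (by
      intro z hz p hp
      obtain ⟨h, hh, rfl⟩ := Finset.mem_image.mp hz
      have hle : Ideal.span (Set.range fun e : Fin R → σ =>
          ((genericPolar k G).submatrix id e).det) ≤ RingHom.ker (eval (ι h)) := by
        rw [Ideal.span_le]
        rintro _ ⟨e, rfl⟩
        rw [SetLike.mem_coe, RingHom.mem_ker, RingHom.map_det]
        have h2 : (eval (ι h)).mapMatrix ((genericPolar k G).submatrix id e) =
            (algebraMap ℤ ℂ).mapMatrix (Matrix.of fun i j => polar (G i) h (e j)) := by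
          ext i j
          simp only [RingHom.mapMatrix_apply, Matrix.map_apply, Matrix.submatrix_apply, id,
            Matrix.of_apply]
          rw [eval_genericPolar, ← polar_map]
          rfl
        rw [h2, ← RingHom.map_det, hdet h hh e, map_zero]
      exact RingHom.mem_ker.mp (hle hp))
  rw [hcard] at h1
  have h2 : (Z.card : ℝ) ≤ C * ((Fintype.card (Fin k × σ) * S.card : ℕ) + 1 : ℝ) ^ D := by
    have := h1.trans (hC _)
    exact_mod_cast this
  refine h2.trans ?_
  rw [mul_assoc, ← mul_pow]
  gcongr
  push_cast
  have : (0 : ℝ) ≤ Fintype.card (Fin k × σ) := by positivity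
  nlinarith

end
end FormsPrime

/-! ### Linear exponential sums and Weyl differencing -/

namespace FormsPrime
open MvPolynomial

noncomputable section

theorem e_add (x y : ℝ) : e (x + y) = e x * e y := by
  simp only [e, ← Complex.exp_add]; congr 1; push_cast; ring

theorem e_zero : e 0 = 1 := by simp [e]

theorem norm_e (x : ℝ) : ‖e x‖ = 1 := by
  rw [e, show 2 * (Real.pi : ℂ) * Complex.I * x = ((2 * Real.pi * x : ℝ) : ℂ) * Complex.I by
    push_cast; ring]
  exact Complex.norm_exp_ofReal_mul_I _

theorem e_neg (x : ℝ) : e (-x) = (starRingEnd ℂ) (e x) := by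
  simp only [e, ← Complex.exp_conj]
  congr 1
  simp [Complex.conj_ofNat]

theorem e_sub (x y : ℝ) : e (x - y) = e x * (starRingEnd ℂ) (e y) := by
  rw [sub_eq_add_neg, e_add, e_neg]

theorem e_sum {ι : Type*} (s : Finset ι) (f : ι → ℝ) : e (∑ i ∈ s, f i) = ∏ i ∈ s, e (f i) := by
  classical
  induction s using Finset.induction_on with
  | empty => simp [e_zero]
  | insert a s ha ih => rw [Finset.sum_insert ha, Finset.prod_insert ha, e_add, ih]

theorem e_int (n : ℤ) : e n = 1 := by
  rw [e, Complex.exp_eq_one_iff]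
  exact ⟨n, by push_cast; ring⟩

/-- A smooth majorant of `min (Q, 1 / (2 ‖b‖))`, where `‖b‖` is the distance to the nearest
integer. -/
def linBound (Q : ℕ) (b : ℝ) : ℝ := 2 * Q / (1 + 2 * Q * |b - round b|)

/-- `|e(b) - 1| = 2 |sin πb|`, together with Jordan's inequality. -/
theorem four_mul_le_norm_e_sub_one (b : ℝ) : 4 * |b - round b| ≤ ‖e b - 1‖ := by
  set t := b - round b with ht
  have h1 : e b = e t := by
    have : b = t + (round b : ℤ) := by rw [ht]; ring
    rw [this, e_add, e_int, mul_one]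
  have h2 : ‖e t - 1‖ = 2 * |Real.sin (Real.pi * t)| := by
    have := Complex.norm_exp_I_mul_ofReal_sub_one (2 * Real.pi * t)
    rw [e, show 2 * (Real.pi : ℂ) * Complex.I * t = Complex.I * ((2 * Real.pi * t : ℝ) : ℂ) by
      push_cast; ring, this, show 2 * Real.pi * t / 2 = Real.pi * t by ring]
    simp
  have h3 : |t| ≤ 1 / 2 := abs_sub_round b
  have h4 : |Real.sin (Real.pi * t)| = Real.sin (Real.pi * |t|) := by
    rcases abs_cases t with ⟨h, h0⟩ | ⟨h, h0⟩
    · rw [h, abs_of_nonneg]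
      exact Real.sin_nonneg_of_nonneg_of_le_pi (by positivity)
        (by nlinarith [Real.pi_pos, abs_le.mp h3])
    · rw [h, mul_neg, Real.sin_neg, abs_of_nonpos]
      rw [← neg_nonneg, ← Real.sin_neg]
      exact Real.sin_nonneg_of_nonneg_of_le_pi (by nlinarith [Real.pi_pos])
        (by nlinarith [Real.pi_pos, abs_le.mp h3])
  have h5 := Real.mul_le_sin (x := Real.pi * |t|) (by positivity)
    (by nlinarith [Real.pi_pos])
  rw [h1, h2, h4]
  have h6 : 2 / Real.pi * (Real.pi * |t|) = 2 * |t| := by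
    field_simp
  linarith

/-- With `t` the distance from `b` to the nearest integer, the trivial bound `Q` and the geometric
bound `1 / (2t)` add up to `‖S‖ (1 + 2Qt) ≤ 2Q`. -/
theorem norm_sum_Icc_e_le (Q : ℕ) (b : ℝ) (lo hi : ℤ) (h : hi - lo < Q) :
    ‖∑ x ∈ Finset.Icc lo hi, e (b * x)‖ ≤ linBound Q b := by
  set t := |b - round b| with ht
  have ht0 : 0 ≤ t := abs_nonneg _
  set S := ∑ x ∈ Finset.Icc lo hi, e (b * x) with hS
  have hQ : ‖S‖ ≤ Q := by
    refine (norm_sum_le _ _).trans ?_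
    simp only [norm_e, Finset.sum_const, nsmul_eq_mul, mul_one, Int.card_Icc]
    have : (hi + 1 - lo).toNat ≤ Q := by omega
    exact_mod_cast this
  have hgeom : ‖S‖ * (4 * t) ≤ 2 := by
    by_cases hle : lo ≤ hi
    · have key : ∀ n : ℕ, (∑ x ∈ Finset.Icc lo (lo + n), e (b * x)) * (e b - 1) =
          e (b * (lo + n + 1)) - e (b * lo) := by
        intro n
        induction n with
        | zero =>
          simp only [Nat.cast_zero, add_zero, Finset.Icc_self, Finset.sum_singleton]
          rw [mul_add, e_add, mul_one]; ring
        | succ n ih =>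
          have : Finset.Icc lo (lo + (n + 1 : ℕ)) =
              insert (lo + (n + 1 : ℕ)) (Finset.Icc lo (lo + n)) := by
            ext x; simp only [Finset.mem_Icc, Finset.mem_insert]; omega
          rw [this, Finset.sum_insert (by simp), add_mul, ih]
          have h1 : e (b * (lo + (n + 1 : ℕ) + 1)) = e (b * (lo + n + 1)) * e b := by
            rw [← e_add]; congr 1; push_cast; ring
          rw [h1]
          push_cast
          rw [add_assoc]
          ring
      obtain ⟨n, hn⟩ : ∃ n : ℕ, hi = lo + n := ⟨(hi - lo).toNat, by omega⟩
      have h1 := key n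
      rw [← hn, ← hS] at h1
      calc ‖S‖ * (4 * t) ≤ ‖S‖ * ‖e b - 1‖ := by
            gcongr; exact four_mul_le_norm_e_sub_one b
        _ = ‖e (b * (lo + n + 1)) - e (b * lo)‖ := by rw [← norm_mul, h1]
        _ ≤ 2 := by
            refine (norm_sub_le _ _).trans ?_
            rw [norm_e, norm_e]; norm_num
    · have : S = 0 := by rw [hS, Finset.Icc_eq_empty hle, Finset.sum_empty]
      rw [this]; simp
  rw [linBound, ← ht, le_div_iff₀ (by positivity)]
  have hQ0 : (0 : ℝ) ≤ Q := by positivity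
  nlinarith [norm_nonneg S]

theorem linBound_nonneg (Q : ℕ) (b : ℝ) : 0 ≤ linBound Q b := by
  unfold linBound; positivity

variable {σ : Type*} [Fintype σ]

/-- The `k`-th differences of `Φ` are affine functions with linear part `β`. -/
def IsDiffLinear : (k : ℕ) → ((σ → ℤ) → ℝ) → ((Fin k → σ → ℤ) → σ → ℝ) → Prop
  | 0, Φ, β => ∃ c, ∀ b x, Φ x = c + ∑ j, β b j * x j
  | k + 1, Φ, β => ∀ h, IsDiffLinear k (fun x => Φ (x + h) - Φ x) fun h' => β (Fin.cons h h')

variable [DecidableEq σ]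

/-- The integral points all of whose coordinates are at most `A` in absolute value. -/
def intBox (σ : Type*) [Fintype σ] [DecidableEq σ] (A : ℝ) : Finset (σ → ℤ) :=
  Fintype.piFinset fun _ => Finset.Icc (-⌊A⌋) ⌊A⌋

theorem mem_intBox {A : ℝ} {u : σ → ℤ} : u ∈ intBox σ A ↔ ∀ j, |(u j : ℝ)| ≤ A := by
  simp only [intBox, Fintype.mem_piFinset, Finset.mem_Icc]
  refine forall_congr' fun j => ?_
  rw [abs_le]
  constructor
  · rintro ⟨h1, h2⟩
    have h3 : -u j ≤ ⌊A⌋ := by omega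
    rw [Int.le_floor] at h2 h3
    push_cast at h3
    exact ⟨by linarith, h2⟩
  · rintro ⟨h1, h2⟩
    have h3 : -u j ≤ ⌊A⌋ := Int.le_floor.mpr (by push_cast; linarith)
    exact ⟨by omega, Int.le_floor.mpr h2⟩

theorem card_intBox_natCast (Q : ℕ) : (intBox σ (Q : ℝ)).card = (2 * Q + 1) ^ Fintype.card σ := by
  simp only [intBox, Fintype.card_piFinset, Int.card_Icc, Int.floor_natCast, Finset.prod_const,
    Finset.card_univ]
  congr 1
  omega

/-- Pairs of points of the box are written as `x, x + h`. For fixed `h` the admissible `x` form the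
intersection of the box with a translate, which is again a box, so that the estimate can be
iterated. -/
theorem normSq_sum_box_le (Q : ℕ) (lo hi : σ → ℤ) (h : ∀ j, hi j - lo j < Q)
    (Φ : (σ → ℤ) → ℝ) :
    ‖∑ x ∈ Fintype.piFinset (fun j => Finset.Icc (lo j) (hi j)), e (Φ x)‖ ^ 2 ≤
      ∑ h ∈ intBox σ (Q : ℝ), ‖∑ x ∈ Fintype.piFinset (fun j =>
        Finset.Icc (max (lo j) (lo j - h j)) (min (hi j) (hi j - h j))),
          e (Φ (x + h) - Φ x)‖ := by
  set A := Fintype.piFinset (fun j => Finset.Icc (lo j) (hi j)) with hA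
  have h1 : ((‖∑ x ∈ A, e (Φ x)‖ ^ 2 : ℝ) : ℂ) =
      ∑ h ∈ intBox σ (Q : ℝ), ∑ x ∈ Fintype.piFinset (fun j =>
        Finset.Icc (max (lo j) (lo j - h j)) (min (hi j) (hi j - h j))),
          e (Φ (x + h) - Φ x) := by
    have h2 : ∀ g : σ → ℤ, Fintype.piFinset (fun j =>
        Finset.Icc (max (lo j) (lo j - g j)) (min (hi j) (hi j - g j))) =
          A.filter fun x => x + g ∈ A := by
      intro g
      ext x
      simp only [hA, Finset.mem_filter, Fintype.mem_piFinset, Finset.mem_Icc, Pi.add_apply]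
      rw [← forall_and]
      refine forall_congr' fun j => ?_
      omega
    simp only [h2, Finset.sum_filter]
    rw [Finset.sum_comm]
    have h3 : ((‖∑ x ∈ A, e (Φ x)‖ ^ 2 : ℝ) : ℂ) =
        ∑ x ∈ A, ∑ y ∈ A, e (Φ y - Φ x) := by
      rw [Complex.ofReal_pow, ← Complex.mul_conj', map_sum, Finset.sum_mul_sum, Finset.sum_comm]
      refine Finset.sum_congr rfl fun x _ => Finset.sum_congr rfl fun y _ => ?_
      rw [e_sub]
    rw [h3]
    refine Finset.sum_congr rfl fun x hx => ?_
    rw [← Finset.sum_filter]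
    refine Finset.sum_nbij' (fun y => y - x) (fun g => x + g) ?_ ?_ ?_ ?_ ?_
    · intro y hy
      rw [Finset.mem_filter, add_sub_cancel]
      refine ⟨?_, hy⟩
      simp only [intBox, Fintype.mem_piFinset, Finset.mem_Icc, Int.floor_natCast, hA] at hx hy ⊢
      intro j
      have := hx j; have := hy j; have := h j
      simp only [Pi.sub_apply]
      omega
    · intro g hg
      exact (Finset.mem_filter.mp hg).2
    · intro y _; simp
    · intro g _; simp
    · intro y _; simp
  have h4 : ‖∑ x ∈ A, e (Φ x)‖ ^ 2 = ‖((‖∑ x ∈ A, e (Φ x)‖ ^ 2 : ℝ) : ℂ)‖ := by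
    rw [Complex.norm_real, Real.norm_of_nonneg (by positivity)]
  rw [h4, h1]
  exact norm_sum_le _ _

/-- Each step squares the sum and then uses the power mean inequality over the `(2Q+1)^N` shifts,
`N` being the number of variables. After `k` steps the phase is affine and the sum factors over the
coordinates. -/
theorem norm_sum_box_pow_le (Q : ℕ) (k : ℕ) : ∀ (lo hi : σ → ℤ) (_ : ∀ j, hi j - lo j < Q)
    (Φ : (σ → ℤ) → ℝ) (β : (Fin k → σ → ℤ) → σ → ℝ) (_ : IsDiffLinear k Φ β),
    ‖∑ x ∈ Fintype.piFinset (fun j => Finset.Icc (lo j) (hi j)), e (Φ x)‖ ^ (2 ^ k) ≤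
      (((2 * Q + 1) ^ Fintype.card σ : ℕ) : ℝ) ^ (2 ^ k - (k + 1)) *
        ∑ h ∈ Fintype.piFinset (fun _ : Fin k => intBox σ (Q : ℝ)), ∏ j, linBound Q (β h j) := by
  induction k with
  | zero =>
    intro lo hi hQ Φ β hΦ
    obtain ⟨c, hc⟩ := hΦ
    simp only [pow_zero, pow_one, zero_add, Nat.sub_self, one_mul]
    have h0 : Fintype.piFinset (fun _ : Fin 0 => intBox σ (Q : ℝ)) = {default} := by
      refine Finset.eq_singleton_iff_unique_mem.mpr ⟨?_, fun x _ => Subsingleton.elim _ _⟩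
      exact Fintype.mem_piFinset.mpr fun i => i.elim0
    rw [h0, Finset.sum_singleton]
    have h1 : ∀ x : σ → ℤ, e (Φ x) = e c * ∏ j, e (β default j * x j) := by
      intro x
      rw [hc default x, e_add, e_sum]
    simp only [h1]
    rw [← Finset.mul_sum, norm_mul, norm_e, one_mul,
      ← Finset.prod_univ_sum (fun j => Finset.Icc (lo j) (hi j))
        (fun j (n : ℤ) => e (β default j * n)), norm_prod]
    exact Finset.prod_le_prod (fun _ _ => norm_nonneg _)
      fun j _ => norm_sum_Icc_e_le Q _ _ _ (hQ j)
  | succ k ih =>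
    intro lo hi hQ Φ β hΦ
    set H := intBox σ (Q : ℝ) with hH
    have hHcard : H.card = (2 * Q + 1) ^ Fintype.card σ := card_intBox_natCast Q
    set M : ℝ := (((2 * Q + 1) ^ Fintype.card σ : ℕ) : ℝ) with hM
    have hMpos : 0 < M := by rw [hM]; positivity
    let a : (σ → ℤ) → ℝ := fun h => ‖∑ x ∈ Fintype.piFinset (fun j =>
        Finset.Icc (max (lo j) (lo j - h j)) (min (hi j) (hi j - h j))), e (Φ (x + h) - Φ x)‖
    have h1 : ∀ h, a h ^ (2 ^ k) ≤ M ^ (2 ^ k - (k + 1)) *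
        ∑ h' ∈ Fintype.piFinset (fun _ : Fin k => H), ∏ j, linBound Q (β (Fin.cons h h') j) := by
      intro h
      refine ih _ _ (fun j => ?_) _ _ (hΦ h)
      have := hQ j
      omega
    have h2 : ‖∑ x ∈ Fintype.piFinset (fun j => Finset.Icc (lo j) (hi j)), e (Φ x)‖ ^
        (2 ^ (k + 1)) ≤ M ^ (2 ^ k - 1) * ∑ h ∈ H, a h ^ (2 ^ k) := by
      calc _ = (‖∑ x ∈ Fintype.piFinset (fun j => Finset.Icc (lo j) (hi j)), e (Φ x)‖ ^ 2) ^
            (2 ^ k) := by rw [← pow_mul, pow_succ']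
        _ ≤ (∑ h ∈ H, a h) ^ (2 ^ k) := by
            gcongr; exact normSq_sum_box_le Q lo hi hQ Φ
        _ = (∑ h ∈ H, a h) ^ ((2 ^ k - 1) + 1) := by
            rw [Nat.sub_add_cancel Nat.one_le_two_pow]
        _ ≤ M ^ (2 ^ k - 1) * ∑ h ∈ H, a h ^ ((2 ^ k - 1) + 1) := by
            have := pow_sum_le_card_mul_sum_pow (s := H) (f := a)
              (fun h _ => norm_nonneg _) (2 ^ k - 1)
            rwa [hHcard] at this
        _ = _ := by rw [Nat.sub_add_cancel Nat.one_le_two_pow]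
    refine h2.trans ?_
    have h3 : ∑ h ∈ H, a h ^ (2 ^ k) ≤ M ^ (2 ^ k - (k + 1)) *
        ∑ h ∈ Fintype.piFinset (fun _ : Fin (k + 1) => H), ∏ j, linBound Q (β h j) := by
      have h4 : ∑ h ∈ Fintype.piFinset (fun _ : Fin (k + 1) => H), ∏ j, linBound Q (β h j) =
          ∑ h ∈ H, ∑ h' ∈ Fintype.piFinset (fun _ : Fin k => H),
            ∏ j, linBound Q (β (Fin.cons h h') j) := by
        rw [← Finset.sum_product']
        refine Finset.sum_nbij' (fun h => (h 0, Fin.tail h)) (fun p => Fin.cons p.1 p.2)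
          ?_ ?_ ?_ ?_ ?_
        · intro h hh
          rw [Fintype.mem_piFinset] at hh
          exact Finset.mem_product.mpr ⟨hh 0, Fintype.mem_piFinset.mpr fun i => hh i.succ⟩
        · intro p hp
          obtain ⟨hp1, hp2⟩ := Finset.mem_product.mp hp
          rw [Fintype.mem_piFinset] at hp2 ⊢
          intro i
          refine Fin.cases ?_ (fun i => ?_) i
          · simpa using hp1
          · simpa using hp2 i
        · intro h _; simp
        · intro p _; simp
        · intro h _; simp
      rw [h4, Finset.mul_sum]
      exact Finset.sum_le_sum fun h _ => h1 h
    -- The exponents of the number of shifts: `2^k - 1` from the power mean inequality and the rest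
    -- from the induction. The subtractions are genuine as `k + 1 ≤ 2^k`.
    have h5 : 2 ^ (k + 1) - (k + 1 + 1) = (2 ^ k - 1) + (2 ^ k - (k + 1)) := by
      have : k + 1 ≤ 2 ^ k := Nat.lt_two_pow_self
      rw [pow_succ]; omega
    rw [h5, pow_add, mul_assoc]
    gcongr

end
end FormsPrime

/-! ### Differences of polynomials and polar forms -/

namespace FormsPrime
open MvPolynomial

noncomputable section

variable {σ : Type*}

/-- The polynomial `p(x + h)`. -/
def shift (h : σ → ℝ) : MvPolynomial σ ℝ →ₐ[ℝ] MvPolynomial σ ℝ := aeval fun i => X i + C (h i)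

theorem eval_shift (h x : σ → ℝ) (p : MvPolynomial σ ℝ) :
    eval x (shift h p) = eval (x + h) p := by
  have : (aeval x : MvPolynomial σ ℝ →ₐ[ℝ] ℝ).comp (shift h) = aeval (x + h) := by
    ext i; simp [shift]
  have h2 := congrArg (fun f : MvPolynomial σ ℝ →ₐ[ℝ] ℝ => f p) this
  exact h2

/-- The polynomials of degree at most `n - c`, which is only `0` when `n < c`. -/
def degreeGap (σ : Type*) (c n : ℕ) : Submodule ℝ (MvPolynomial σ ℝ) :=
  restrictSupport ℝ {s : σ →₀ ℕ | s.degree + c ≤ n}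

theorem mem_degreeGap {c n : ℕ} {p : MvPolynomial σ ℝ} :
    p ∈ degreeGap σ c n ↔ ∀ s ∈ p.support, s.degree + c ≤ n := by
  rw [degreeGap, mem_restrictSupport_iff]
  exact Iff.rfl

theorem X_mul_mem_degreeGap {c n : ℕ} {p : MvPolynomial σ ℝ} (hp : p ∈ degreeGap σ c n) (i : σ) :
    X i * p ∈ degreeGap σ c (n + 1) := by
  classical
  rw [mem_degreeGap] at hp ⊢
  intro s hs
  have h1 := support_mul (X i) p hs
  obtain ⟨a, ha, b, hb, rfl⟩ := Finset.mem_add.mp h1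
  rw [support_X, Finset.mem_singleton] at ha
  subst ha
  have := hp b hb
  simp only [map_add, Finsupp.degree_single]
  omega

theorem degreeGap_mono {c n c' n' : ℕ} (h : n + c' ≤ n' + c) :
    degreeGap σ c n ≤ degreeGap σ c' n' := by
  intro p hp
  rw [mem_degreeGap] at hp ⊢
  intro s hs
  have := hp s hs
  omega

theorem mem_degreeGap_zero {n : ℕ} {p : MvPolynomial σ ℝ} :
    p ∈ degreeGap σ 0 n ↔ p.totalDegree ≤ n := by
  rw [mem_degreeGap, totalDegree, Finset.sup_le_iff]
  exact Iff.rfl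

variable [Fintype σ]

/-- Taylor expansion to first order. The three statements are proved together, since multiplication
by a variable feeds each remainder into the next one. -/
theorem shift_monomial_mem (h : σ → ℝ) (n : ℕ) : ∀ s : σ →₀ ℕ, s.degree = n →
    shift h (monomial s 1) ∈ degreeGap σ 0 n ∧
    shift h (monomial s 1) - monomial s 1 ∈ degreeGap σ 1 n ∧
    shift h (monomial s 1) - monomial s 1 - dirDeriv h (monomial s 1) ∈ degreeGap σ 2 n := by
  classical
  induction n with
  | zero =>
    intro s hs
    rw [Finsupp.degree_eq_zero_iff] at hs
    subst hs
    have h1 : shift h (monomial 0 1) = 1 := map_one _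
    rw [h1]
    refine ⟨?_, ?_, ?_⟩
    · rw [mem_degreeGap]
      intro s hs
      rw [mem_support_iff, coeff_one] at hs
      have : s = 0 := by
        by_contra h0
        exact hs (if_neg (Ne.symm h0))
      simp [this]
    · simp
    · simp [dirDeriv]
  | succ n ih =>
    intro s hs
    obtain ⟨i, hi⟩ : ∃ i, s i ≠ 0 := by
      by_contra! h0
      have : s = 0 := Finsupp.ext h0
      subst this
      simp at hs
    obtain ⟨s', rfl⟩ : ∃ s', s = Finsupp.single i 1 + s' :=
      ⟨s - Finsupp.single i 1, (add_tsub_cancel_of_le (by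
        rw [Finsupp.single_le_iff]; omega)).symm⟩
    have hs' : s'.degree = n := by
      simp at hs; omega
    obtain ⟨h0, h1, h2⟩ := ih s' hs'
    set m : MvPolynomial σ ℝ := monomial s' 1 with hm
    have hmon : (monomial (Finsupp.single i 1 + s') 1 : MvPolynomial σ ℝ) = X i * m := by
      rw [hm, X, monomial_mul, one_mul]
    have hsh : shift h (X i * m) = X i * shift h m + h i • shift h m := by
      rw [map_mul, shift, aeval_X, add_mul, smul_eq_C_mul]
    have hdir : dirDeriv h (X i * m) = h i • m + X i * dirDeriv h m := by
      simp only [dirDeriv, pderiv_mul, pderiv_X, mul_add, Finset.sum_add_distrib]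
      congr 1
      · rw [Finset.sum_eq_single i]
        · simp [smul_eq_C_mul]
        · intro j _ hj; simp [hj.symm]
        · simp
      · rw [Finset.mul_sum]
        exact Finset.sum_congr rfl fun j _ => by ring
    rw [hmon, hsh, hdir]
    refine ⟨?_, ?_, ?_⟩
    · exact Submodule.add_mem _ (X_mul_mem_degreeGap h0 i)
        (Submodule.smul_mem _ _ (degreeGap_mono (by omega) h0))
    · have : X i * shift h m + h i • shift h m - X i * m =
          X i * (shift h m - m) + h i • shift h m := by ring
      rw [this]
      refine Submodule.add_mem _ (X_mul_mem_degreeGap h1 i) (Submodule.smul_mem _ _ ?_)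
      rw [mem_degreeGap] at h0 ⊢
      intro s hs
      have := h0 s hs
      omega
    · have : X i * shift h m + h i • shift h m - X i * m - (h i • m + X i * dirDeriv h m) =
          X i * (shift h m - m - dirDeriv h m) + h i • (shift h m - m) := by
        rw [smul_sub]; ring
      rw [this]
      refine Submodule.add_mem _ (X_mul_mem_degreeGap h2 i) (Submodule.smul_mem _ _ ?_)
      rw [mem_degreeGap] at h1 ⊢
      intro s hs
      have := h1 s hs
      omega

theorem dirDeriv_sum_smul (h : σ → ℝ) (s : Finset (σ →₀ ℕ)) (c : (σ →₀ ℕ) → ℝ) :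
    dirDeriv h (∑ v ∈ s, c v • monomial v 1) = ∑ v ∈ s, c v • dirDeriv h (monomial v 1) := by
  simp only [dirDeriv, map_sum, Derivation.map_smul, Finset.mul_sum, Finset.smul_sum]
  rw [Finset.sum_comm]
  refine Finset.sum_congr rfl fun v _ => Finset.sum_congr rfl fun i _ => ?_
  rw [mul_smul_comm]

theorem as_sum_smul {σ : Type*} (p : MvPolynomial σ ℝ) : p = ∑ v ∈ p.support, coeff v p • monomial v 1 := by
  conv_lhs => rw [p.as_sum]
  exact Finset.sum_congr rfl fun v _ => by rw [smul_monomial, smul_eq_mul, mul_one]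

theorem shift_sub_mem (h : σ → ℝ) {n : ℕ} {p : MvPolynomial σ ℝ} (hp : p.totalDegree ≤ n) :
    shift h p - p ∈ degreeGap σ 1 n ∧ shift h p - p - dirDeriv h p ∈ degreeGap σ 2 n := by
  rw [← mem_degreeGap_zero, mem_degreeGap] at hp
  have e1 : shift h p - p =
      ∑ v ∈ p.support, coeff v p • (shift h (monomial v 1) - monomial v 1) := by
    conv_lhs => rw [as_sum_smul p]
    simp only [map_sum, map_smul, smul_sub, Finset.sum_sub_distrib]
  have e2 : shift h p - p - dirDeriv h p =
      ∑ v ∈ p.support, coeff v p •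
        (shift h (monomial v 1) - monomial v 1 - dirDeriv h (monomial v 1)) := by
    rw [e1]
    conv_lhs => rw [as_sum_smul p, dirDeriv_sum_smul]
    rw [← as_sum_smul p]
    simp only [smul_sub, Finset.sum_sub_distrib]
  rw [e2, e1]
  constructor
  · refine Submodule.sum_mem _ fun v hv => Submodule.smul_mem _ _ ?_
    have := hp v hv
    exact degreeGap_mono (by omega) (shift_monomial_mem h _ v rfl).2.1
  · refine Submodule.sum_mem _ fun v hv => Submodule.smul_mem _ _ ?_
    have := hp v hv
    exact degreeGap_mono (by omega) (shift_monomial_mem h _ v rfl).2.2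

/-- A difference along `h` turns `p + q` into the derivative of `p` along `h` plus terms of lower
degree, so `q` never affects the linear part of the last difference. This is why Weyl's inequality
tolerates arbitrary phases of lower degree. -/
theorem isDiffLinear_polar (k : ℕ) : ∀ (p q : MvPolynomial σ ℝ) (_ : p.IsHomogeneous (k + 1))
    (_ : q.totalDegree ≤ k), IsDiffLinear k (fun x => eval (fun j => (x j : ℝ)) (p + q))
      fun h => polar p fun a j => (h a j : ℝ) := by
  induction k with
  | zero =>
    intro p q hp hq
    refine ⟨coeff 0 q, fun b x => ?_⟩
    have hqC := totalDegree_eq_zero_iff_eq_C.mp (Nat.le_zero.mp hq)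
    have h1 := congrArg (eval fun j => (x j : ℝ)) hp.sum_X_mul_pderiv
    simp only [map_sum, map_mul, eval_X, zero_add, one_smul] at h1
    change eval (fun j => (x j : ℝ)) (p + q) = coeff 0 q + ∑ j, polar p _ j * (x j : ℝ)
    rw [map_add, hqC, eval_C, add_comm, coeff_zero_C, ← h1]
    congr 1
    refine Finset.sum_congr rfl fun j _ => ?_
    have h2 := polar_diagonal p hp (fun j => (x j : ℝ)) j
    rw [Nat.factorial_zero, Nat.cast_one, one_mul] at h2
    rw [← h2, mul_comm]
    congr 2
    exact Subsingleton.elim _ _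
  | succ k ih =>
    intro p q hp hq h
    set hr : σ → ℝ := fun j => (h j : ℝ) with hhr
    obtain ⟨-, hp2⟩ := shift_sub_mem hr hp.totalDegree_le
    obtain ⟨hq1, -⟩ := shift_sub_mem hr hq
    have hdeg : ((shift hr p - p - dirDeriv hr p) + (shift hr q - q)).totalDegree ≤ k := by
      rw [← mem_degreeGap_zero]
      exact Submodule.add_mem _ (degreeGap_mono (by omega) hp2)
        (degreeGap_mono (by omega) hq1)
    have := ih (dirDeriv hr p) _ (dirDeriv_isHomogeneous hp hr) hdeg
    convert this using 1
    · funext x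
      have hx : (fun j => ((x + h) j : ℝ)) = (fun j => (x j : ℝ)) + hr := by
        funext j; simp [hhr]
      simp only [map_add, map_sub, eval_shift]
      rw [hx]
      ring
    · funext h' j
      exact polar_succ p _ j

end
end FormsPrime

/-! ### Summing the linear bounds over one direction -/

namespace FormsPrime
open MvPolynomial

noncomputable section

/-- The value `z` is a placeholder: tuples with the coordinate `a` erased are represented by those
with value `z` there. -/
theorem sum_piFinset_eq_sum_update {ι β M : Type*} [Fintype ι] [DecidableEq ι] [AddCommMonoid M]
    (s : ι → Finset β) (a : ι) (z : β) (f : (ι → β) → M) :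
    ∑ h ∈ Fintype.piFinset s, f h =
      ∑ h ∈ Fintype.piFinset (Function.update s a {z}), ∑ u ∈ s a, f (Function.update h a u) := by
  rw [← Finset.sum_product']
  refine Finset.sum_nbij' (fun h => (Function.update h a z, h a))
    (fun p => Function.update p.1 a p.2) ?_ ?_ ?_ ?_ ?_
  · intro h hh
    rw [Fintype.mem_piFinset] at hh
    refine Finset.mem_product.mpr ⟨Fintype.mem_piFinset.mpr fun i => ?_, hh a⟩
    by_cases hi : i = a
    · subst hi; simp
    · simpa [Function.update_of_ne hi] using hh i
  · intro p hp
    obtain ⟨hp1, hp2⟩ := Finset.mem_product.mp hp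
    rw [Fintype.mem_piFinset] at hp1 ⊢
    intro i
    by_cases hi : i = a
    · subst hi; simpa using hp2
    · simpa [Function.update_of_ne hi] using hp1 i
  · intro h _; simp
  · intro p hp
    obtain ⟨hp1, -⟩ := Finset.mem_product.mp hp
    rw [Fintype.mem_piFinset] at hp1
    have h1 : p.1 a = z := by simpa using hp1 a
    ext1
    · simp [← h1]
    · simp
  · intro h _; simp

/-- Lifts an estimate in one direction, with the other directions frozen, to all tuples. -/
theorem sum_piFinset_le_card {ι β : Type*} [Fintype ι] [DecidableEq ι]
    (s : ι → Finset β) (a : ι) (t : Finset β) (z : β) (f : (ι → β) → ℝ) (p : (ι → β) → Prop)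
    [DecidablePred p] (c : ℝ)
    (h : ∀ h0, ∑ u ∈ s a, f (Function.update h0 a u) ≤
      c * ((t.filter fun u => p (Function.update h0 a u)).card : ℝ)) :
    ∑ h ∈ Fintype.piFinset s, f h ≤
      c * (((Fintype.piFinset (Function.update s a t)).filter p).card : ℝ) := by
  rw [Finset.card_filter, Nat.cast_sum, sum_piFinset_eq_sum_update s a z,
    sum_piFinset_eq_sum_update (Function.update s a t) a z, Function.update_idem,
    Function.update_self, Finset.mul_sum]
  refine Finset.sum_le_sum fun h0 _ => (h h0).trans_eq ?_
  rw [Finset.card_filter, Nat.cast_sum]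

/-- `b` is within `δ` of an integer. -/
def NearInt (δ b : ℝ) : Prop := |b - round b| ≤ δ

theorem nearInt_of_le {δ b : ℝ} (n : ℤ) (h : |b - n| ≤ δ) : NearInt δ b :=
  (round_le b n).trans h

theorem sum_inv_two_mul_add_one_le (Q : ℕ) :
    ∑ r ∈ Finset.range Q, (1 / (1 + 2 * (r : ℝ))) ≤ 1 + Real.log Q := by
  have h1 := harmonic_le_one_add_log Q
  refine le_trans ?_ h1
  rw [harmonic, Rat.cast_sum]
  refine Finset.sum_le_sum fun r _ => ?_
  push_cast
  rw [one_div]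
  have hr : (0 : ℝ) ≤ r := Nat.cast_nonneg r
  exact inv_anti₀ (by positivity) (by linarith)

/-- An upper bound for `linBound Q b` when the fractional part of `b` lies in
`[r / Q, (r + 1) / Q)`. -/
def cellBound (Q r : ℕ) : ℝ :=
  2 * Q * (1 / (1 + 2 * (r : ℝ))) + 2 * Q * (1 / (1 + 2 * ((Q - 1 - r : ℕ) : ℝ)))

theorem sum_cellBound_le (Q : ℕ) :
    ∑ r ∈ Finset.range Q, cellBound Q r ≤ 4 * Q * (1 + Real.log Q) := by
  simp only [cellBound, Finset.sum_add_distrib, ← Finset.mul_sum]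
  rw [Finset.sum_range_reflect (fun r => 1 / (1 + 2 * (r : ℝ))) Q]
  have := sum_inv_two_mul_add_one_le Q
  have hQ : (0 : ℝ) ≤ Q := Nat.cast_nonneg Q
  nlinarith

theorem cellBound_nonneg (Q r : ℕ) : 0 ≤ cellBound Q r := by
  unfold cellBound; positivity

/-- If the fractional part lies in `[r/Q, (r+1)/Q)`, the distance to the nearest integer is at least
`r/Q` or at least `(Q-1-r)/Q`. -/
theorem linBound_le_cellBound {Q : ℕ} (hQ : 1 ≤ Q) (b : ℝ) :
    linBound Q b ≤ cellBound Q ⌊Q * Int.fract b⌋₊ := by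
  have hQ0 : (0 : ℝ) < Q := by exact_mod_cast hQ
  set r := ⌊Q * Int.fract b⌋₊ with hr
  have h0 : 0 ≤ Int.fract b := Int.fract_nonneg b
  have h1 : Int.fract b < 1 := Int.fract_lt_one b
  have hr1 : (r : ℝ) ≤ Q * Int.fract b := Nat.floor_le (by positivity)
  have hr2 : (Q : ℝ) * Int.fract b < r + 1 := Nat.lt_floor_add_one _
  have hrQ : r + 1 ≤ Q := by
    have : (r : ℝ) < Q := by nlinarith
    exact_mod_cast this
  have hcast : ((Q - 1 - r : ℕ) : ℝ) = Q - 1 - r := by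
    rw [Nat.cast_sub (by omega), Nat.cast_sub hQ]; simp
  have hdist : (r : ℝ) ≤ Q * |b - round b| ∨ (Q : ℝ) - 1 - r ≤ Q * |b - round b| := by
    have h2 : |b - round b| = min (Int.fract b) (1 - Int.fract b) := abs_sub_round_eq_min b
    rw [h2]
    rcases le_total (Int.fract b) (1 - Int.fract b) with h | h
    · left; rw [min_eq_left h]; exact hr1
    · right; rw [min_eq_right h]; nlinarith
  unfold linBound cellBound
  rw [hcast]
  have hr0 : (0 : ℝ) ≤ r := Nat.cast_nonneg r
  have hq1 : (0 : ℝ) ≤ Q - 1 - r := by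
    have : (r : ℝ) + 1 ≤ Q := by exact_mod_cast hrQ
    linarith
  rw [div_eq_mul_one_div]
  have ht := abs_nonneg (b - round b)
  have hA : 0 ≤ 2 * (Q : ℝ) * (1 / (1 + 2 * (r : ℝ))) := by positivity
  have hB : 0 ≤ 2 * (Q : ℝ) * (1 / (1 + 2 * ((Q : ℝ) - 1 - r))) := by positivity
  rcases hdist with h | h
  · have : 2 * (Q : ℝ) * (1 / (1 + 2 * Q * |b - round b|)) ≤ 2 * Q * (1 / (1 + 2 * (r : ℝ))) := by
      gcongr ?_ * (1 / ?_)
      linarith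
    linarith
  · have : 2 * (Q : ℝ) * (1 / (1 + 2 * Q * |b - round b|)) ≤
        2 * Q * (1 / (1 + 2 * ((Q : ℝ) - 1 - r))) := by
      gcongr ?_ * (1 / ?_)
      linarith
    linarith

open Classical in
-- The points `u` are sorted by the cells of side `1/Q` containing the fractional parts of `L u`.
-- Two points in one cell differ by some `v` with `L v` within `1/Q` of integers, so each cell has
-- at most as many points as are counted on the right. The bounds over the cells sum to a power of a
-- harmonic sum.
theorem sum_prod_linBound_le {σ : Type*} [Fintype σ] [DecidableEq σ] {Q : ℕ} (hQ : 1 ≤ Q)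
    (L : (σ → ℤ) → σ → ℝ) (hL : ∀ u v j, L (u - v) j = L u j - L v j) :
    ∑ u ∈ intBox σ (Q : ℝ), ∏ j, linBound Q (L u j) ≤
      (4 * Q * (1 + Real.log Q)) ^ Fintype.card σ *
        (((intBox σ (2 * Q : ℝ)).filter fun v => ∀ j, NearInt (1 / Q) (L v j)).card : ℝ) := by
  have hQ0 : (0 : ℝ) < Q := by exact_mod_cast hQ
  set M := ((intBox σ (2 * Q : ℝ)).filter fun v => ∀ j, NearInt (1 / Q) (L v j)).card with hM
  let r : (σ → ℤ) → σ → ℕ := fun u j => ⌊Q * Int.fract (L u j)⌋₊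
  have hr : ∀ u ∈ intBox σ (Q : ℝ), r u ∈ Fintype.piFinset fun _ : σ => Finset.range Q := by
    intro u _
    refine Fintype.mem_piFinset.mpr fun j => Finset.mem_range.mpr ?_
    have h0 : 0 ≤ Int.fract (L u j) := Int.fract_nonneg _
    rw [Nat.floor_lt (by positivity)]
    nlinarith [Int.fract_lt_one (L u j)]
  have hfib : ∀ c : σ → ℕ, ((intBox σ (Q : ℝ)).filter fun u => r u = c).card ≤ M := by
    intro c
    rcases Finset.eq_empty_or_nonempty ((intBox σ (Q : ℝ)).filter fun u => r u = c) with h | h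
    · rw [h]; simp
    · obtain ⟨u0, hu0⟩ := h
      obtain ⟨hu0b, hu0c⟩ := Finset.mem_filter.mp hu0
      refine Finset.card_le_card_of_injOn (fun u => u - u0) ?_ fun u _ v _ h => sub_left_injective h
      intro u hu
      obtain ⟨hub, huc⟩ := Finset.mem_filter.mp hu
      refine Finset.mem_filter.mpr ⟨?_, fun j => ?_⟩
      · rw [mem_intBox] at hub hu0b ⊢
        intro j
        have h1 := hub j
        have h2 := hu0b j
        change |((u j - u0 j : ℤ) : ℝ)| ≤ _
        rw [Int.cast_sub]
        refine (abs_sub _ _).trans ?_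
        linarith
      · refine nearInt_of_le (⌊L u j⌋ - ⌊L u0 j⌋) ?_
        have h1 : r u j = r u0 j := by rw [huc, hu0c]
        have e1 : L (u - u0) j - ((⌊L u j⌋ - ⌊L u0 j⌋ : ℤ) : ℝ) =
            Int.fract (L u j) - Int.fract (L u0 j) := by
          rw [hL, Int.fract, Int.fract]; push_cast; ring
        rw [e1]
        have f1 : (r u j : ℝ) ≤ Q * Int.fract (L u j) :=
          Nat.floor_le (mul_nonneg hQ0.le (Int.fract_nonneg _))
        have f2 : (Q : ℝ) * Int.fract (L u j) < r u j + 1 := Nat.lt_floor_add_one _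
        have f3 : (r u0 j : ℝ) ≤ Q * Int.fract (L u0 j) :=
          Nat.floor_le (mul_nonneg hQ0.le (Int.fract_nonneg _))
        have f4 : (Q : ℝ) * Int.fract (L u0 j) < r u0 j + 1 := Nat.lt_floor_add_one _
        rw [h1] at f1 f2
        rw [le_div_iff₀ hQ0, ← abs_of_pos hQ0, ← abs_mul, abs_le]
        constructor <;> nlinarith
  calc ∑ u ∈ intBox σ (Q : ℝ), ∏ j, linBound Q (L u j)
      ≤ ∑ u ∈ intBox σ (Q : ℝ), ∏ j, cellBound Q (r u j) :=
        Finset.sum_le_sum fun u _ => Finset.prod_le_prod (fun _ _ => linBound_nonneg _ _)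
          fun j _ => linBound_le_cellBound hQ _
    _ = ∑ c ∈ Fintype.piFinset fun _ : σ => Finset.range Q,
          ∑ u ∈ (intBox σ (Q : ℝ)).filter (fun u => r u = c), ∏ j, cellBound Q (r u j) :=
        (Finset.sum_fiberwise_of_maps_to hr _).symm
    _ = ∑ c ∈ Fintype.piFinset fun _ : σ => Finset.range Q,
          (((intBox σ (Q : ℝ)).filter (fun u => r u = c)).card : ℝ) * ∏ j, cellBound Q (c j) := by
        refine Finset.sum_congr rfl fun c _ => ?_
        rw [← nsmul_eq_mul, ← Finset.sum_const]
        refine Finset.sum_congr rfl fun u hu => ?_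
        rw [(Finset.mem_filter.mp hu).2]
    _ ≤ ∑ c ∈ Fintype.piFinset fun _ : σ => Finset.range Q, (M : ℝ) * ∏ j, cellBound Q (c j) := by
        refine Finset.sum_le_sum fun c _ => mul_le_mul_of_nonneg_right ?_
          (Finset.prod_nonneg fun j _ => cellBound_nonneg _ _)
        exact_mod_cast hfib c
    _ = (∑ r ∈ Finset.range Q, cellBound Q r) ^ Fintype.card σ * M := by
        rw [← Finset.mul_sum, ← Finset.prod_univ_sum (fun _ : σ => Finset.range Q)
          (fun _ r => cellBound Q r), Finset.prod_const, Finset.card_univ, mul_comm]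
    _ ≤ _ := by
        have h0 : 0 ≤ ∑ r ∈ Finset.range Q, cellBound Q r :=
          Finset.sum_nonneg fun r _ => cellBound_nonneg _ _
        gcongr
        exact sum_cellBound_le Q

end
end FormsPrime

/-! ### Nets in finite-dimensional spaces and isotropic subspaces -/

namespace FormsPrime
open MvPolynomial

noncomputable section

/-- The balls of radius `ρ/2` about the points are disjoint and lie in the ball of radius `3/2`;
their volumes are compared. -/
theorem card_le_of_separated {E : Type*} [NormedAddCommGroup E] [NormedSpace ℝ E]
    [FiniteDimensional ℝ E] (T : Finset E) {ρ : ℝ} (hρ : 0 < ρ) (hρ1 : ρ ≤ 1)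
    (hball : ∀ x ∈ T, ‖x‖ ≤ 1) (hsep : ∀ x ∈ T, ∀ y ∈ T, x ≠ y → ρ ≤ ‖x - y‖) :
    (T.card : ℝ) ≤ (3 / ρ) ^ Module.finrank ℝ E := by
  borelize E
  let μ : MeasureTheory.Measure E := MeasureTheory.Measure.addHaar
  have hdisj : (T : Set E).PairwiseDisjoint fun x => Metric.ball x (ρ / 2) := by
    intro x hx y hy hxy
    apply Metric.ball_disjoint_ball
    rw [dist_eq_norm]
    linarith [hsep x hx y hy hxy]
  have hsub : (⋃ x ∈ T, Metric.ball x (ρ / 2)) ⊆ Metric.ball (0 : E) (3 / 2) := by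
    intro z hz
    simp only [Set.mem_iUnion] at hz
    obtain ⟨x, hx, hz⟩ := hz
    rw [Metric.mem_ball] at hz ⊢
    rw [dist_zero_right]
    have h1 := hball x hx
    have h2 : ‖z‖ ≤ ‖z - x‖ + ‖x‖ := by
      calc ‖z‖ = ‖z - x + x‖ := by rw [sub_add_cancel]
        _ ≤ _ := norm_add_le _ _
    rw [dist_eq_norm] at hz
    linarith
  have hμ := MeasureTheory.measure_mono (μ := μ) hsub
  rw [MeasureTheory.measure_biUnion_finset hdisj fun _ _ => Metric.isOpen_ball.measurableSet] at hμ
  have hb : ∀ (x : E) {r : ℝ} (_ : 0 < r), μ (Metric.ball x r) =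
      ENNReal.ofReal (r ^ Module.finrank ℝ E) * μ (Metric.ball 0 1) :=
    fun x r hr => MeasureTheory.Measure.addHaar_ball_of_pos μ x hr
  have h0 : μ (Metric.ball (0 : E) 1) ≠ 0 :=
    (Metric.isOpen_ball.measure_pos μ ⟨0, Metric.mem_ball_self one_pos⟩).ne'
  have htop : μ (Metric.ball (0 : E) 1) ≠ ⊤ := Metric.isBounded_ball.measure_lt_top.ne
  simp only [hb _ (half_pos hρ), hb (0 : E) (by norm_num : (0 : ℝ) < 3 / 2), Finset.sum_const,
    nsmul_eq_mul] at hμ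
  rw [← mul_assoc, ENNReal.mul_le_mul_iff_left h0 htop] at hμ
  have h1 : (T.card : ENNReal) * ENNReal.ofReal ((ρ / 2) ^ Module.finrank ℝ E) =
      ENNReal.ofReal (T.card * (ρ / 2) ^ Module.finrank ℝ E) := by
    rw [ENNReal.ofReal_mul (Nat.cast_nonneg _), ENNReal.ofReal_natCast]
  rw [h1, ENNReal.ofReal_le_ofReal_iff (by positivity), ← le_div_iff₀ (by positivity),
    ← div_pow] at hμ
  refine hμ.trans_eq ?_
  congr 1
  field_simp

/-- A maximal `ρ`-separated subset is a net, and its size is governed by the dimension of the span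
of `S` and not of the ambient space. -/
theorem exists_net {E : Type*} [NormedAddCommGroup E] [NormedSpace ℝ E]
    [FiniteDimensional ℝ E] (S : Finset E) {ρ : ℝ} (hρ : 0 < ρ) (hρ1 : ρ ≤ 1)
    (hball : ∀ x ∈ S, ‖x‖ ≤ 1) :
    ∃ T ⊆ S, (T.card : ℝ) ≤ (3 / ρ) ^ Module.finrank ℝ (Submodule.span ℝ (S : Set E)) ∧
      ∀ x ∈ S, ∃ y ∈ T, ‖x - y‖ ≤ ρ := by
  classical
  let P : Finset E → Prop := fun T => ∀ x ∈ T, ∀ y ∈ T, x ≠ y → ρ ≤ ‖x - y‖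
  obtain ⟨T, hT, hmax⟩ := (S.powerset.filter P).exists_maximal ⟨∅, by simp [P]⟩
  rw [Finset.mem_filter, Finset.mem_powerset] at hT
  refine ⟨T, hT.1, ?_, fun x hx => ?_⟩
  · set W := Submodule.span ℝ (S : Set E) with hW
    let T' : Finset W := T.attach.image fun x => ⟨x.1, Submodule.subset_span (hT.1 x.2)⟩
    have hcard : T'.card = T.card := by
      refine (Finset.card_image_of_injective _ fun a b h => ?_).trans Finset.card_attach
      exact Subtype.ext (congrArg (fun w : W => w.1) h)
    have hT' : ∀ w ∈ T', w.1 ∈ T := by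
      intro w hw
      obtain ⟨x, -, rfl⟩ := Finset.mem_image.mp hw
      exact x.2
    rw [← hcard]
    refine card_le_of_separated T' hρ hρ1 (fun w hw => hball _ (hT.1 (hT' w hw))) ?_
    intro w hw v hv hne
    exact hT.2 _ (hT' w hw) _ (hT' v hv) fun h => hne (Subtype.ext h)
  · by_contra! hcon
    have hxT : x ∉ T := fun h => by
      have := hcon x h
      rw [sub_self, norm_zero] at this
      linarith
    have hins : insert x T ∈ S.powerset.filter P := by
      rw [Finset.mem_filter, Finset.mem_powerset]
      refine ⟨Finset.insert_subset hx hT.1, ?_⟩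
      intro a ha b hb hab
      rcases Finset.mem_insert.mp ha with ha' | ha' <;>
        rcases Finset.mem_insert.mp hb with hb' | hb'
      · exact absurd (ha'.trans hb'.symm) hab
      · rw [ha']; exact (hcon b hb').le
      · rw [hb', norm_sub_rev]; exact (hcon a ha').le
      · exact hT.2 a ha' b hb' hab
    exact hxT (hmax hins (Finset.subset_insert x T) (Finset.mem_insert_self x T))

variable {σ : Type*} [Fintype σ]

/-- The standard symplectic form. -/
def symplectic (σ : Type*) [Fintype σ] :
    ((σ → ℝ) × (σ → ℝ)) →ₗ[ℝ] ((σ → ℝ) × (σ → ℝ)) →ₗ[ℝ] ℝ :=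
  LinearMap.mk₂ ℝ (fun v w => ∑ j, (v.1 j * w.2 j - v.2 j * w.1 j))
    (fun v v' w => by
      rw [← Finset.sum_add_distrib]
      exact Finset.sum_congr rfl fun j _ => by simp; ring)
    (fun c v w => by
      rw [smul_eq_mul, Finset.mul_sum]
      exact Finset.sum_congr rfl fun j _ => by simp; ring)
    (fun v w w' => by
      rw [← Finset.sum_add_distrib]
      exact Finset.sum_congr rfl fun j _ => by simp; ring)
    (fun c v w => by
      rw [smul_eq_mul, Finset.mul_sum]
      exact Finset.sum_congr rfl fun j _ => by simp; ring)

theorem symplectic_apply (v w : (σ → ℝ) × (σ → ℝ)) :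
    symplectic σ v w = ∑ j, (v.1 j * w.2 j - v.2 j * w.1 j) := rfl

theorem symplectic_injective : Function.Injective (symplectic σ) := by
  classical
  rw [injective_iff_map_eq_zero]
  intro v hv
  ext j
  · have := congrArg (fun f => f (0, Pi.single j 1)) hv
    simpa [symplectic_apply, Pi.single_apply] using this
  · have := congrArg (fun f => f (Pi.single j 1, 0)) hv
    simpa [symplectic_apply, Pi.single_apply] using this

/-- By nondegeneracy the form embeds the span `W` in its own annihilator, so `2 dim W ≤ 2 |σ|`. -/
theorem finrank_span_le_of_isotropic (S : Set ((σ → ℝ) × (σ → ℝ)))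
    (hS : ∀ v ∈ S, ∀ w ∈ S, symplectic σ v w = 0) :
    Module.finrank ℝ (Submodule.span ℝ S) ≤ Fintype.card σ := by
  set W := Submodule.span ℝ S
  have h1 : ∀ v ∈ W, ∀ w ∈ W, symplectic σ v w = 0 := by
    intro v hv w hw
    induction hv using Submodule.span_induction with
    | zero => simp
    | add a b _ _ ha hb => rw [map_add, LinearMap.add_apply, ha, hb, add_zero]
    | smul c a _ ha => rw [map_smul, LinearMap.smul_apply, ha, smul_zero]
    | mem v hv =>
      induction hw using Submodule.span_induction with
      | zero => simp
      | add a b _ _ ha hb => rw [map_add, ha, hb, add_zero]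
      | smul c a _ ha => rw [map_smul, ha, smul_zero]
      | mem w hw => exact hS v hv w hw
  have h2 : W.map (symplectic σ) ≤ W.dualAnnihilator := by
    rintro _ ⟨v, hv, rfl⟩
    rw [Submodule.mem_dualAnnihilator]
    exact fun w hw => h1 v hv w hw
  have h3 := Submodule.finrank_mono h2
  have h4 : Module.finrank ℝ (W.map (symplectic σ)) = Module.finrank ℝ W :=
    (Submodule.equivMapOfInjective _ symplectic_injective W).finrank_eq.symm
  have h5 := Subspace.finrank_add_finrank_dualAnnihilator_eq W
  have h6 : Module.finrank ℝ ((σ → ℝ) × (σ → ℝ)) = 2 * Fintype.card σ := by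
    rw [Module.finrank_prod, Module.finrank_pi]; ring
  rw [h4] at h3
  have h7 : Module.finrank ℝ W + Module.finrank ℝ W ≤ 2 * Fintype.card σ := by
    rw [← h6, ← h5]
    exact Nat.add_le_add_left h3 _
  omega

end
end FormsPrime

/-! ### Davenport's shrinking lemma -/

namespace FormsPrime
open MvPolynomial

noncomputable section

variable {σ : Type*} [Fintype σ] [DecidableEq σ]

open Classical in
/-- The number of integral points `u` with `|u| ≤ A` at which all coordinates of `L u` are within
`δ` of an integer. -/
def nearCount (L : (σ → ℤ) → σ → ℝ) (A δ : ℝ) : ℕ :=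
  ((intBox σ A).filter fun u => ∀ j, NearInt δ (L u j)).card

/-- The point attached to `u` in the lattice of pairs `(u, L u - v)`, rescaled. -/
def latticePoint (L : (σ → ℤ) → σ → ℝ) (A δ : ℝ) (u : σ → ℤ) : (σ → ℝ) × (σ → ℝ) :=
  (fun j => u j / A, fun j => (L u j - round (L u j)) / δ)

/-- The rescaled lattice points lie in the unit ball of a space of dimension at most `r`, so
`(3/ρ)^r` balls of radius `ρ` cover them. Differences within one ball are counted at the scale `ρ`.
-/
theorem nearCount_le_of_finrank {L : (σ → ℤ) → σ → ℝ} (hL : ∀ u v j, L (u - v) j = L u j - L v j)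
    {A δ ρ : ℝ} (hA : 0 < A) (hδ : 0 < δ) (hρ : 0 < ρ) (hρ1 : ρ ≤ 1) (r : ℕ)
    (hr : Module.finrank ℝ (Submodule.span ℝ (latticePoint L A δ ''
      {u | (∀ j, |(u j : ℝ)| ≤ A) ∧ ∀ j, NearInt δ (L u j)})) ≤ r) :
    (nearCount L A δ : ℝ) ≤ (3 / ρ) ^ r * nearCount L (ρ * A) (ρ * δ) := by
  classical
  set F := (intBox σ A).filter fun u => ∀ j, NearInt δ (L u j) with hF
  set S := F.image (latticePoint L A δ) with hS
  have hFset : (F : Set (σ → ℤ)) = {u | (∀ j, |(u j : ℝ)| ≤ A) ∧ ∀ j, NearInt δ (L u j)} := by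
    ext u
    simp [hF, mem_intBox]
  have hball : ∀ x ∈ S, ‖x‖ ≤ 1 := by
    intro x hx
    obtain ⟨u, hu, rfl⟩ := Finset.mem_image.mp hx
    obtain ⟨hu1, hu2⟩ := Finset.mem_filter.mp hu
    rw [mem_intBox] at hu1
    rw [latticePoint, Prod.norm_mk]
    refine max_le ?_ ?_
    · refine (pi_norm_le_iff_of_nonneg zero_le_one).mpr fun j => ?_
      rw [Real.norm_eq_abs, abs_div, abs_of_pos hA, div_le_one hA]
      exact hu1 j
    · refine (pi_norm_le_iff_of_nonneg zero_le_one).mpr fun j => ?_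
      rw [Real.norm_eq_abs, abs_div, abs_of_pos hδ, div_le_one hδ]
      exact hu2 j
  obtain ⟨T, hTS, hTcard, hT⟩ := exists_net S hρ hρ1 hball
  have hT' : (T.card : ℝ) ≤ (3 / ρ) ^ r := by
    refine hTcard.trans (pow_le_pow_right₀ ?_ ?_)
    · rw [le_div_iff₀ hρ]; linarith
    · rw [hS, Finset.coe_image, hFset]; exact hr
  have hcover : F ⊆ T.biUnion fun t => F.filter fun u => ‖latticePoint L A δ u - t‖ ≤ ρ := by
    intro u hu
    obtain ⟨t, ht, htu⟩ := hT _ (Finset.mem_image_of_mem _ hu)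
    exact Finset.mem_biUnion.mpr ⟨t, ht, Finset.mem_filter.mpr ⟨hu, htu⟩⟩
  have hfib : ∀ t ∈ T, (F.filter fun u => ‖latticePoint L A δ u - t‖ ≤ ρ).card ≤
      nearCount L (ρ * A) (ρ * δ) := by
    intro t ht
    obtain ⟨u0, hu0, rfl⟩ := Finset.mem_image.mp (hTS ht)
    refine Finset.card_le_card_of_injOn (fun u => u - u0) ?_ fun u _ v _ h => sub_left_injective h
    intro u hu
    obtain ⟨-, hu2⟩ := Finset.mem_filter.mp hu
    rw [latticePoint, latticePoint, Prod.mk_sub_mk, Prod.norm_mk, max_le_iff,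
      pi_norm_le_iff_of_nonneg hρ.le, pi_norm_le_iff_of_nonneg hρ.le] at hu2
    refine Finset.mem_filter.mpr ⟨mem_intBox.mpr fun j => ?_, fun j => ?_⟩
    · have := hu2.1 j
      rw [Pi.sub_apply, Real.norm_eq_abs, ← sub_div, abs_div, abs_of_pos hA, div_le_iff₀ hA] at this
      change |((u j - u0 j : ℤ) : ℝ)| ≤ _
      rwa [Int.cast_sub]
    · have := hu2.2 j
      rw [Pi.sub_apply, Real.norm_eq_abs, ← sub_div, abs_div, abs_of_pos hδ, div_le_iff₀ hδ] at this
      refine nearInt_of_le (round (L u j) - round (L u0 j)) ?_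
      rw [hL]
      push_cast
      rwa [show L u j - L u0 j - ((round (L u j) : ℝ) - round (L u0 j)) =
        L u j - round (L u j) - (L u0 j - round (L u0 j)) by ring]
  have h1 : F.card ≤ T.card * nearCount L (ρ * A) (ρ * δ) :=
    (Finset.card_le_card hcover).trans (Finset.card_biUnion_le_card_mul _ _ _ hfib)
  have h2 : (nearCount L A δ : ℝ) ≤ T.card * nearCount L (ρ * A) (ρ * δ) := by
    exact_mod_cast h1
  refine h2.trans ?_
  gcongr

/-- Because `Λ` is symmetric, the symplectic pairing of two such points is an integer divided by `A
δ`. It is also at most `2 |σ|` in absolute value, so for small `A δ` the integer is zero and the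
points span an isotropic subspace. -/
theorem finrank_span_latticePoint_le {σ : Type*} [Fintype σ] {L : (σ → ℤ) → σ → ℝ} (Λ : Matrix σ σ ℝ)
    (hΛ : Λ.IsSymm) (hL : ∀ u j, L u j = ∑ i, Λ j i * u i) {A δ : ℝ} (hA : 0 < A) (hδ : 0 < δ)
    (hAδ : 2 * Fintype.card σ * (A * δ) < 1) :
    Module.finrank ℝ (Submodule.span ℝ (latticePoint L A δ ''
      {u | (∀ j, |(u j : ℝ)| ≤ A) ∧ ∀ j, NearInt δ (L u j)})) ≤ Fintype.card σ := by
  refine finrank_span_le_of_isotropic _ ?_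
  rintro _ ⟨u, ⟨hu1, hu2⟩, rfl⟩ _ ⟨u', ⟨hu'1, hu'2⟩, rfl⟩
  rw [symplectic_apply]
  simp only [latticePoint]
  have hsym : ∑ j, (u j : ℝ) * L u' j = ∑ j, L u j * (u' j : ℝ) := by
    simp only [hL, Finset.mul_sum, Finset.sum_mul]
    rw [Finset.sum_comm]
    refine Finset.sum_congr rfl fun i _ => Finset.sum_congr rfl fun j _ => ?_
    rw [← hΛ.apply]; ring
  set m : ℤ := ∑ j, (round (L u j) * u' j - u j * round (L u' j)) with hm
  have h1 : ∑ j, ((u j / A : ℝ) * ((L u' j - round (L u' j)) / δ) -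
      (L u j - round (L u j)) / δ * (u' j / A)) = m / (A * δ) := by
    have : (m : ℝ) = ∑ j, ((u j : ℝ) * (L u' j - round (L u' j)) -
        (L u j - round (L u j)) * u' j) := by
      have h2 : ∑ j, ((u j : ℝ) * (L u' j - round (L u' j)) - (L u j - round (L u j)) * u' j) =
          (∑ j, (u j : ℝ) * L u' j - ∑ j, L u j * (u' j : ℝ)) +
            ∑ j, ((round (L u j) : ℝ) * u' j - u j * round (L u' j)) := by
        rw [← Finset.sum_sub_distrib, ← Finset.sum_add_distrib]
        exact Finset.sum_congr rfl fun j _ => by ring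
      rw [h2, hsym, sub_self, zero_add, hm]
      push_cast
      rfl
    rw [this, Finset.sum_div]
    refine Finset.sum_congr rfl fun j _ => ?_
    field_simp
  rw [h1]
  have h3 : |(m : ℝ)| < 1 := by
    have h4 : |(m : ℝ) / (A * δ)| ≤ 2 * Fintype.card σ := by
      rw [← h1]
      refine (Finset.abs_sum_le_sum_abs _ _).trans ?_
      calc _ ≤ ∑ _j : σ, (2 : ℝ) := by
            refine Finset.sum_le_sum fun j _ => ?_
            have b1 : |(u j / A : ℝ)| ≤ 1 := by
              rw [abs_div, abs_of_pos hA, div_le_one hA]; exact hu1 j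
            have b2 : |(u' j / A : ℝ)| ≤ 1 := by
              rw [abs_div, abs_of_pos hA, div_le_one hA]; exact hu'1 j
            have b3 : |(L u j - round (L u j)) / δ| ≤ 1 := by
              rw [abs_div, abs_of_pos hδ, div_le_one hδ]; exact hu2 j
            have b4 : |(L u' j - round (L u' j)) / δ| ≤ 1 := by
              rw [abs_div, abs_of_pos hδ, div_le_one hδ]; exact hu'2 j
            refine (abs_sub _ _).trans ?_
            rw [abs_mul, abs_mul]
            have c1 := mul_le_one₀ b1 (abs_nonneg _) b4
            have c2 := mul_le_one₀ b3 (abs_nonneg _) b2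
            linarith
        _ = 2 * Fintype.card σ := by simp; ring
    rw [abs_div, abs_of_pos (mul_pos hA hδ), div_le_iff₀ (mul_pos hA hδ)] at h4
    linarith
  have h5 : m = 0 := by
    have : |m| < 1 := by exact_mod_cast h3
    exact Int.abs_lt_one_iff.mp this
  rw [h5]; simp

/-- Davenport's shrinking lemma. -/
theorem exists_nearCount_le (σ : Type*) [Fintype σ] [DecidableEq σ] :
    ∃ C : ℝ, 0 < C ∧ ∀ (Λ : Matrix σ σ ℝ) (_ : Λ.IsSymm) (L : (σ → ℤ) → σ → ℝ)
      (_ : ∀ u j, L u j = ∑ i, Λ j i * u i) (A δ ρ : ℝ) (_ : 0 < A) (_ : 0 < δ) (_ : A * δ ≤ 4)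
      (_ : 0 < ρ) (_ : ρ ≤ 1),
      (nearCount L A δ : ℝ) ≤ C * (ρ⁻¹) ^ Fintype.card σ * nearCount L (ρ * A) (ρ * δ) := by
  set N := Fintype.card σ with hN
  -- Small enough that, at scale `ρ₀` with `A δ ≤ 4`, the integers of the symplectic pairing vanish:
  -- `2 N · 4 ρ₀² < 1`.
  set ρ₀ : ℝ := 1 / (4 * (N + 1)) with hρ₀
  have hρ₀pos : 0 < ρ₀ := by positivity
  have hρ₀1 : ρ₀ ≤ 1 := by
    rw [hρ₀, div_le_one (by positivity)]
    have : (0 : ℝ) ≤ N := Nat.cast_nonneg N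
    linarith
  refine ⟨(3 / ρ₀) ^ (2 * N) * 3 ^ N, by positivity, ?_⟩
  intro Λ hΛ L hL A δ ρ hA hδ hAδ hρ hρ1
  have hLsub : ∀ u v j, L (u - v) j = L u j - L v j := by
    intro u v j
    simp only [hL, ← Finset.sum_sub_distrib]
    exact Finset.sum_congr rfl fun i _ => by push_cast [Pi.sub_apply]; ring
  have htriv : ∀ S : Set ((σ → ℝ) × (σ → ℝ)),
      Module.finrank ℝ (Submodule.span ℝ S) ≤ 2 * N := by
    intro S
    refine (Submodule.finrank_le _).trans ?_
    rw [Module.finrank_prod, Module.finrank_pi]; omega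
  have h3N : (1 : ℝ) ≤ 3 ^ N := one_le_pow₀ (by norm_num)
  rcases le_total ρ₀ ρ with h | h
  -- For `ρ ≥ ρ₀` the trivial rank `2N` costs only a constant.
  · have h1 := nearCount_le_of_finrank hLsub hA hδ hρ hρ1 (2 * N) (htriv _)
    refine h1.trans ?_
    gcongr ?_ * _
    have h2 : (3 / ρ) ^ (2 * N) ≤ (3 / ρ₀) ^ (2 * N) := by gcongr
    have h4 : 1 ≤ (ρ⁻¹) ^ N := one_le_pow₀ (one_le_inv₀ hρ |>.mpr hρ1)
    calc (3 / ρ) ^ (2 * N) ≤ (3 / ρ₀) ^ (2 * N) * 1 * 1 := by rw [mul_one, mul_one]; exact h2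
      _ ≤ (3 / ρ₀) ^ (2 * N) * 3 ^ N * ρ⁻¹ ^ N := by gcongr
  -- Otherwise the scale `ρ₀` is reached first, with the trivial rank. From there the points are
  -- isotropic, and the remaining ratio `ρ / ρ₀` is paid with exponent `N` only.
  · have h1 := nearCount_le_of_finrank hLsub hA hδ hρ₀pos hρ₀1 (2 * N) (htriv _)
    have hsmall : 2 * (N : ℝ) * (ρ₀ * A * (ρ₀ * δ)) < 1 := by
      have h2 : ρ₀ * A * (ρ₀ * δ) ≤ ρ₀ * ρ₀ * 4 := by
        rw [show ρ₀ * A * (ρ₀ * δ) = ρ₀ * ρ₀ * (A * δ) by ring]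
        gcongr
      have hN0 : (0 : ℝ) ≤ N := Nat.cast_nonneg N
      have h3 : ρ₀ * (4 * (N + 1)) = 1 := by rw [hρ₀]; field_simp
      nlinarith
    have hq : 0 < ρ / ρ₀ := by positivity
    have hq1 : ρ / ρ₀ ≤ 1 := (div_le_one hρ₀pos).mpr h
    have h2 := nearCount_le_of_finrank hLsub (mul_pos hρ₀pos hA) (mul_pos hρ₀pos hδ) hq hq1 N
      (finrank_span_latticePoint_le Λ hΛ hL (mul_pos hρ₀pos hA) (mul_pos hρ₀pos hδ) hsmall)
    rw [← mul_assoc, ← mul_assoc, div_mul_cancel₀ _ hρ₀pos.ne'] at h2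
    calc (nearCount L A δ : ℝ) ≤ (3 / ρ₀) ^ (2 * N) * nearCount L (ρ₀ * A) (ρ₀ * δ) := h1
      _ ≤ (3 / ρ₀) ^ (2 * N) * ((3 / (ρ / ρ₀)) ^ N * nearCount L (ρ * A) (ρ * δ)) := by gcongr
      _ ≤ (3 / ρ₀) ^ (2 * N) * ((3 * ρ⁻¹) ^ N * nearCount L (ρ * A) (ρ * δ)) := by
          gcongr
          rw [div_div_eq_mul_div, div_eq_mul_inv]
          gcongr
          linarith
      _ = _ := by rw [mul_pow]; ring

end
end FormsPrime

/-! ### Counting nearly integral polar forms; Cramer's rule -/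

namespace FormsPrime
open MvPolynomial

noncomputable section

variable {σ : Type*} [Fintype σ] [DecidableEq σ]

/-- The polar form of `p` at integral directions. -/
def intPolar {k : ℕ} (p : MvPolynomial σ ℝ) (h : Fin k → σ → ℤ) (j : σ) : ℝ :=
  polar p (fun a l => (h a l : ℝ)) j

theorem intPolar_update {k : ℕ} (p : MvPolynomial σ ℝ) (h : Fin k → σ → ℤ) (a : Fin k)
    (u : σ → ℤ) (j : σ) : intPolar p (Function.update h a u) j =
      ∑ i, polar p (Function.update (fun a l => (h a l : ℝ)) a (Pi.single i 1)) j * u i := by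
  rw [intPolar, ← polar_update p (fun a l => (h a l : ℝ)) a (fun i => (u i : ℝ)) j]
  congr 1
  funext b l
  by_cases hb : b = a
  · subst hb; simp
  · simp [Function.update_of_ne hb]

open Classical in
/-- The number of tuples of integral directions, bounded by `A`, at which all polar forms of `p` are
within `δ` of an integer. -/
def polarCount {k : ℕ} (p : MvPolynomial σ ℝ) (A : Fin k → ℝ) (δ : ℝ) : ℕ :=
  ((Fintype.piFinset fun a => intBox σ (A a)).filter fun h => ∀ j, NearInt δ (intPolar p h j)).card

theorem intBox_mono {A B : ℝ} (h : A ≤ B) : intBox σ A ⊆ intBox σ B := fun u hu => by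
  rw [mem_intBox] at hu ⊢
  exact fun j => (hu j).trans h

theorem polarCount_mono {k : ℕ} (p : MvPolynomial σ ℝ) {A B : Fin k → ℝ} {δ ε : ℝ}
    (hA : ∀ a, A a ≤ B a) (hδ : δ ≤ ε) : polarCount p A δ ≤ polarCount p B ε := by
  classical
  refine Finset.card_le_card fun h hh => ?_
  rw [Finset.mem_filter, Fintype.mem_piFinset] at hh ⊢
  exact ⟨fun a => intBox_mono (hA a) (hh.1 a), fun j => (hh.2 j).trans hδ⟩

/-- With all directions but one frozen, the polar forms are linear with a symmetric matrix, so
Davenport's lemma applies in that direction. -/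
theorem exists_polarCount_update_le (σ : Type*) [Fintype σ] [DecidableEq σ] :
    ∃ C : ℝ, 0 < C ∧ ∀ (k : ℕ) (p : MvPolynomial σ ℝ) (A : Fin k → ℝ) (a : Fin k) (δ ρ : ℝ)
      (_ : 0 < A a) (_ : 0 < δ) (_ : A a * δ ≤ 4) (_ : 0 < ρ) (_ : ρ ≤ 1),
      (polarCount p A δ : ℝ) ≤ C * (ρ⁻¹) ^ Fintype.card σ *
        polarCount p (Function.update A a (ρ * A a)) (ρ * δ) := by
  classical
  obtain ⟨C, hC, hmain⟩ := exists_nearCount_le σ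
  refine ⟨C, hC, fun k p A a δ ρ hA hδ hAδ hρ hρ1 => ?_⟩
  have h1 : (polarCount p A δ : ℝ) = ∑ h ∈ Fintype.piFinset fun a => intBox σ (A a),
      if ∀ j, NearInt δ (intPolar p h j) then (1 : ℝ) else 0 := by
    rw [polarCount, Finset.card_filter]; push_cast; rfl
  have h2 : Function.update (fun b => intBox σ (A b)) a (intBox σ (ρ * A a)) =
      fun b => intBox σ (Function.update A a (ρ * A a) b) := by
    funext b
    by_cases hb : b = a
    · subst hb; simp
    · simp [Function.update_of_ne hb]
  have h3 := sum_piFinset_le_card (fun b => intBox σ (A b)) a (intBox σ (ρ * A a)) 0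
    (fun h => if ∀ j, NearInt δ (intPolar p h j) then (1 : ℝ) else 0)
    (fun h => ∀ j, NearInt (ρ * δ) (intPolar p h j)) (C * (ρ⁻¹) ^ Fintype.card σ) (by
      intro h0
      have h4 := hmain
        (Matrix.of fun j i => polar p (Function.update (fun a l => (h0 a l : ℝ)) a
          (Pi.single i 1)) j)
        (by
          ext i j
          exact polar_update_single_symm _ _ _ _ _)
        (fun u j => intPolar p (Function.update h0 a u) j)
        (fun u j => intPolar_update _ _ _ _ _) (A a) δ ρ hA hδ hAδ hρ hρ1
      refine le_trans (le_of_eq ?_) h4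
      rw [nearCount, Finset.card_filter]
      push_cast
      rfl)
  rw [h1]
  refine h3.trans_eq ?_
  rw [h2]
  rfl

/-- The directions are shrunk one after the other. The tolerance only decreases along the way, so
the condition `A δ ≤ 4` persists for the directions still of size `A`. -/
theorem exists_polarCount_le (σ : Type*) [Fintype σ] [DecidableEq σ] (k : ℕ) :
    ∃ C : ℝ, 0 < C ∧ ∀ (p : MvPolynomial σ ℝ) (A δ ρ : ℝ)
      (_ : 0 < A) (_ : 0 < δ) (_ : A * δ ≤ 4) (_ : 0 < ρ) (_ : ρ ≤ 1),
      (polarCount (k := k) p (fun _ => A) δ : ℝ) ≤ C * ((ρ⁻¹) ^ Fintype.card σ) ^ k *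
        polarCount (k := k) p (fun _ => ρ * A) (ρ ^ k * δ) := by
  obtain ⟨C, hC, hstep⟩ := exists_polarCount_update_le σ
  refine ⟨C ^ k, by positivity, fun p A δ ρ hA hδ hAδ hρ hρ1 => ?_⟩
  have key : ∀ i ≤ k, (polarCount (k := k) p (fun _ => A) δ : ℝ) ≤
      (C * (ρ⁻¹) ^ Fintype.card σ) ^ i *
        polarCount p (fun a : Fin k => if a.val < i then ρ * A else A) (ρ ^ i * δ) := by
    intro i
    induction i with
    | zero => intro _; simp
    | succ i ih =>
      intro hi
      have hρi : ρ ^ i ≤ 1 := pow_le_one₀ hρ.le hρ1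
      have h1 := hstep k p (fun a : Fin k => if a.val < i then ρ * A else A) ⟨i, by omega⟩
        (ρ ^ i * δ) ρ (by simpa using hA) (by positivity) (by
          simp only [lt_irrefl, if_false]
          calc A * (ρ ^ i * δ) = ρ ^ i * (A * δ) := by ring
            _ ≤ 1 * (A * δ) := by gcongr
            _ ≤ 4 := by linarith) hρ hρ1
      have h2 : Function.update (fun a : Fin k => if a.val < i then ρ * A else A) ⟨i, by omega⟩
          (ρ * A) = fun a : Fin k => if a.val < i + 1 then ρ * A else A := by
        funext a
        by_cases ha : a = ⟨i, by omega⟩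
        · subst ha; simp
        · rw [Function.update_of_ne ha]
          have : a.val ≠ i := fun h => ha (Fin.ext h)
          have h3 : a.val < i ↔ a.val < i + 1 := by omega
          simp only [h3]
      simp only [lt_irrefl, if_false] at h1
      rw [h2, ← mul_assoc, ← pow_succ'] at h1
      calc (polarCount (k := k) p (fun _ => A) δ : ℝ) ≤ _ := ih (by omega)
        _ ≤ (C * (ρ⁻¹) ^ Fintype.card σ) ^ i * (C * (ρ⁻¹) ^ Fintype.card σ *
            polarCount p (fun a : Fin k => if a.val < i + 1 then ρ * A else A)
              (ρ ^ (i + 1) * δ)) := by gcongr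
        _ = _ := by rw [pow_succ]; ring
  have h1 := key k le_rfl
  have h2 : (fun a : Fin k => if a.val < k then ρ * A else A) = fun _ => ρ * A := by
    funext a; simp
  rw [h2, mul_pow] at h1
  exact h1

theorem sum_prod_linBound_intPolar_le {k : ℕ} (hk : 0 < k) (p : MvPolynomial σ ℝ) {Q : ℕ}
    (hQ : 1 ≤ Q) :
    ∑ h ∈ Fintype.piFinset (fun _ : Fin k => intBox σ (Q : ℝ)), ∏ j, linBound Q (intPolar p h j) ≤
      (4 * Q * (1 + Real.log Q)) ^ Fintype.card σ *
        polarCount (k := k) p (fun _ => 2 * Q) (1 / Q) := by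
  classical
  have hQ0 : (0 : ℝ) < Q := by exact_mod_cast hQ
  have h1 := sum_piFinset_le_card (fun _ : Fin k => intBox σ (Q : ℝ)) ⟨0, hk⟩
    (intBox σ (2 * Q : ℝ)) 0 (fun h => ∏ j, linBound Q (intPolar p h j))
    (fun h => ∀ j, NearInt (1 / Q) (intPolar p h j))
    ((4 * Q * (1 + Real.log Q)) ^ Fintype.card σ) (fun h0 => by
      have := sum_prod_linBound_le hQ (fun u j => intPolar p (Function.update h0 ⟨0, hk⟩ u) j)
        (by
          intro u v j
          simp only [intPolar_update, ← Finset.sum_sub_distrib]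
          exact Finset.sum_congr rfl fun i _ => by push_cast [Pi.sub_apply]; ring)
      refine this.trans_eq ?_
      congr!)
  refine h1.trans ?_
  have hlog : 0 ≤ Real.log Q := Real.log_natCast_nonneg Q
  gcongr
  refine Finset.card_le_card fun h hh => ?_
  rw [Finset.mem_filter, Fintype.mem_piFinset] at hh ⊢
  refine ⟨fun a => ?_, hh.2⟩
  have h2 := hh.1 a
  by_cases ha : a = ⟨0, hk⟩
  · subst ha; simpa using h2
  · rw [Function.update_of_ne ha] at h2
    exact intBox_mono (by linarith) h2

theorem abs_polar_le {σ : Type*} [Fintype σ] {k : ℕ} (p : MvPolynomial σ ℝ) (h : Fin k → σ → ℝ) (j : σ) {A : ℝ}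
    (hA : ∀ a l, |h a l| ≤ A) :
    |polar p h j| ≤ (∑ J : Fin k → σ, |polarCoeff p J j|) * A ^ k := by
  rw [polar, Finset.sum_mul]
  refine (Finset.abs_sum_le_sum_abs _ _).trans (Finset.sum_le_sum fun J _ => ?_)
  rw [abs_mul, mul_comm, Finset.abs_prod]
  gcongr
  calc ∏ a, |h a (J a)| ≤ ∏ _a : Fin k, A :=
        Finset.prod_le_prod (fun _ _ => abs_nonneg _) fun a _ => hA a (J a)
    _ = A ^ k := by simp

/-- Cramer's rule: `det M · γ` is the row `γ M`, nearly integral by assumption, times the adjugate.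
The denominator is `|det M|`, and the error is governed by minors of order `R - 1`. -/
theorem exists_approx_of_det_ne_zero {R : ℕ} (hR : 1 ≤ R) (M : Matrix (Fin R) (Fin R) ℤ)
    (hM : M.det ≠ 0) {B δ : ℝ} (hB : ∀ i l, |(M i l : ℝ)| ≤ B) (γ : Fin R → ℝ)
    (hγ : ∀ l, NearInt δ (∑ i, γ i * M i l)) :
    ∃ n : ℕ, 1 ≤ n ∧ (n : ℝ) ≤ R.factorial * B ^ R ∧ ∃ a : Fin R → ℤ, ∀ i,
      |n * γ i - a i| ≤ R * R.factorial * (B ^ (R - 1) * δ) := by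
  obtain ⟨r, rfl⟩ : ∃ r, R = r + 1 := ⟨R - 1, by omega⟩
  have hB0 : 0 ≤ B := (abs_nonneg _).trans (hB 0 0)
  set v : Fin (r + 1) → ℤ := fun l => round (∑ i, γ i * M i l) with hv
  have hδ0 : 0 ≤ δ := (abs_nonneg _).trans (hγ 0)
  let abv : AbsoluteValue ℝ ℝ := AbsoluteValue.abs
  have hMR : ((M.map (Int.cast : ℤ → ℝ)).det) = (M.det : ℝ) := by
    have := (Int.castRingHom ℝ).map_det M
    exact this.symm
  have hdet : |(M.det : ℝ)| ≤ (r + 1).factorial * B ^ (r + 1) := by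
    have := Matrix.det_le (A := M.map (Int.cast : ℤ → ℝ)) (abv := abv) (x := B)
      (fun i j => hB i j)
    rw [hMR, Fintype.card_fin, nsmul_eq_mul] at this
    exact this
  have hadj : ∀ l i, |((M.adjugate l i : ℤ) : ℝ)| ≤ r.factorial * B ^ r := by
    intro l i
    rw [Matrix.adjugate_fin_succ_eq_det_submatrix, Int.cast_mul, Int.cast_pow, Int.cast_neg,
      Int.cast_one, abs_mul, abs_pow, abs_neg, abs_one, one_pow, one_mul]
    have := Matrix.det_le (A := (M.submatrix i.succAbove l.succAbove).map (Int.cast : ℤ → ℝ))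
      (abv := abv) (x := B) (fun i j => hB _ _)
    rw [Fintype.card_fin, nsmul_eq_mul] at this
    have h2 := (Int.castRingHom ℝ).map_det (M.submatrix i.succAbove l.succAbove)
    have h3 : |(((M.submatrix i.succAbove l.succAbove).det : ℤ) : ℝ)| =
        abv ((M.submatrix i.succAbove l.succAbove).map (Int.cast : ℤ → ℝ)).det :=
      congrArg abs h2
    rw [h3]
    exact this
  have hcramer : ∀ i, (M.det : ℝ) * γ i =
      ∑ l, (∑ i', γ i' * M i' l) * (M.adjugate l i : ℝ) := by
    intro i
    have h1 : ∀ i', ∑ l, (M i' l : ℝ) * (M.adjugate l i : ℝ) = if i' = i then (M.det : ℝ) else 0 := by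
      intro i'
      have := congrFun (congrFun (Matrix.mul_adjugate M) i') i
      rw [Matrix.mul_apply, Matrix.smul_apply, Matrix.one_apply] at this
      have h2 := congrArg (Int.cast : ℤ → ℝ) this
      push_cast at h2
      rw [h2]
      split_ifs <;> simp
    simp only [Finset.sum_mul]
    rw [Finset.sum_comm]
    simp only [mul_assoc, ← Finset.mul_sum, h1]
    simp [mul_comm]
  have hmain : ∀ i, |(M.det : ℝ) * γ i - ((∑ l, v l * M.adjugate l i : ℤ) : ℝ)| ≤
      (r + 1 : ℕ) * (r + 1).factorial * (B ^ r * δ) := by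
    intro i
    rw [hcramer]
    push_cast
    rw [← Finset.sum_sub_distrib]
    refine (Finset.abs_sum_le_sum_abs _ _).trans ?_
    calc _ ≤ ∑ _l : Fin (r + 1), ((r + 1).factorial : ℝ) * (B ^ r * δ) := by
          refine Finset.sum_le_sum fun l _ => ?_
          rw [← sub_mul, abs_mul]
          have hf : (r.factorial : ℝ) ≤ (r + 1).factorial := by
            exact_mod_cast Nat.factorial_le (Nat.le_succ r)
          calc _ ≤ δ * (r.factorial * B ^ r) :=
                mul_le_mul (hγ l) (hadj l i) (abs_nonneg _) hδ0
            _ ≤ δ * ((r + 1).factorial * B ^ r) := by gcongr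
            _ = _ := by ring
      _ = _ := by simp; ring
  refine ⟨M.det.natAbs, Int.natAbs_pos.mpr hM, ?_, ?_⟩
  · rw [Nat.cast_natAbs, Int.cast_abs]; exact hdet
  -- The sign of the determinant is moved into the numerators.
  · rcases Int.natAbs_eq M.det with h | h
    · refine ⟨fun i => ∑ l, v l * M.adjugate l i, fun i => ?_⟩
      have := hmain i
      rw [h] at this
      simpa using this
    · refine ⟨fun i => -∑ l, v l * M.adjugate l i, fun i => ?_⟩
      have := hmain i
      rw [h, ← abs_neg] at this
      refine le_trans (le_of_eq ?_) this
      congr 1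
      rw [Int.cast_neg, Int.cast_neg, Int.cast_natCast]
      ring

end
end FormsPrime

/-! ### Birch's form of Weyl's inequality -/

namespace FormsPrime
open MvPolynomial

noncomputable section

/-- The real polynomial `∑ i, γ_i G_i`. -/
def realForm {σ : Type*} {R : ℕ} (G : Fin R → MvPolynomial σ ℤ) (γ : Fin R → ℝ) :
    MvPolynomial σ ℝ :=
  ∑ i, C (γ i) * map (Int.castRingHom ℝ) (G i)

theorem realForm_isHomogeneous {σ : Type*} {R d : ℕ} {G : Fin R → MvPolynomial σ ℤ}
    (hG : ∀ i, (G i).IsHomogeneous d) (γ : Fin R → ℝ) : (realForm G γ).IsHomogeneous d := by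
  refine IsHomogeneous.sum _ _ _ fun i _ => ?_
  have := (isHomogeneous_C σ (γ i)).mul ((hG i).map (Int.castRingHom ℝ))
  rwa [zero_add] at this

theorem eval_realForm {σ : Type*} {R : ℕ} (G : Fin R → MvPolynomial σ ℤ) (γ : Fin R → ℝ)
    (x : σ → ℕ) : eval (fun j => (x j : ℝ)) (realForm G γ) = phase G γ x := by
  rw [realForm, phase, map_sum]
  refine Finset.sum_congr rfl fun i _ => ?_
  rw [map_mul, eval_C, eval_map]
  congr 1
  have := eval₂_comp_left (Int.castRingHom ℝ) (RingHom.id ℤ) (fun j => (x j : ℤ)) (G i)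
  rw [RingHom.comp_id] at this
  refine Eq.trans ?_ this.symm
  congr 1

theorem intPolar_realForm {σ : Type*} [Fintype σ] {R k : ℕ} (G : Fin R → MvPolynomial σ ℤ)
    (γ : Fin R → ℝ) (h : Fin k → σ → ℤ) (j : σ) :
    intPolar (realForm G γ) h j = ∑ i, γ i * ((polar (G i) h j : ℤ) : ℝ) := by
  rw [intPolar, realForm, polar_sum]
  refine Finset.sum_congr rfl fun i _ => ?_
  rw [polar_C_mul]
  congr 1
  exact polar_map (Int.castRingHom ℝ) (G i) h j

theorem exists_abs_polar_le {σ : Type*} [Fintype σ] {R : ℕ} (k : ℕ)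
    (G : Fin R → MvPolynomial σ ℤ) : ∃ c : ℝ, 1 ≤ c ∧ ∀ (h : Fin k → σ → ℤ) (A : ℝ) (_ : 0 ≤ A)
      (_ : ∀ a l, |(h a l : ℝ)| ≤ A) (i j), |((polar (G i) h j : ℤ) : ℝ)| ≤ c * A ^ k := by
  refine ⟨1 + ∑ i, ∑ j, ∑ J : Fin k → σ, |polarCoeff (map (Int.castRingHom ℝ) (G i)) J j|, ?_,
    fun h A hA0 hA i j => ?_⟩
  · have : 0 ≤ ∑ i, ∑ j, ∑ J : Fin k → σ, |polarCoeff (map (Int.castRingHom ℝ) (G i)) J j| := by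
      positivity
    linarith
  · have h1 := abs_polar_le (map (Int.castRingHom ℝ) (G i)) (fun a l => (h a l : ℝ)) j hA
    have h2 := polar_map (Int.castRingHom ℝ) (G i) h j
    have h3 : |((polar (G i) h j : ℤ) : ℝ)| ≤
        (∑ J : Fin k → σ, |polarCoeff (map (Int.castRingHom ℝ) (G i)) J j|) * A ^ k := by
      rw [show ((polar (G i) h j : ℤ) : ℝ) = polar (map (Int.castRingHom ℝ) (G i))
        (fun a l => (h a l : ℝ)) j from h2.symm]
      exact h1
    refine h3.trans ?_
    gcongr
    have h4 : ∑ J : Fin k → σ, |polarCoeff (map (Int.castRingHom ℝ) (G i)) J j| ≤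
        ∑ j, ∑ J : Fin k → σ, |polarCoeff (map (Int.castRingHom ℝ) (G i)) J j| :=
      Finset.single_le_sum (f := fun j =>
        ∑ J : Fin k → σ, |polarCoeff (map (Int.castRingHom ℝ) (G i)) J j|)
        (fun _ _ => by positivity) (Finset.mem_univ j)
    have h5 : ∑ j, ∑ J : Fin k → σ, |polarCoeff (map (Int.castRingHom ℝ) (G i)) J j| ≤
        ∑ i, ∑ j, ∑ J : Fin k → σ, |polarCoeff (map (Int.castRingHom ℝ) (G i)) J j| :=
      Finset.single_le_sum (f := fun i =>
        ∑ j, ∑ J : Fin k → σ, |polarCoeff (map (Int.castRingHom ℝ) (G i)) J j|)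
        (fun _ _ => by positivity) (Finset.mem_univ i)
    linarith

/-- The points `γ` of `ℝ ^ R` with a simultaneous rational approximation whose denominator is at
most `C X` and whose error is at most `C X / P ^ d`, in the sense of numerators. -/
def majorArcs (R d : ℕ) (C X P : ℝ) : Set (Fin R → ℝ) :=
  {γ | ∃ n : ℕ, 1 ≤ n ∧ (n : ℝ) ≤ C * X ∧ ∃ a : Fin R → ℤ, ∀ i, |n * γ i - a i| ≤ C * X / P ^ d}

variable {σ : Type*} [Fintype σ] [DecidableEq σ]

theorem sum_box_eq_sum_intBox {M : Type*} [AddCommMonoid M] (P : ℝ) (Φ : (σ → ℤ) → M) :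
    ∑ x ∈ box σ P, Φ (fun j => (x j : ℤ)) =
      ∑ x ∈ Fintype.piFinset fun _ : σ => Finset.Icc (1 : ℤ) ⌊P⌋₊, Φ x := by
  refine Finset.sum_bij' (fun x _ j => (x j : ℤ)) (fun x _ j => (x j).toNat) ?_ ?_ ?_ ?_ ?_
  · intro x hx
    simp only [box, Fintype.mem_piFinset, Finset.mem_Icc] at hx ⊢
    exact fun j => ⟨by exact_mod_cast (hx j).1, by exact_mod_cast (hx j).2⟩
  · intro x hx
    simp only [box, Fintype.mem_piFinset, Finset.mem_Icc] at hx ⊢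
    exact fun j => ⟨by have := hx j; omega, by have := hx j; omega⟩
  · intro x _; simp
  · intro x hx
    simp only [Fintype.mem_piFinset, Finset.mem_Icc] at hx
    funext j
    have := hx j
    simp only
    omega
  · intro x _; rfl

theorem card_box (P : ℝ) : (box σ P).card = ⌊P⌋₊ ^ Fintype.card σ := by
  simp [box, Fintype.card_piFinset]

theorem card_box_le {P : ℝ} (hP : 0 ≤ P) : ((box σ P).card : ℝ) ≤ P ^ Fintype.card σ := by
  rw [card_box]; push_cast
  gcongr
  exact Nat.floor_le hP

theorem one_le_log {P : ℝ} (hP : 3 ≤ P) : 1 ≤ Real.log P := by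
  rw [Real.le_log_iff_exp_le (by linarith)]
  linarith [Real.exp_one_lt_d9]

/-- Differencing and summation over one direction leave a count of tuples of size about `P` with
tolerance about `1/P`. Shrinking by `Y/P` makes the size about `Y` and the tolerance about `Y^k /
P^(k+1)`, which is what the approximation of `γ` requires. -/
theorem exists_norm_sum_pow_le (σ : Type*) [Fintype σ] [DecidableEq σ] {k : ℕ} (hk : 0 < k) :
    ∃ C : ℝ, 0 < C ∧ ∀ (P Y : ℝ) (_ : 3 ≤ P) (_ : 0 < Y) (_ : Y ≤ P) (p q : MvPolynomial σ ℝ)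
      (_ : p.IsHomogeneous (k + 1)) (_ : q.totalDegree ≤ k),
      ‖∑ x ∈ box σ P, e (eval (fun j => (x j : ℝ)) (p + q))‖ ^ 2 ^ k ≤
        C * (P ^ Fintype.card σ) ^ 2 ^ k * Real.log P ^ Fintype.card σ *
          (polarCount (k := k) p (fun _ => 2 * Y) (2 * Y ^ k / P ^ (k + 1)) /
            (Y ^ Fintype.card σ) ^ k) := by
  obtain ⟨C₁, hC₁, hshrink⟩ := exists_polarCount_le σ k
  set N := Fintype.card σ
  refine ⟨(3 ^ N) ^ (2 ^ k - (k + 1)) * 8 ^ N * C₁, by positivity,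
    fun P Y hP hY hYP p q hp hq => ?_⟩
  have hP0 : 0 < P := by linarith
  set Q := ⌊P⌋₊ with hQdef
  have hQ : 1 ≤ Q := Nat.one_le_floor_iff _ |>.mpr (by linarith)
  have hQP : (Q : ℝ) ≤ P := Nat.floor_le (by linarith)
  have hPQ : P ≤ 2 * Q := by
    have h1 := Nat.lt_floor_add_one P
    have h2 : (1 : ℝ) ≤ Q := by exact_mod_cast hQ
    linarith
  have hQ0 : (0 : ℝ) < Q := by exact_mod_cast hQ
  have hlogQ : 0 ≤ Real.log Q := Real.log_natCast_nonneg Q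
  have hlog : 1 + Real.log Q ≤ 2 * Real.log P := by
    have h1 := one_le_log hP
    have h2 := Real.log_le_log hQ0 hQP
    linarith
  have hlogP : 0 ≤ Real.log P := by linarith [one_le_log hP]
  have hpow : k + 1 ≤ 2 ^ k := Nat.lt_two_pow_self
  have h1 := norm_sum_box_pow_le (σ := σ) Q k (fun _ => 1) (fun _ => (Q : ℤ))
    (fun _ => by omega) _ _ (isDiffLinear_polar k p q hp hq)
  rw [← sum_box_eq_sum_intBox P
    (fun x => e (eval (fun j => (x j : ℝ)) (p + q)))] at h1
  simp only [Int.cast_natCast] at h1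
  have h2 := sum_prod_linBound_intPolar_le hk p hQ
  have h3 := hshrink p (2 * Q) (1 / Q) (Y / P) (by positivity) (by positivity)
    (by field_simp; norm_num) (by positivity) (by rw [div_le_one hP0]; exact hYP)
  have h4 : polarCount (k := k) p (fun _ => Y / P * (2 * Q)) ((Y / P) ^ k * (1 / Q)) ≤
      polarCount (k := k) p (fun _ => 2 * Y) (2 * Y ^ k / P ^ (k + 1)) := by
    refine polarCount_mono p (fun _ => ?_) ?_
    · calc Y / P * (2 * Q) ≤ Y / P * (2 * P) := by gcongr
        _ = 2 * Y := by field_simp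
    · rw [div_pow, pow_succ, div_mul_div_comm, div_le_div_iff₀ (by positivity) (by positivity)]
      nlinarith [show 0 < Y ^ k * P ^ k by positivity]
  set V : ℝ := ((polarCount (k := k) p (fun _ => 2 * Y) (2 * Y ^ k / P ^ (k + 1)) : ℕ) : ℝ)
  have h5 : (polarCount (k := k) p (fun _ => Y / P * (2 * Q)) ((Y / P) ^ k * (1 / Q)) : ℝ) ≤ V :=
    Nat.cast_le.mpr h4
  have h3' := h3.trans (mul_le_mul_of_nonneg_left h5 (by positivity))
  have h6 : ∑ h ∈ Fintype.piFinset (fun _ : Fin k => intBox σ (Q : ℝ)),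
      ∏ j, linBound Q (polar p (fun a l => (h a l : ℝ)) j) ≤
        (4 * P * (2 * Real.log P)) ^ N * (C₁ * (((Y / P)⁻¹) ^ N) ^ k * V) := by
    refine h2.trans ?_
    gcongr
  calc _ ≤ _ := h1
    _ ≤ ((3 * P) ^ N) ^ (2 ^ k - (k + 1)) *
          ((4 * P * (2 * Real.log P)) ^ N * (C₁ * (((Y / P)⁻¹) ^ N) ^ k * V)) := by
        have h7 : (((2 * Q + 1) ^ N : ℕ) : ℝ) ≤ (3 * P) ^ N := by
          push_cast
          have : (1 : ℝ) ≤ Q := by exact_mod_cast hQ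
          gcongr
          linarith
        gcongr
        refine Finset.sum_nonneg fun h _ => Finset.prod_nonneg fun j _ => linBound_nonneg _ _
    _ = _ := by
        have h8 : (P ^ N) ^ 2 ^ k = (P ^ N) ^ (2 ^ k - (k + 1)) * (P ^ N) ^ (k + 1) := by
          rw [← pow_add]; congr 1; omega
        rw [h8, inv_div, show 4 * P * (2 * Real.log P) = 8 * P * Real.log P by ring]
        simp only [mul_pow, div_pow]
        field_simp
        rw [pow_succ]
        ring

/-- Weyl's inequality of Birch for systems of forms. -/
theorem exists_norm_sum_le {R k : ℕ} (hR : 1 ≤ R) (hk : 0 < k) (G : Fin R → MvPolynomial σ ℤ)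
    (hG : ∀ i, (G i).IsHomogeneous (k + 1)) :
    ∃ C : ℝ, 1 ≤ C ∧ ∀ (P Y : ℝ) (_ : 3 ≤ P) (_ : 1 ≤ Y) (_ : Y ≤ P) (γ : Fin R → ℝ)
      (q : MvPolynomial σ ℝ) (_ : q.totalDegree ≤ k)
      (_ : γ ∉ majorArcs R (k + 1) C (Y ^ (k * R)) P),
      ‖∑ x ∈ box σ P, e (phase G γ x + eval (fun j => (x j : ℝ)) q)‖ ≤
        C * P ^ Fintype.card σ * Real.log P ^ Fintype.card σ *
          Y ^ (((affineDim (singularLocus G) : ℝ) - Fintype.card σ) / 2 ^ k) := by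
  classical
  obtain ⟨C₁, hC₁, hsum⟩ := exists_norm_sum_pow_le σ hk
  obtain ⟨C₂, hC₂, hcard⟩ := exists_card_minors_eq_zero_le hR hk G hG
  obtain ⟨c, hc, hpolar⟩ := exists_abs_polar_le k G
  set N := Fintype.card σ
  set D := affineDim (singularLocus G)
  set C₃ : ℝ := C₁ * C₂ * 2 ^ (D + (k - 1) * N) with hC₃
  have hC₃0 : 0 ≤ C₃ := by positivity
  set C₄ : ℝ := R * R.factorial * 2 * (c * 2 ^ k) ^ R with hC₄
  have hR1 : (1 : ℝ) ≤ R := by exact_mod_cast hR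
  have hRf : (1 : ℝ) ≤ R.factorial := by exact_mod_cast Nat.factorial_pos R
  have hc2 : 1 ≤ c * 2 ^ k := one_le_mul_of_one_le_of_one_le hc (one_le_pow₀ (by norm_num))
  have hC₄1 : 1 ≤ C₄ := by
    rw [hC₄]
    have := one_le_pow₀ (n := R) hc2
    have h2 : (1 : ℝ) ≤ R * R.factorial := one_le_mul_of_one_le_of_one_le hR1 hRf
    nlinarith
  refine ⟨C₄ + (1 + C₃), by linarith, fun P Y hP hY hYP γ q hq hγ => ?_⟩
  have hP0 : 0 < P := by linarith
  have hY0 : 0 < Y := by linarith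
  have hL := one_le_log hP
  have h1 := hsum P Y hP hY0 hYP (realForm G γ) q (realForm_isHomogeneous hG γ) hq
  simp only [map_add, eval_realForm] at h1
  set Z := (Fintype.piFinset fun _ : Fin k => intBox σ (2 * Y)).filter fun h =>
    ∀ j, NearInt (2 * Y ^ k / P ^ (k + 1)) (intPolar (realForm G γ) h j) with hZ
  have hZmem : ∀ h ∈ Z, ∀ a j, |(h a j : ℝ)| ≤ 2 * Y := fun h hh a j => by
    rw [hZ, Finset.mem_filter, Fintype.mem_piFinset] at hh
    exact mem_intBox.mp (hh.1 a) j
  -- A nonzero minor at a counted tuple would place `γ` on a major arc: the minor is `≪ Y^(kR)`, and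
  -- the error is `≪ Y^(k(R-1)) · Y^k / P^(k+1)`.
  have hdet : ∀ h ∈ Z, ∀ v : Fin R → σ, (Matrix.of fun i j => polar (G i) h (v j)).det = 0 := by
    intro h hh v
    by_contra hne
    apply hγ
    have h2 := exists_approx_of_det_ne_zero hR _ hne (B := c * (2 * Y) ^ k)
      (δ := 2 * Y ^ k / P ^ (k + 1))
      (fun i l => hpolar h (2 * Y) (by positivity) (hZmem h hh) i (v l)) γ (fun l => by
        rw [hZ, Finset.mem_filter] at hh
        have := hh.2 (v l)
        rw [intPolar_realForm] at this
        exact this)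
    obtain ⟨n, hn, hnB, a, ha⟩ := h2
    refine ⟨n, hn, hnB.trans ?_, a, fun i => (ha i).trans ?_⟩
    · calc R.factorial * (c * (2 * Y) ^ k) ^ R
          = 1 * R.factorial * 1 * (c * 2 ^ k) ^ R * Y ^ (k * R) := by
            rw [mul_pow 2 Y, ← mul_assoc, mul_pow, ← pow_mul]; ring
        _ ≤ R * R.factorial * 2 * (c * 2 ^ k) ^ R * Y ^ (k * R) := by gcongr; norm_num
        _ ≤ _ := by gcongr; linarith
    · calc R * R.factorial * ((c * (2 * Y) ^ k) ^ (R - 1) * (2 * Y ^ k / P ^ (k + 1)))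
          = R * R.factorial * 2 * (c * 2 ^ k) ^ (R - 1) * (Y ^ k) ^ (R - 1 + 1) / P ^ (k + 1) := by
            rw [mul_pow 2 Y, ← mul_assoc, mul_pow]; ring
        _ = R * R.factorial * 2 * (c * 2 ^ k) ^ (R - 1) * Y ^ (k * R) / P ^ (k + 1) := by
            rw [Nat.sub_add_cancel hR, ← pow_mul]
        _ ≤ R * R.factorial * 2 * (c * 2 ^ k) ^ R * Y ^ (k * R) / P ^ (k + 1) := by
            gcongr
            exact Nat.sub_le _ _
        _ ≤ _ := by gcongr; linarith
  have h2 := hcard (2 * Y) (by linarith) Z hZmem hdet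
  have h3 : ((polarCount (k := k) (realForm G γ) (fun _ => 2 * Y) (2 * Y ^ k / P ^ (k + 1)) : ℕ) : ℝ)
      = Z.card := rfl
  rw [h3] at h1
  have h4 : ‖∑ x ∈ box σ P, e (phase G γ x + eval (fun j => (x j : ℝ)) q)‖ ^ 2 ^ k ≤
      ((1 + C₃) * P ^ N * Real.log P ^ N * Y ^ (((D : ℝ) - N) / 2 ^ k)) ^ 2 ^ k := by
    calc _ ≤ _ := h1
      _ ≤ C₁ * (P ^ N) ^ 2 ^ k * Real.log P ^ N *
          (C₂ * (2 * Y) ^ (D + (k - 1) * N) / (Y ^ N) ^ k) := by gcongr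
      -- The exponent of `Y` is `D + (k-1)N - kN = D - N`.
      _ = C₃ * (P ^ N) ^ 2 ^ k * Real.log P ^ N * Y ^ ((D : ℝ) - N) := by
          rw [Real.rpow_sub hY0, Real.rpow_natCast, Real.rpow_natCast, hC₃, mul_pow 2 Y]
          obtain ⟨l, rfl⟩ : ∃ l, k = l + 1 := ⟨k - 1, by omega⟩
          rw [Nat.add_sub_cancel, pow_succ (Y ^ N) l, ← pow_mul, pow_add Y, mul_comm l N]
          field_simp
          rw [pow_mul]
      -- The constant and the logarithm are enlarged to `2^k`-th powers, so that the root can be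
      -- taken.
      _ ≤ (1 + C₃) ^ 2 ^ k * (P ^ N) ^ 2 ^ k * (Real.log P ^ N) ^ 2 ^ k * Y ^ ((D : ℝ) - N) := by
          have h5 : C₃ ≤ (1 + C₃) ^ 2 ^ k :=
            (by linarith : C₃ ≤ 1 + C₃).trans (le_self_pow₀ (by linarith) (by positivity))
          have h6 : Real.log P ^ N ≤ (Real.log P ^ N) ^ 2 ^ k :=
            le_self_pow₀ (one_le_pow₀ hL) (by positivity)
          gcongr
      _ = _ := by
          rw [mul_pow, mul_pow, mul_pow, ← Real.rpow_natCast (Y ^ _) (2 ^ k), ← Real.rpow_mul hY0.le]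
          congr 2
          push_cast
          field_simp
  have hL0 : 0 ≤ Real.log P := by linarith
  refine (le_of_pow_le_pow_left₀ (by positivity) (by positivity) h4).trans ?_
  gcongr
  linarith

end
end FormsPrime

/-! ### Major arcs: measure and a kernel built from dyadic shells -/

namespace FormsPrime
open MvPolynomial MeasureTheory

noncomputable section

/-- The saving in Weyl's inequality for a system of `R` forms of degree `k + 1`. -/
def weylExponent {σ : Type*} [Fintype σ] {R : ℕ} (k : ℕ) (G : Fin R → MvPolynomial σ ℤ) : ℝ :=
  ((Fintype.card σ : ℝ) - affineDim (singularLocus G)) / (2 ^ k * k * R)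

/-- Take `Y = X ^ (1 / (kR))` in Birch's inequality. For `X < 1` the trivial bound suffices, as the
power of `X` is at least `1`. -/
theorem exists_norm_sum_le_of_notMem_majorArcs {σ : Type*} [Fintype σ] [DecidableEq σ] {R k : ℕ}
    (hR : 1 ≤ R) (hk : 0 < k) (G : Fin R → MvPolynomial σ ℤ)
    (hG : ∀ i, (G i).IsHomogeneous (k + 1)) (hA : 0 ≤ weylExponent k G) :
    ∃ C : ℝ, 1 ≤ C ∧ ∀ (P X : ℝ) (_ : 3 ≤ P) (_ : 0 < X) (_ : X ≤ P ^ (k * R)) (γ : Fin R → ℝ)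
      (q : MvPolynomial σ ℝ) (_ : q.totalDegree ≤ k) (_ : γ ∉ majorArcs R (k + 1) C X P),
      ‖∑ x ∈ box σ P, e (phase G γ x + eval (fun j => (x j : ℝ)) q)‖ ≤
        C * P ^ Fintype.card σ * Real.log P ^ Fintype.card σ * X ^ (-weylExponent k G) := by
  obtain ⟨C, hC, h⟩ := exists_norm_sum_le hR hk G hG
  refine ⟨C, hC, fun P X hP hX hXP γ q hq hγ => ?_⟩
  have hP0 : 0 < P := by linarith
  have hL := one_le_log hP
  have hkR : (0 : ℝ) < k * R := by
    have : (0 : ℝ) < k := by exact_mod_cast hk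
    have : (0 : ℝ) < R := by exact_mod_cast hR
    positivity
  rcases le_or_gt 1 X with hX1 | hX1
  · set Y := X ^ (1 / ((k : ℝ) * R)) with hYdef
    have hY1 : 1 ≤ Y := Real.one_le_rpow hX1 (by positivity)
    have hYX : Y ^ (k * R) = X := by
      rw [hYdef, ← Real.rpow_natCast, ← Real.rpow_mul hX.le]
      push_cast
      rw [one_div_mul_cancel hkR.ne', Real.rpow_one]
    have hYP : Y ≤ P := by
      refine le_of_pow_le_pow_left₀ (n := k * R) (by positivity) hP0.le ?_
      rw [hYX]; exact hXP
    have h1 := h P Y hP hY1 hYP γ q hq (by rw [hYX]; exact hγ)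
    refine h1.trans_eq ?_
    congr 1
    rw [hYdef, ← Real.rpow_mul hX.le]
    congr 1
    rw [weylExponent]
    field_simp
    ring
  · have h1 : ‖∑ x ∈ box σ P, e (phase G γ x + eval (fun j => (x j : ℝ)) q)‖ ≤
        P ^ Fintype.card σ := by
      refine (norm_sum_le _ _).trans ?_
      simp only [norm_e, Finset.sum_const, nsmul_eq_mul, mul_one]
      exact card_box_le hP0.le
    have h2 : 1 ≤ X ^ (-weylExponent k G) :=
      Real.one_le_rpow_of_pos_of_le_one_of_nonpos hX hX1.le (by linarith)
    have h3 : 1 ≤ Real.log P ^ Fintype.card σ := one_le_pow₀ hL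
    calc _ ≤ _ := h1
      _ = 1 * P ^ Fintype.card σ * 1 * 1 := by ring
      _ ≤ _ := by gcongr

theorem majorArcs_eq_iUnion (R d : ℕ) (C X P : ℝ) : majorArcs R d C X P =
    ⋃ (n : ℕ) (_ : 1 ≤ n ∧ (n : ℝ) ≤ C * X) (a : Fin R → ℤ),
      {γ : Fin R → ℝ | ∀ i, |n * γ i - a i| ≤ C * X / P ^ d} := by
  ext γ
  simp [majorArcs, and_assoc]

theorem measurableSet_majorArcs (R d : ℕ) (C X P : ℝ) : MeasurableSet (majorArcs R d C X P) := by
  rw [majorArcs_eq_iUnion]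
  refine MeasurableSet.iUnion fun n => MeasurableSet.iUnion fun _ => MeasurableSet.iUnion fun a => ?_
  rw [Set.ofPred_forall]
  refine MeasurableSet.iInter fun i => IsClosed.measurableSet ?_
  exact isClosed_le (by fun_prop) continuous_const

theorem volume_real_Icc_pi {R : ℕ} {a b : Fin R → ℝ} {l : ℝ} (hl : 0 ≤ l)
    (h : ∀ i, b i - a i = l) : volume.real (Set.Icc a b) = l ^ R := by
  rw [Measure.real, Real.volume_Icc_pi_toReal (fun i => by have := h i; linarith)]
  simp [h]

/-- For a denominator `n` there are `≪ n^R` numerators meeting the cube, each with a box of measure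
`≪ (X / (n P^d))^R`. The powers of `n` cancel, and there are `≪ X` denominators. -/
theorem exists_volume_majorArcs_le (R d : ℕ) {C : ℝ} (hC : 0 < C) :
    ∃ C' : ℝ, 0 < C' ∧ ∀ (P X : ℝ) (_ : 0 < P) (_ : 0 < X) (_ : X ≤ P ^ d),
      volume.real (Set.Icc (fun _ => -2) (fun _ => 2) ∩ majorArcs R d C X P) ≤
        C' * (X ^ (R + 1) / P ^ (R * d)) := by
  set c := ⌈C⌉₊
  have hc : C ≤ c := Nat.le_ceil C
  refine ⟨C * ((5 + 2 * c) * (2 * C)) ^ R, by positivity, fun P X hP hX hXP => ?_⟩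
  set ε := C * X / P ^ d with hε
  have hε0 : 0 ≤ ε := by positivity
  have hεC : ε ≤ c := by
    refine le_trans ?_ hc
    rw [hε, div_le_iff₀ (by positivity)]
    gcongr
  set S : ℕ → (Fin R → ℤ) → Set (Fin R → ℝ) := fun n a =>
    Set.Icc (fun i => (a i - ε) / n) (fun i => (a i + ε) / n) with hS
  have hsub : Set.Icc (fun _ => -2) (fun _ => 2) ∩ majorArcs R d C X P ⊆
      ⋃ n ∈ Finset.Icc 1 ⌊C * X⌋₊, ⋃ a ∈ intBox (Fin R) ((2 * n + c : ℕ) : ℝ), S n a := by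
    rintro γ ⟨hγ, n, hn, hnX, a, ha⟩
    have hn0 : (0 : ℝ) < n := by exact_mod_cast hn
    simp only [Set.mem_iUnion, Finset.mem_Icc]
    refine ⟨n, ⟨hn, Nat.le_floor hnX⟩, a, ?_, ?_⟩
    · rw [mem_intBox]
      intro j
      have h1 := abs_le.mp (ha j)
      have h2 : -2 ≤ γ j := hγ.1 j
      have h3 : γ j ≤ 2 := hγ.2 j
      have h4 : (n : ℝ) * γ j ≤ n * 2 := by gcongr
      have h5 : (n : ℝ) * (-2) ≤ n * γ j := by gcongr
      push_cast
      rw [abs_le]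
      constructor <;> linarith
    · constructor <;> intro i <;> have h1 := abs_le.mp (ha i)
      · simp only
        rw [div_le_iff₀ hn0]
        linarith
      · simp only
        rw [le_div_iff₀ hn0]
        linarith
  have hcompact : IsCompact (⋃ n ∈ Finset.Icc 1 ⌊C * X⌋₊,
      ⋃ a ∈ intBox (Fin R) ((2 * n + c : ℕ) : ℝ), S n a) :=
    Finset.isCompact_biUnion _ fun _ _ => Finset.isCompact_biUnion _ fun _ _ => isCompact_Icc
  calc volume.real (Set.Icc (fun _ => -2) (fun _ => 2) ∩ majorArcs R d C X P)
      ≤ volume.real (⋃ n ∈ Finset.Icc 1 ⌊C * X⌋₊,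
          ⋃ a ∈ intBox (Fin R) ((2 * n + c : ℕ) : ℝ), S n a) :=
        measureReal_mono hsub hcompact.measure_lt_top.ne
    _ ≤ ∑ n ∈ Finset.Icc 1 ⌊C * X⌋₊,
          volume.real (⋃ a ∈ intBox (Fin R) ((2 * n + c : ℕ) : ℝ), S n a) :=
        measureReal_biUnion_finset_le _ _
    _ ≤ ∑ n ∈ Finset.Icc 1 ⌊C * X⌋₊, ((5 + 2 * c) * (2 * ε)) ^ R := by
        refine Finset.sum_le_sum fun n hn => ?_
        have hn1 : (1 : ℝ) ≤ n := by exact_mod_cast (Finset.mem_Icc.mp hn).1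
        refine (measureReal_biUnion_finset_le _ _).trans ?_
        have h1 : ∀ a, volume.real (S n a) = (2 * ε / n) ^ R := fun a =>
          volume_real_Icc_pi (by positivity) fun i => by ring
        simp only [h1, Finset.sum_const, nsmul_eq_mul]
        rw [card_intBox_natCast, Fintype.card_fin]
        push_cast
        rw [← mul_pow]
        refine pow_le_pow_left₀ (by positivity) ?_ R
        calc (2 * (2 * (n : ℝ) + c) + 1) * (2 * ε / n) ≤ ((5 + 2 * c) * n) * (2 * ε / n) := by
              gcongr
              nlinarith [show (0 : ℝ) ≤ c by positivity]
          _ = _ := by field_simp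
    _ ≤ (C * X) * ((5 + 2 * c) * (2 * ε)) ^ R := by
        rw [Finset.sum_const, nsmul_eq_mul, Nat.card_Icc, Nat.add_sub_cancel]
        gcongr
        exact Nat.floor_le (by positivity)
    _ = _ := by
        rw [hε, mul_comm R d, pow_mul P d R, show (5 + 2 * (c : ℝ)) * (2 * (C * X / P ^ d)) =
          (5 + 2 * c) * (2 * C) * (X / P ^ d) by ring, mul_pow, div_pow]
        ring

theorem continuous_phase {σ : Type*} {R : ℕ} (G : Fin R → MvPolynomial σ ℤ) (x : σ → ℕ) :
    Continuous fun α : Fin R → ℝ => phase G α x := by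
  unfold phase
  fun_prop

/-- A majorant for the values of Weyl sums outside the major arcs, of small mean value. -/
theorem exists_kernel {R d : ℕ} (hR : 1 ≤ R) {C A : ℝ} (hC : 0 < C) (hA : (R : ℝ) + 1 < A) :
    ∃ C' : ℝ, 0 < C' ∧ ∀ (P X : ℝ) (_ : 1 ≤ P) (_ : 0 < X)
      (_ : X ^ (R + 1) ≤ P ^ (R * d)),
      ∃ ω : (Fin R → ℝ) → ℝ, Measurable ω ∧ (∀ γ, 0 ≤ ω γ) ∧ (∃ b, ∀ γ, ω γ ≤ b) ∧
        ∫ γ in Set.Icc (fun _ => -2) (fun _ => 2), ω γ ≤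
          C' * (X ^ ((R : ℝ) + 1 - A) / P ^ (R * d)) ∧
        ∀ γ, γ ∉ majorArcs R d C X P → ∃ X', 0 < X' ∧ X' ^ (R + 1) ≤ P ^ (R * d) ∧
          γ ∉ majorArcs R d C X' P ∧ X' ^ (-A) ≤ ω γ := by
  classical
  obtain ⟨C₁, hC₁, hvol⟩ := exists_volume_majorArcs_le R d hC
  set r : ℝ := 2 ^ ((R : ℝ) + 1 - A) with hr
  have hr0 : 0 < r := by positivity
  have hr1 : r < 1 := Real.rpow_lt_one_of_one_lt_of_neg (by norm_num) (by linarith)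
  have h1r : 0 < 1 - r := by linarith
  refine ⟨C₁ * 2 ^ (R + 1) * (1 - r)⁻¹ + 4 ^ R * 2 ^ (R + 1), by positivity,
    fun P X hP hX hXP => ?_⟩
  have hP0 : 0 < P := by linarith
  have hPd : 0 < P ^ (R * d) := by positivity
  have hbdd : ∃ n : ℕ, P ^ (R * d) < ((2 : ℝ) ^ n * X) ^ (R + 1) := by
    obtain ⟨n, hn⟩ := pow_unbounded_of_one_lt (P ^ (R * d) / X ^ (R + 1)) (one_lt_two (α := ℝ))
    refine ⟨n, ?_⟩
    rw [mul_pow]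
    rw [div_lt_iff₀ (by positivity)] at hn
    refine hn.trans_le ?_
    gcongr
    exact le_self_pow₀ (one_le_pow₀ (by norm_num)) (by omega)
  -- `K` is the last dyadic index with `(2^K X)^(R+1) ≤ P^(Rd)`.
  obtain ⟨K, hK⟩ : ∃ K, Nat.find hbdd = K + 1 := by
    refine ⟨Nat.find hbdd - 1, ?_⟩
    have : Nat.find hbdd ≠ 0 := by
      intro h0
      have := Nat.find_spec hbdd
      rw [h0] at this
      simp only [pow_zero, one_mul] at this
      linarith
    omega
  have hK1 : P ^ (R * d) < ((2 : ℝ) ^ (K + 1) * X) ^ (R + 1) := by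
    have := Nat.find_spec hbdd
    rwa [hK] at this
  have hK2 : ∀ i ≤ K, ((2 : ℝ) ^ i * X) ^ (R + 1) ≤ P ^ (R * d) := fun i hi =>
    not_lt.mp (Nat.find_min hbdd (by omega))
  have hX2 : ∀ i : ℕ, 0 < (2 : ℝ) ^ i * X := fun i => by positivity
  have hle : ∀ i ≤ K, (2 : ℝ) ^ i * X ≤ P ^ d := fun i hi => by
    refine le_of_pow_le_pow_left₀ (n := R + 1) (by omega) (by positivity) ((hK2 i hi).trans ?_)
    rw [← pow_mul]
    refine pow_le_pow_right₀ hP ?_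
    nlinarith
  set M : ℕ → Set (Fin R → ℝ) := fun i => majorArcs R d C (2 ^ i * X) P with hM
  have hMmeas : ∀ i, MeasurableSet (M i) := fun i => measurableSet_majorArcs _ _ _ _ _
  -- The `i`-th term takes care of points that lie in `M (i+1)` but not in `M i`, where Weyl's
  -- inequality holds with parameter `2^i X`. The constant serves the points outside all the `M i`.
  set ω : (Fin R → ℝ) → ℝ := fun γ =>
    (∑ i ∈ Finset.range K, (M (i + 1)).indicator (fun _ => ((2 : ℝ) ^ i * X) ^ (-A)) γ) +
      ((2 : ℝ) ^ K * X) ^ (-A) with hω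
  have hc0 : ∀ i : ℕ, 0 ≤ ((2 : ℝ) ^ i * X) ^ (-A) := fun i => by positivity
  have hind0 : ∀ i γ, 0 ≤ (M (i + 1)).indicator (fun _ => ((2 : ℝ) ^ i * X) ^ (-A)) γ :=
    fun i γ => Set.indicator_nonneg (fun _ _ => hc0 i) γ
  refine ⟨ω, ?_, fun γ => ?_, ⟨(∑ i ∈ Finset.range K, ((2 : ℝ) ^ i * X) ^ (-A)) +
      ((2 : ℝ) ^ K * X) ^ (-A), fun γ => ?_⟩, ?_, fun γ hγ => ?_⟩
  · refine Measurable.add_const (Finset.measurable_sum _ fun i _ => ?_) _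
    exact measurable_const.indicator (hMmeas _)
  · exact add_nonneg (Finset.sum_nonneg fun i _ => hind0 i γ) (hc0 K)
  · rw [hω]
    simp only [add_le_add_iff_right]
    exact Finset.sum_le_sum fun i _ => Set.indicator_le_self' (fun _ _ => hc0 i) γ
  · have hfin : IsFiniteMeasure (volume.restrict
        (Set.Icc (fun _ => -2) (fun _ => 2) : Set (Fin R → ℝ))) :=
      ⟨by rw [Measure.restrict_apply_univ]; exact isCompact_Icc.measure_lt_top⟩
    have hint : ∀ i, Integrable ((M (i + 1)).indicator fun _ => ((2 : ℝ) ^ i * X) ^ (-A))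
        (volume.restrict (Set.Icc (fun _ => -2) (fun _ => 2) : Set (Fin R → ℝ))) := fun i =>
      (integrable_const _).indicator (hMmeas _)
    rw [hω, integral_add (integrable_finsetSum _ fun i _ => hint i) (integrable_const _),
      integral_finsetSum _ fun i _ => hint i]
    -- Measure times height of the `i`-th term is `≪ (2^i X)^(R+1-A) / P^(Rd)`, a geometric sequence
    -- of ratio `r < 1` because `A > R + 1`.
    have h1 : ∀ i ∈ Finset.range K, ∫ γ in Set.Icc (fun _ => -2) (fun _ => 2),
        (M (i + 1)).indicator (fun _ => ((2 : ℝ) ^ i * X) ^ (-A)) γ ≤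
          C₁ * 2 ^ (R + 1) * (X ^ ((R : ℝ) + 1 - A) / P ^ (R * d)) * r ^ i := by
      intro i hi
      rw [integral_indicator (hMmeas _), Measure.restrict_restrict (hMmeas _), setIntegral_const,
        Set.inter_comm, smul_eq_mul]
      have h2 := hvol P (2 ^ (i + 1) * X) hP0 (hX2 _) (hle _ (Finset.mem_range.mp hi))
      calc _ ≤ C₁ * ((2 ^ (i + 1) * X) ^ (R + 1) / P ^ (R * d)) * ((2 : ℝ) ^ i * X) ^ (-A) := by
            gcongr
        _ = C₁ * 2 ^ (R + 1) * ((((2 : ℝ) ^ i * X) ^ (R + 1) * ((2 : ℝ) ^ i * X) ^ (-A))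
              / P ^ (R * d)) := by
            rw [show (2 : ℝ) ^ (i + 1) * X = 2 ^ i * X * 2 by ring, mul_pow _ (2 : ℝ)]; ring
        _ = C₁ * 2 ^ (R + 1) * ((((2 : ℝ) ^ i * X) ^ ((R : ℝ) + 1 - A)) / P ^ (R * d)) := by
            rw [sub_eq_add_neg, Real.rpow_add (hX2 i), ← Nat.cast_succ, Real.rpow_natCast]
        _ = _ := by
            rw [Real.mul_rpow (by positivity) hX.le, hr, ← Real.rpow_natCast 2 i,
              ← Real.rpow_mul (by norm_num), mul_comm (i : ℝ), Real.rpow_mul (by norm_num),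
              Real.rpow_natCast]
            ring
    have h3 : ∑ i ∈ Finset.range K, r ^ i ≤ (1 - r)⁻¹ := by
      rw [← tsum_geometric_of_lt_one hr0.le hr1]
      exact (summable_geometric_of_lt_one hr0.le hr1).sum_le_tsum _ fun _ _ => by positivity
    -- By the choice of `K`, `(2^K X)^(R+1)` is comparable with `P^(Rd)`, so the constant term is as
    -- small as the first term of the series.
    have h4 : ((2 : ℝ) ^ K * X) ^ (-A) ≤
        2 ^ (R + 1) * (X ^ ((R : ℝ) + 1 - A) / P ^ (R * d)) := by
      have h5 : ((2 : ℝ) ^ K * X) ^ (-A) =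
          ((2 : ℝ) ^ K * X) ^ ((R : ℝ) + 1 - A) / ((2 : ℝ) ^ K * X) ^ (R + 1) := by
        rw [eq_div_iff (by positivity), ← Real.rpow_natCast _ (R + 1), ← Real.rpow_add (hX2 K)]
        congr 1
        push_cast
        ring
      have h6 : ((2 : ℝ) ^ K * X) ^ ((R : ℝ) + 1 - A) ≤ X ^ ((R : ℝ) + 1 - A) :=
        Real.rpow_le_rpow_of_nonpos hX (le_mul_of_one_le_left hX.le (one_le_pow₀ (by norm_num)))
          (by linarith)
      rw [h5, mul_div_assoc', div_le_div_iff₀ (by positivity) hPd]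
      have h7 : P ^ (R * d) ≤ 2 ^ (R + 1) * ((2 : ℝ) ^ K * X) ^ (R + 1) := by
        refine hK1.le.trans_eq ?_
        rw [← mul_pow, pow_succ]; ring
      calc _ ≤ X ^ ((R : ℝ) + 1 - A) * (2 ^ (R + 1) * ((2 : ℝ) ^ K * X) ^ (R + 1)) := by gcongr
        _ = _ := by ring
    have h8 : volume.real (Set.Icc (fun _ => -2) (fun _ => 2) : Set (Fin R → ℝ)) = 4 ^ R :=
      volume_real_Icc_pi (by norm_num) fun i => by norm_num
    rw [setIntegral_const, smul_eq_mul, h8]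
    have h9 := Finset.sum_le_sum h1
    rw [← Finset.mul_sum] at h9
    calc _ ≤ C₁ * 2 ^ (R + 1) * (X ^ ((R : ℝ) + 1 - A) / P ^ (R * d)) * (1 - r)⁻¹ +
          4 ^ R * (2 ^ (R + 1) * (X ^ ((R : ℝ) + 1 - A) / P ^ (R * d))) := by
          refine add_le_add (h9.trans ?_) ?_ <;> gcongr
      _ = _ := by ring
  · by_cases hall : ∀ i ≤ K, γ ∉ M i
    · refine ⟨2 ^ K * X, hX2 K, hK2 K le_rfl, hall K le_rfl, ?_⟩
      rw [hω]
      simp only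
      have := Finset.sum_nonneg fun i (_ : i ∈ Finset.range K) => hind0 i γ
      linarith
    · push Not at hall
      -- The first arcs containing `γ`; the index before it provides `X'`.
      obtain ⟨i, ⟨hi, hiM⟩, hmin⟩ : ∃ i, (i ≤ K ∧ γ ∈ M i) ∧ ∀ j < i, ¬ (j ≤ K ∧ γ ∈ M j) :=
        ⟨Nat.find hall, Nat.find_spec hall, fun j hj => Nat.find_min hall hj⟩
      obtain ⟨j, rfl⟩ : ∃ j, i = j + 1 := by
        refine ⟨i - 1, ?_⟩
        have : i ≠ 0 := by
          rintro rfl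
          apply hγ
          simpa [hM] using hiM
        omega
      refine ⟨2 ^ j * X, hX2 j, hK2 j (by omega), fun h => hmin j (by omega) ⟨by omega, h⟩, ?_⟩
      rw [hω]
      simp only
      have h1 := Finset.single_le_sum (f := fun i =>
        (M (i + 1)).indicator (fun _ => ((2 : ℝ) ^ i * X) ^ (-A)) γ)
        (fun i _ => hind0 i γ) (Finset.mem_range.mpr (by omega : j < K))
      simp only [Set.indicator_of_mem hiM] at h1
      linarith [hc0 K]

end
end FormsPrime

/-! ### Schur's test, tame amplitudes and the large sieve -/

namespace FormsPrime
open MvPolynomial MeasureTheory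

noncomputable section

section Schur

variable {R : ℕ} {𝔫 : Set (Fin R → ℝ)}

/-- The row and column bounds of Schur's test, by translation invariance. -/
theorem setIntegral_comp_sub_le {κ : (Fin R → ℝ) → ℝ} (hκ0 : ∀ γ, 0 ≤ κ γ) (hκ : Integrable κ) :
    (∀ α, ∫ β in 𝔫, κ (α - β) ≤ ∫ γ, κ γ) ∧ ∀ β, ∫ α in 𝔫, κ (α - β) ≤ ∫ γ, κ γ := by
  constructor
  · intro α
    rw [← integral_sub_left_eq_self κ volume α]
    exact setIntegral_le_integral (hκ.comp_sub_left α) (Filter.Eventually.of_forall fun _ => hκ0 _)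
  · intro β
    rw [← integral_sub_right_eq_self κ β]
    exact setIntegral_le_integral (hκ.comp_sub_right β) (Filter.Eventually.of_forall fun _ => hκ0 _)

variable [IsFiniteMeasure (volume.restrict 𝔫)]

theorem integrable_kernel_mul {κ : (Fin R → ℝ) → ℝ} (hκm : Measurable κ) (hκ0 : ∀ γ, 0 ≤ κ γ)
    {b : ℝ} (hκb : ∀ γ, κ γ ≤ b) {w : (Fin R → ℝ) × (Fin R → ℝ) → ℝ} (hwm : Measurable w)
    (hw0 : ∀ p, 0 ≤ w p) {c : ℝ} (hwc : ∀ p, w p ≤ c) :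
    Integrable (fun p : (Fin R → ℝ) × (Fin R → ℝ) => κ (p.1 - p.2) * w p)
      ((volume.restrict 𝔫).prod (volume.restrict 𝔫)) := by
  refine Integrable.of_bound (C := b * c)
    ((hκm.comp (measurable_fst.sub measurable_snd)).mul hwm).aestronglyMeasurable
    (Filter.Eventually.of_forall fun p => ?_)
  rw [Real.norm_eq_abs, abs_of_nonneg (mul_nonneg (hκ0 _) (hw0 _))]
  exact mul_le_mul (hκb _) (hwc _) (hw0 _) ((hκ0 _).trans (hκb (p.1 - p.2)))

theorem integral_kernel_mul_le {κ : (Fin R → ℝ) → ℝ} (hκm : Measurable κ) (hκ0 : ∀ γ, 0 ≤ κ γ)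
    {b : ℝ} (hκb : ∀ γ, κ γ ≤ b) (hκ : Integrable κ) {w : (Fin R → ℝ) → ℝ} (hwm : Measurable w)
    (hw0 : ∀ γ, 0 ≤ w γ) {c : ℝ} (hwc : ∀ γ, w γ ≤ c) :
    ∫ p, κ (p.1 - p.2) * w p.1 ∂((volume.restrict 𝔫).prod (volume.restrict 𝔫)) ≤
        (∫ γ, κ γ) * ∫ α in 𝔫, w α ∧
      ∫ p, κ (p.1 - p.2) * w p.2 ∂((volume.restrict 𝔫).prod (volume.restrict 𝔫)) ≤
        (∫ γ, κ γ) * ∫ α in 𝔫, w α := by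
  have hwi : Integrable w (volume.restrict 𝔫) := by
    refine Integrable.of_bound (C := c) hwm.aestronglyMeasurable
      (Filter.Eventually.of_forall fun p => ?_)
    rw [Real.norm_eq_abs, abs_of_nonneg (hw0 _)]
    exact hwc _
  constructor
  · rw [integral_prod _ (integrable_kernel_mul hκm hκ0 hκb (w := fun p => w p.1) (hwm.comp measurable_fst)
      (fun _ => hw0 _) (fun _ => hwc _)), ← integral_const_mul]
    refine integral_mono_of_nonneg (Filter.Eventually.of_forall fun α => ?_) (hwi.const_mul _)
      (Filter.Eventually.of_forall fun α => ?_)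
    · exact integral_nonneg fun β => mul_nonneg (hκ0 _) (hw0 _)
    · simp only
      rw [integral_mul_const]
      exact mul_le_mul_of_nonneg_right ((setIntegral_comp_sub_le hκ0 hκ).1 α) (hw0 α)
  · rw [integral_prod_symm _ (integrable_kernel_mul hκm hκ0 hκb (w := fun p => w p.2) (hwm.comp measurable_snd)
      (fun _ => hw0 _) (fun _ => hwc _)), ← integral_const_mul]
    refine integral_mono_of_nonneg (Filter.Eventually.of_forall fun α => ?_) (hwi.const_mul _)
      (Filter.Eventually.of_forall fun α => ?_)
    · exact integral_nonneg fun β => mul_nonneg (hκ0 _) (hw0 _)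
    · simp only
      rw [integral_mul_const]
      exact mul_le_mul_of_nonneg_right ((setIntegral_comp_sub_le hκ0 hκ).2 α) (hw0 α)

/-- A large sieve inequality of `T T^*` type. -/
theorem sum_norm_integral_sq_le {ι : Type*} (s : Finset ι) (a : ι → (Fin R → ℝ) → ℂ)
    (h𝔫 : MeasurableSet 𝔫) (ham : ∀ i ∈ s, Measurable (a i)) {c : ℝ}
    (hac : ∀ i ∈ s, ∀ α, ‖a i α‖ ≤ c) {ψ χ : (Fin R → ℝ) → ℝ} (hψm : Measurable ψ)
    (hχm : Measurable χ) (hψ0 : ∀ γ, 0 ≤ ψ γ) (hχ0 : ∀ γ, 0 ≤ χ γ) {b : ℝ} (hψb : ∀ γ, ψ γ ≤ b)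
    (hχb : ∀ γ, χ γ ≤ b) (hψ : Integrable ψ) (hχ : Integrable χ)
    (hker : ∀ α ∈ 𝔫, ∀ β ∈ 𝔫, ‖∑ i ∈ s, a i α * (starRingEnd ℂ) (a i β)‖ ≤
      ψ (α - β) + χ (α - β) * ((∑ i ∈ s, ‖a i α‖ ^ 2 + ∑ i ∈ s, ‖a i β‖ ^ 2) / 2)) :
    ∑ i ∈ s, ‖∫ α in 𝔫, a i α‖ ^ 2 ≤ (∫ γ, ψ γ) * volume.real 𝔫 +
      (∫ γ, χ γ) * ∑ i ∈ s, ∫ α in 𝔫, ‖a i α‖ ^ 2 := by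
  set μ := volume.restrict 𝔫 with hμ
  set w : (Fin R → ℝ) → ℝ := fun α => ∑ i ∈ s, ‖a i α‖ ^ 2 with hw
  have hwm : Measurable w := Finset.measurable_sum _ fun i hi => ((ham i hi).norm.pow_const 2)
  have hw0 : ∀ γ, 0 ≤ w γ := fun γ => Finset.sum_nonneg fun i _ => by positivity
  have hwc : ∀ γ, w γ ≤ ∑ _i ∈ s, c ^ 2 := fun γ => Finset.sum_le_sum fun i hi =>
    pow_le_pow_left₀ (norm_nonneg _) (hac i hi γ) 2
  have hint : ∀ i ∈ s, Integrable (a i) μ := fun i hi =>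
    Integrable.of_bound (C := c) (ham i hi).aestronglyMeasurable
      (Filter.Eventually.of_forall fun α => hac i hi α)
  have hint2 : ∀ i ∈ s, Integrable (fun p : (Fin R → ℝ) × (Fin R → ℝ) =>
      a i p.1 * (starRingEnd ℂ) (a i p.2)) (μ.prod μ) := fun i hi =>
    (hint i hi).mul_prod ((RCLike.conjCLE (K := ℂ)).integrable_comp_iff.mpr (hint i hi))
  -- The squares are opened and the sum is taken inside, so that the double integral sees the
  -- correlation sums bounded in `hker`.
  have hsum : ((∑ i ∈ s, ‖∫ α, a i α ∂μ‖ ^ 2 : ℝ) : ℂ) =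
      ∫ p, ∑ i ∈ s, a i p.1 * (starRingEnd ℂ) (a i p.2) ∂(μ.prod μ) := by
    rw [integral_finsetSum _ hint2]
    push_cast
    refine Finset.sum_congr rfl fun i _ => ?_
    rw [integral_prod_mul (a i) (fun β => (starRingEnd ℂ) (a i β)), integral_conj,
      Complex.mul_conj']
  have hψ1 := integrable_kernel_mul (𝔫 := 𝔫) hψm hψ0 hψb (w := fun _ => 1) measurable_const
    (fun _ => zero_le_one) (fun _ => le_rfl)
  have hχ1 := integrable_kernel_mul (𝔫 := 𝔫) hχm hχ0 hχb (w := fun p => w p.1)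
    (hwm.comp measurable_fst) (fun _ => hw0 _) (fun _ => hwc _)
  have hχ2 := integrable_kernel_mul (𝔫 := 𝔫) hχm hχ0 hχb (w := fun p => w p.2)
    (hwm.comp measurable_snd) (fun _ => hw0 _) (fun _ => hwc _)
  have hχs : Integrable (fun p : (Fin R → ℝ) × (Fin R → ℝ) => 1 / 2 * (χ (p.1 - p.2) * w p.1) +
      1 / 2 * (χ (p.1 - p.2) * w p.2)) (μ.prod μ) :=
    (hχ1.const_mul (1 / 2)).add (hχ2.const_mul (1 / 2))
  have hmain : ∑ i ∈ s, ‖∫ α, a i α ∂μ‖ ^ 2 ≤ ∫ p, (ψ (p.1 - p.2) * 1 +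
      (1 / 2 * (χ (p.1 - p.2) * w p.1) + 1 / 2 * (χ (p.1 - p.2) * w p.2))) ∂(μ.prod μ) := by
    have h1 : ∑ i ∈ s, ‖∫ α, a i α ∂μ‖ ^ 2 =
        ‖∫ p, ∑ i ∈ s, a i p.1 * (starRingEnd ℂ) (a i p.2) ∂(μ.prod μ)‖ := by
      rw [← hsum, Complex.norm_real, Real.norm_eq_abs, abs_of_nonneg]
      exact Finset.sum_nonneg fun i _ => by positivity
    rw [h1]
    refine norm_integral_le_of_norm_le (hψ1.add hχs) ?_
    rw [hμ, Measure.prod_restrict]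
    refine ae_restrict_of_forall_mem (h𝔫.prod h𝔫) fun p hp => ?_
    refine (hker p.1 hp.1 p.2 hp.2).trans_eq ?_
    simp only [hw]
    ring
  refine hmain.trans ?_
  rw [integral_add hψ1 hχs,
    integral_add (hχ1.const_mul (1 / 2)) (hχ2.const_mul (1 / 2)), integral_const_mul,
    integral_const_mul]
  have h2 := (integral_kernel_mul_le (𝔫 := 𝔫) hψm hψ0 hψb hψ (w := fun _ => 1) measurable_const
    (fun _ => zero_le_one) (fun _ => le_rfl)).1
  have h3 := integral_kernel_mul_le (𝔫 := 𝔫) hχm hχ0 hχb hχ hwm hw0 hwc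
  have h4 : ∫ α in 𝔫, w α = ∑ i ∈ s, ∫ α in 𝔫, ‖a i α‖ ^ 2 := by
    rw [hw]
    refine integral_finsetSum _ fun i hi => ?_
    refine Integrable.of_bound (C := c ^ 2) ((ham i hi).norm.pow_const 2).aestronglyMeasurable
      (Filter.Eventually.of_forall fun α => ?_)
    rw [Real.norm_eq_abs, abs_of_nonneg (by positivity)]
    exact pow_le_pow_left₀ (norm_nonneg _) (hac i hi α) 2
  have h5 : ∫ _α in 𝔫, (1 : ℝ) = volume.real 𝔫 := by simp
  rw [h5] at h2
  rw [← h4]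
  linarith [h3.1, h3.2]

end Schur

/-- Multiplication by `u` increases the sums over `s` twisted by polynomial phases of degree at most
`k` by a factor of at most `M`. -/
def IsTame {σ : Type*} (s : Finset (σ → ℕ)) (k : ℕ) (M : ℝ) (u : (σ → ℕ) → ℂ) : Prop :=
  ∀ (v : (σ → ℕ) → ℂ) (B : ℝ), (∀ q : MvPolynomial σ ℝ, q.totalDegree ≤ k →
      ‖∑ x ∈ s, v x * e (eval (fun j => (x j : ℝ)) q)‖ ≤ B) →
    ∀ q : MvPolynomial σ ℝ, q.totalDegree ≤ k →
      ‖∑ x ∈ s, v x * u x * e (eval (fun j => (x j : ℝ)) q)‖ ≤ M * B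

namespace IsTame

variable {σ : Type*} {s : Finset (σ → ℕ)} {k : ℕ} {M M' : ℝ} {u u' : (σ → ℕ) → ℂ}

/-- Tameness quantifies over all twists at once, so the bound it yields is of the form that it takes
as input. -/
theorem mul (h : IsTame s k M u) (h' : IsTame s k M' u') :
    IsTame s k (M * M') fun x => u x * u' x := fun v B hv q hq => by
  have := h' (fun x => v x * u x) (M * B) (fun q hq => h v B hv q hq) q hq
  simp only [mul_assoc] at this ⊢
  rw [mul_left_comm]
  exact this

theorem phase {q : MvPolynomial σ ℝ} (hq : q.totalDegree ≤ k) :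
    IsTame s k 1 fun x => e (eval (fun j => (x j : ℝ)) q) := fun v B hv q' hq' => by
  rw [one_mul]
  have := hv (q + q') ((totalDegree_add _ _).trans (max_le hq hq'))
  simpa only [map_add, e_add, mul_assoc] using this

theorem const_mul (c : ℂ) (h : IsTame s k M u) : IsTame s k (‖c‖ * M) fun x => c * u x :=
  fun v B hv q hq => by
    have h1 := h v B hv q hq
    have h2 : ∑ x ∈ s, v x * (c * u x) * e (eval (fun j => (x j : ℝ)) q) =
        c * ∑ x ∈ s, v x * u x * e (eval (fun j => (x j : ℝ)) q) := by
      rw [Finset.mul_sum]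
      exact Finset.sum_congr rfl fun x _ => by ring
    rw [h2, norm_mul, mul_assoc]
    gcongr

theorem sum {ι : Type*} (t : Finset ι) {M : ι → ℝ} {u : ι → (σ → ℕ) → ℂ}
    (h : ∀ i ∈ t, IsTame s k (M i) (u i)) :
    IsTame s k (∑ i ∈ t, M i) fun x => ∑ i ∈ t, u i x := fun v B hv q hq => by
  have h2 : ∑ x ∈ s, v x * (∑ i ∈ t, u i x) * e (eval (fun j => (x j : ℝ)) q) =
      ∑ i ∈ t, ∑ x ∈ s, v x * u i x * e (eval (fun j => (x j : ℝ)) q) := by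
    rw [Finset.sum_comm]
    refine Finset.sum_congr rfl fun x _ => ?_
    rw [Finset.mul_sum, Finset.sum_mul]
  rw [h2, Finset.sum_mul]
  exact (norm_sum_le _ _).trans (Finset.sum_le_sum fun i hi => h i hi v B hv q hq)

theorem mono (hM : M ≤ M') (h : IsTame s k M u) : IsTame s k M' u := fun v B hv q hq => by
  refine (h v B hv q hq).trans ?_
  have : 0 ≤ B := (norm_nonneg _).trans (hv q hq)
  gcongr

end IsTame

/-- The large sieve inequality attached to a system of forms. -/
theorem exists_sum_norm_integral_sq_le {σ : Type*} [Fintype σ] [DecidableEq σ] {R k : ℕ}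
    (hR : 1 ≤ R) (hk : 0 < k) (G : Fin R → MvPolynomial σ ℤ)
    (hG : ∀ i, (G i).IsHomogeneous (k + 1)) (hA : (R : ℝ) + 1 < weylExponent k G) :
    ∃ C : ℝ, 0 < C ∧ ∀ (A : ℝ) (_ : (R : ℝ) + 1 < A) (_ : A ≤ weylExponent k G) (P X : ℝ)
      (_ : 3 ≤ P) (_ : 0 < X) (_ : X ^ (R + 1) ≤ P ^ (R * (k + 1))) (𝔫 : Set (Fin R → ℝ))
      (_ : MeasurableSet 𝔫) (_ : 𝔫 ⊆ Set.Icc (fun _ => 0) (fun _ => 2))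
      (u : (Fin R → ℝ) → (σ → ℕ) → ℂ) (M c : ℝ) (_ : 0 ≤ M) (_ : ∀ x, Measurable fun α => u α x)
      (_ : ∀ x ∈ box σ P, ∀ α, ‖u α x‖ ≤ c)
      (_ : ∀ α β, IsTame (box σ P) k M fun x => u α x * (starRingEnd ℂ) (u β x)),
      ∑ x ∈ box σ P, ‖∫ α in 𝔫, e (phase G α x) * u α x‖ ^ 2 ≤
        C * (M * P ^ Fintype.card σ * Real.log P ^ Fintype.card σ *
          (X ^ ((R : ℝ) + 1 - A) / P ^ (R * (k + 1))) * volume.real 𝔫 +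
        X ^ (R + 1) / P ^ (R * (k + 1)) * ∑ x ∈ box σ P, ∫ α in 𝔫, ‖u α x‖ ^ 2) := by
  obtain ⟨C₀, hC₀, hweyl⟩ := exists_norm_sum_le_of_notMem_majorArcs hR hk G hG
    (by have : (0 : ℝ) ≤ R := Nat.cast_nonneg R; linarith)
  obtain ⟨C₁, hC₁, hkernel⟩ := exists_kernel (d := k + 1) hR (by linarith : 0 < C₀) hA
  obtain ⟨C₂, hC₂, hvol⟩ := exists_volume_majorArcs_le R (k + 1) (by linarith : 0 < C₀)
  set A₀ := weylExponent k G
  set N := Fintype.card σ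
  -- The kernel is built with the full exponent `A₀`, so that its constant does not depend on `A`;
  -- `c₀` pays for the passage to `A` when `X` is small.
  set c₀ : ℝ := (2 * C₀) ^ (A₀ - (R + 1)) with hc₀
  have hc₀0 : 0 < c₀ := by positivity
  have hc₀1 : 1 ≤ c₀ := Real.one_le_rpow (by linarith) (by linarith)
  refine ⟨C₀ * C₁ * c₀ + C₂, by positivity, fun A hA1 hA2 P X hP hX hXP 𝔫 h𝔫 h𝔫2 u M c hM hum huc
    htame => ?_⟩
  have hP0 : 0 < P := by linarith
  have hL := one_le_log hP
  have hL0 : 0 ≤ Real.log P := by linarith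
  -- Below `1 / (2 C₀)` nothing is gained: with that parameter denominators would be at most `1/2`,
  -- so the major arcs are already empty.
  set X₁ := max X (1 / (2 * C₀)) with hX₁
  have hX₁0 : 0 < X₁ := lt_max_of_lt_left hX
  have hsmall : 1 / (2 * C₀) ≤ 1 := by rw [div_le_one (by linarith)]; linarith
  have hXpow : X₁ ^ (R + 1) ≤ P ^ (R * (k + 1)) := by
    rcases max_choice X (1 / (2 * C₀)) with h | h
    · rw [hX₁, h]; exact hXP
    · rw [hX₁, h]
      exact (pow_le_one₀ (by positivity) hsmall).trans (one_le_pow₀ (by linarith))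
  have hXA : X₁ ^ ((R : ℝ) + 1 - A₀) ≤ c₀ * X ^ ((R : ℝ) + 1 - A) := by
    rcases le_or_gt 1 X with h1 | h1
    · rw [hX₁, max_eq_left (hsmall.trans h1)]
      calc _ ≤ X ^ ((R : ℝ) + 1 - A) := Real.rpow_le_rpow_of_exponent_le h1 (by linarith)
        _ ≤ _ := le_mul_of_one_le_left (by positivity) hc₀1
    · have h2 : 1 ≤ X ^ ((R : ℝ) + 1 - A) :=
        Real.one_le_rpow_of_pos_of_le_one_of_nonpos hX h1.le (by linarith)
      calc X₁ ^ ((R : ℝ) + 1 - A₀) ≤ (1 / (2 * C₀)) ^ ((R : ℝ) + 1 - A₀) :=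
            Real.rpow_le_rpow_of_nonpos (by positivity) (le_max_right _ _) (by linarith)
        _ = c₀ := by
            rw [hc₀, one_div, Real.inv_rpow (by linarith), ← Real.rpow_neg (by linarith)]
            congr 1
            ring
        _ ≤ _ := le_mul_of_one_le_right hc₀0.le h2
  obtain ⟨ω, hωm, hω0, ⟨b, hωb⟩, hωint, hω⟩ := hkernel P X₁ (by linarith) hX₁0 hXpow
  set K : Set (Fin R → ℝ) := Set.Icc (fun _ => -2) (fun _ => 2) with hKdef
  have hKm : MeasurableSet K := measurableSet_Icc
  have hKtop : volume K ≠ ⊤ := isCompact_Icc.measure_lt_top.ne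
  have hKfin : IsFiniteMeasure (volume.restrict K) :=
    ⟨by rw [Measure.restrict_apply_univ]; exact isCompact_Icc.measure_lt_top⟩
  have h𝔫fin : IsFiniteMeasure (volume.restrict 𝔫) :=
    ⟨by
      rw [Measure.restrict_apply_univ]
      exact (measure_mono h𝔫2).trans_lt isCompact_Icc.measure_lt_top⟩
  set 𝔐 := majorArcs R (k + 1) C₀ X₁ P with h𝔐
  have h𝔐m : MeasurableSet 𝔐 := measurableSet_majorArcs _ _ _ _ _
  set B := M * (C₀ * P ^ N * Real.log P ^ N) with hB
  have hB0 : 0 ≤ B := by positivity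
  -- `ψ` carries the minor arc bound and `χ` the major arcs. Both live on the cube `K`, which
  -- contains all differences of points of `𝔫`.
  set ψ : (Fin R → ℝ) → ℝ := K.indicator fun γ => B * ω γ with hψ
  set χ : (Fin R → ℝ) → ℝ := (K ∩ 𝔐).indicator fun _ => 1 with hχ
  have hBωi : Integrable (fun γ => B * ω γ) (volume.restrict K) :=
    Integrable.of_bound (C := B * b) (hωm.const_mul B).aestronglyMeasurable
      (Filter.Eventually.of_forall fun γ => by
        rw [Real.norm_eq_abs, abs_of_nonneg (mul_nonneg hB0 (hω0 γ))]
        exact mul_le_mul_of_nonneg_left (hωb γ) hB0)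
  have hψint : ∫ γ, ψ γ ≤ B * (C₁ * (X₁ ^ ((R : ℝ) + 1 - A₀) / P ^ (R * (k + 1)))) := by
    rw [hψ, integral_indicator hKm, integral_const_mul]
    gcongr
  have hχint : ∫ γ, χ γ ≤ C₂ * (X ^ (R + 1) / P ^ (R * (k + 1))) := by
    rw [hχ, integral_indicator (hKm.inter h𝔐m), setIntegral_const, smul_eq_mul, mul_one]
    rcases max_choice X (1 / (2 * C₀)) with h | h
    · rw [h𝔐, hX₁, h]
      refine hvol P X hP0 hX (le_of_pow_le_pow_left₀ (n := R + 1) (by omega) (by positivity)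
        (hXP.trans ?_))
      rw [← pow_mul]
      refine pow_le_pow_right₀ (by linarith) ?_
      nlinarith
    · have : 𝔐 = ∅ := by
        rw [Set.eq_empty_iff_forall_notMem]
        rintro γ ⟨n, hn, hnX, -⟩
        rw [hX₁, h] at hnX
        have h1 : (1 : ℝ) ≤ n := by exact_mod_cast hn
        have h2 : C₀ * (1 / (2 * C₀)) = 1 / 2 := by field_simp
        linarith
      rw [this, Set.inter_empty, measureReal_empty]
      positivity
  have hmain := sum_norm_integral_sq_le (box σ P) (fun x α => e (phase G α x) * u α x) h𝔫
    (fun x _ => Measurable.mul (by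
      have := continuous_phase G x
      unfold e
      fun_prop) (hum x))
    (c := c) (fun x hx α => by rw [norm_mul, norm_e, one_mul]; exact huc x hx α)
    (ψ := ψ) (χ := χ) (b := max (B * b) 1) ((hωm.const_mul B).indicator hKm)
    (measurable_const.indicator (hKm.inter h𝔐m))
    (fun γ => Set.indicator_nonneg (fun γ _ => mul_nonneg hB0 (hω0 γ)) γ)
    (fun γ => Set.indicator_nonneg (fun _ _ => zero_le_one) γ)
    (fun γ => (Set.indicator_le_self' (fun γ _ => mul_nonneg hB0 (hω0 γ)) γ).trans
      ((mul_le_mul_of_nonneg_left (hωb γ) hB0).trans (le_max_left _ _)))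
    (fun γ => (Set.indicator_le_self' (fun _ _ => zero_le_one) γ).trans (le_max_right _ _))
    ((integrable_indicator_iff hKm).mpr hBωi)
    ((integrable_indicator_iff (hKm.inter h𝔐m)).mpr
      (integrableOn_const (measure_ne_top_of_subset Set.inter_subset_left hKtop)))
    (fun α hα β hβ => by
      have hγK : α - β ∈ K := by
        have h1 := h𝔫2 hα
        have h2 := h𝔫2 hβ
        constructor <;> intro i
        · have h3 : 0 ≤ α i := h1.1 i
          have h4 : β i ≤ 2 := h2.2 i
          simp only [Pi.sub_apply]; linarith
        · have h3 : α i ≤ 2 := h1.2 i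
          have h4 : 0 ≤ β i := h2.1 i
          simp only [Pi.sub_apply]; linarith
      have hψ0 : 0 ≤ ψ (α - β) := Set.indicator_nonneg (fun γ _ => mul_nonneg hB0 (hω0 γ)) _
      have hχ0 : 0 ≤ χ (α - β) := Set.indicator_nonneg (fun _ _ => zero_le_one) _
      have hsum0 : 0 ≤ (∑ x ∈ box σ P, ‖e (phase G α x) * u α x‖ ^ 2 +
          ∑ x ∈ box σ P, ‖e (phase G β x) * u β x‖ ^ 2) / 2 := by positivity
      by_cases hγ : α - β ∈ 𝔐
      -- On the major arcs only `|a b| ≤ (|a|² + |b|²) / 2` is used.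
      · have h1 : χ (α - β) = 1 := Set.indicator_of_mem (show α - β ∈ K ∩ 𝔐 from ⟨hγK, hγ⟩) _
        rw [h1, one_mul, ← Finset.sum_add_distrib, Finset.sum_div]
        refine le_trans ((norm_sum_le _ _).trans (Finset.sum_le_sum fun x _ => ?_))
          (le_add_of_nonneg_left hψ0)
        rw [norm_mul, RCLike.norm_conj]
        nlinarith [sq_nonneg (‖e (phase G α x) * u α x‖ - ‖e (phase G β x) * u β x‖)]
      · refine le_trans ?_ (le_add_of_nonneg_right (mul_nonneg hχ0 hsum0))
        obtain ⟨X', hX'0, hX'P, hX'γ, hX'ω⟩ := hω _ hγ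
        -- Weyl's inequality holds uniformly in the phases `q` of degree at most `k`, so the tame
        -- amplitude costs a factor `M`. The admissible range of `X'` is ensured by `R (k+1) ≤ k R
        -- (R+1)`.
        have h1 := htame α β (fun x => e (phase G (α - β) x))
          (C₀ * P ^ N * Real.log P ^ N * X' ^ (-A₀)) (fun q hq => by
            simp only [← e_add]
            refine hweyl P X' hP hX'0 ?_ _ q hq hX'γ
            refine le_of_pow_le_pow_left₀ (n := R + 1) (by omega) (by positivity)
              (hX'P.trans ?_)
            rw [← pow_mul]
            refine pow_le_pow_right₀ (by linarith) ?_
            have : R * (k + 1) ≤ R * (k * (R + 1)) := by gcongr; nlinarith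
            linarith) 0 (by simp)
        simp only [map_zero, e_zero, mul_one] at h1
        have h2 : ψ (α - β) = B * ω (α - β) := Set.indicator_of_mem hγK _
        have h3 : ∑ x ∈ box σ P, e (phase G α x) * u α x *
            (starRingEnd ℂ) (e (phase G β x) * u β x) =
            ∑ x ∈ box σ P, e (phase G (α - β) x) * (u α x * (starRingEnd ℂ) (u β x)) := by
          refine Finset.sum_congr rfl fun x _ => ?_
          have h4 : phase G (α - β) x = phase G α x - phase G β x := by
            simp only [phase, Pi.sub_apply, sub_mul, Finset.sum_sub_distrib]
          rw [h4, e_sub, map_mul]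
          ring
        rw [h2, h3]
        refine h1.trans ?_
        rw [hB, mul_assoc M]
        gcongr)
  refine hmain.trans ?_
  have hsq : ∀ x, ∫ α in 𝔫, ‖e (phase G α x) * u α x‖ ^ 2 = ∫ α in 𝔫, ‖u α x‖ ^ 2 := fun x => by
    simp only [norm_mul, norm_e, one_mul]
  simp only [hsq]
  have hJ : 0 ≤ ∑ x ∈ box σ P, ∫ α in 𝔫, ‖u α x‖ ^ 2 :=
    Finset.sum_nonneg fun x _ => integral_nonneg fun α => by positivity
  calc _ ≤ B * (C₁ * (c₀ * X ^ ((R : ℝ) + 1 - A) / P ^ (R * (k + 1)))) * volume.real 𝔫 +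
        C₂ * (X ^ (R + 1) / P ^ (R * (k + 1))) * ∑ x ∈ box σ P, ∫ α in 𝔫, ‖u α x‖ ^ 2 := by
        refine add_le_add (mul_le_mul_of_nonneg_right (hψint.trans ?_) measureReal_nonneg)
          (mul_le_mul_of_nonneg_right hχint hJ)
        gcongr
    _ = C₀ * C₁ * c₀ * (M * P ^ N * Real.log P ^ N *
          (X ^ ((R : ℝ) + 1 - A) / P ^ (R * (k + 1))) * volume.real 𝔫) +
        C₂ * (X ^ (R + 1) / P ^ (R * (k + 1)) * ∑ x ∈ box σ P, ∫ α in 𝔫, ‖u α x‖ ^ 2) := by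
        rw [hB]; ring
    _ ≤ _ := by
        have key : ∀ a b u v : ℝ, 0 ≤ a → 0 ≤ b → 0 ≤ u → 0 ≤ v →
            a * u + b * v ≤ (a + b) * (u + v) := fun a b u v ha hb hu hv => by
          nlinarith [mul_nonneg ha hv, mul_nonneg hb hu]
        exact key _ _ _ _ (by positivity) hC₂.le (by positivity) (by positivity)

end
end FormsPrime

/-! ### Weights, inner and middle sums as tame amplitudes -/

namespace FormsPrime
open MvPolynomial MeasureTheory

noncomputable section

theorem totalDegree_eval₂_le {σ τ A B : Type*} [CommSemiring A] [CommSemiring B] (φ : A →+* B)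
    {w : τ → ℕ} {θ : τ → MvPolynomial σ B} (hθ : ∀ j, (θ j).totalDegree ≤ w j)
    (p : MvPolynomial τ A) :
    (eval₂ (C.comp φ) θ p).totalDegree ≤ p.weightedTotalDegree w := by
  rw [eval₂_eq]
  refine totalDegree_finsetSum_le fun v hv => ?_
  refine (totalDegree_mul _ _).trans ?_
  rw [RingHom.comp_apply, totalDegree_C, zero_add]
  refine (totalDegree_finsetProd _ _).trans ?_
  refine le_trans ?_ (le_weightedTotalDegree w hv)
  rw [Finsupp.weight_apply, Finsupp.sum]
  refine Finset.sum_le_sum fun j _ => (totalDegree_pow _ _).trans ?_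
  rw [smul_eq_mul]
  exact Nat.mul_le_mul_left _ (hθ j)

/-- A phase of bounded degree stays a polynomial of bounded degree after substitution. -/
theorem exists_eval_eq_phase {σ τ : Type*} {R k : ℕ} {w : τ → ℕ} {G : Fin R → MvPolynomial τ ℤ}
    (hG : ∀ i, (G i).weightedTotalDegree w ≤ k) {θ : τ → MvPolynomial σ ℝ}
    (hθ : ∀ j, (θ j).totalDegree ≤ w j) (α : Fin R → ℝ) (η : (σ → ℕ) → τ → ℕ)
    (hη : ∀ x j, (η x j : ℝ) = eval (fun i => (x i : ℝ)) (θ j)) :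
    ∃ q : MvPolynomial σ ℝ, q.totalDegree ≤ k ∧
      ∀ x, eval (fun i => (x i : ℝ)) q = phase G α (η x) := by
  refine ⟨∑ i, C (α i) * eval₂ (C.comp (Int.castRingHom ℝ)) θ (G i),
    totalDegree_finsetSum_le fun i _ => ?_, fun x => ?_⟩
  · refine (totalDegree_mul _ _).trans ?_
    rw [totalDegree_C, zero_add]
    exact (totalDegree_eval₂_le _ hθ _).trans (hG i)
  · rw [map_sum, phase]
    refine Finset.sum_congr rfl fun i _ => ?_
    rw [map_mul, eval_C]
    congr 1
    have h1 := eval₂_comp_left (eval fun i => (x i : ℝ)) (C.comp (Int.castRingHom ℝ)) θ (G i)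
    have h2 := eval₂_comp_left (Int.castRingHom ℝ) (RingHom.id ℤ) (fun j => (η x j : ℤ)) (G i)
    rw [h1]
    refine Eq.trans ?_ h2.symm
    congr 1
    · ext; simp
    · funext j
      simp [← hη]

theorem sum_box_sum {σ τ M : Type*} [Fintype σ] [DecidableEq σ] [Fintype τ] [DecidableEq τ]
    [AddCommMonoid M] (P : ℝ) (Φ : (σ ⊕ τ → ℕ) → M) :
    ∑ v ∈ box (σ ⊕ τ) P, Φ v = ∑ y ∈ box σ P, ∑ z ∈ box τ P, Φ (Sum.elim y z) := by
  rw [← Finset.sum_product']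
  refine Finset.sum_bij' (fun v _ => (v ∘ Sum.inl, v ∘ Sum.inr)) (fun p _ => Sum.elim p.1 p.2)
    ?_ ?_ ?_ ?_ ?_
  · intro v hv
    simp only [box, Finset.mem_product, Fintype.mem_piFinset] at hv ⊢
    exact ⟨fun j => hv _, fun j => hv _⟩
  · intro p hp
    simp only [box, Finset.mem_product, Fintype.mem_piFinset] at hp ⊢
    rintro (j | j)
    · exact hp.1 j
    · exact hp.2 j
  · intro v _; simp
  · intro p _; simp
  · intro v _; simp

/-- The product of the values of the sequences `l_j` at the coordinates of `x`. -/
def weight {σ : Type*} [Fintype σ] (l : σ → ℕ → ℝ) (x : σ → ℕ) : ℝ := ∏ j, l j (x j)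

theorem abs_weight_le {σ : Type*} [Fintype σ] [DecidableEq σ] {l : σ → ℕ → ℝ} {P : ℝ}
    (hl : ∀ j, ∀ x : ℕ, 1 ≤ x → |l j x| ≤ Real.log x) {x : σ → ℕ}
    (hx : x ∈ box σ P) : |weight l x| ≤ Real.log P ^ Fintype.card σ := by
  rw [weight, Finset.abs_prod]
  calc ∏ j, |l j (x j)| ≤ ∏ _j : σ, Real.log P := by
        refine Finset.prod_le_prod (fun _ _ => abs_nonneg _) fun j _ => ?_
        rw [box, Fintype.mem_piFinset] at hx
        have h1 := Finset.mem_Icc.mp (hx j)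
        have h2 : ((x j : ℕ) : ℝ) ≤ P := (Nat.le_floor_iff' (by omega)).mp h1.2
        have h3 : (0 : ℝ) < x j := by exact_mod_cast h1.1
        exact (hl j _ h1.1).trans (Real.log_le_log h3 h2)
    _ = _ := by simp

theorem sum_norm_weight_le {σ : Type*} [Fintype σ] [DecidableEq σ] {l : σ → ℕ → ℝ} {P : ℝ}
    (hP : 1 ≤ P) (hl : ∀ j, ∀ x : ℕ, 1 ≤ x → |l j x| ≤ Real.log x) :
    ∑ x ∈ box σ P, ‖(weight l x : ℂ)‖ ≤ (P * Real.log P) ^ Fintype.card σ := by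
  have hL := Real.log_nonneg hP
  calc ∑ x ∈ box σ P, ‖(weight l x : ℂ)‖ ≤ ∑ _x ∈ box σ P, Real.log P ^ Fintype.card σ :=
        Finset.sum_le_sum fun x hx => by
          rw [Complex.norm_real]
          exact abs_weight_le hl hx
    _ ≤ P ^ Fintype.card σ * Real.log P ^ Fintype.card σ := by
        rw [Finset.sum_const, nsmul_eq_mul]
        gcongr
        exact card_box_le (by linarith)
    _ = _ := (mul_pow _ _ _).symm

theorem sum_sq_weight_le {σ : Type*} [Fintype σ] [DecidableEq σ] {l : σ → ℕ → ℝ} {P : ℝ}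
    (hP : 1 ≤ P) (hl : ∀ j, ∀ x : ℕ, 1 ≤ x → |l j x| ≤ Real.log x) :
    ∑ x ∈ box σ P, weight l x ^ 2 ≤ P ^ Fintype.card σ * Real.log P ^ (2 * Fintype.card σ) := by
  have hL := Real.log_nonneg hP
  calc ∑ x ∈ box σ P, weight l x ^ 2 ≤ ∑ _x ∈ box σ P, Real.log P ^ (2 * Fintype.card σ) :=
        Finset.sum_le_sum fun x hx => by
          rw [mul_comm, pow_mul, ← sq_abs]
          exact pow_le_pow_left₀ (abs_nonneg _) (abs_weight_le hl hx) 2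
    _ ≤ _ := by
        rw [Finset.sum_const, nsmul_eq_mul]
        gcongr
        exact card_box_le (by linarith)

theorem phase_neg {σ : Type*} {R : ℕ} (G : Fin R → MvPolynomial σ ℤ) (α : Fin R → ℝ) (x : σ → ℕ) :
    phase G (-α) x = -phase G α x := by
  simp [phase]

theorem continuous_e_phase {σ : Type*} {R : ℕ} (G : Fin R → MvPolynomial σ ℤ) (x : σ → ℕ) :
    Continuous fun α : Fin R → ℝ => e (phase G α x) := by
  have := continuous_phase G x
  unfold e
  fun_prop

section Sums

variable {m s t R k : ℕ} (lam : (Fin m ⊕ Fin s) ⊕ Fin t → ℕ → ℝ)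
  (g : Fin R → MvPolynomial (Fin m ⊕ Fin s) ℤ)
  (h : Fin R → MvPolynomial ((Fin m ⊕ Fin s) ⊕ Fin t) ℤ) (P : ℝ)

/-- The sum over `z` and `w` of the terms of the exponential sum, without the factor depending on
`y` only. -/
def middleSum (α : Fin R → ℝ) (y : Fin m → ℕ) : ℂ :=
  ∑ z ∈ box (Fin s) P, (weight (fun j => lam (Sum.inl (Sum.inr j))) z : ℂ) *
    (e (phase g α (Sum.elim y z)) * innerSum lam h P (Sum.elim y z) α)

theorem innerSum_eq (v : Fin m ⊕ Fin s → ℕ) (α : Fin R → ℝ) : innerSum lam h P v α =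
    ∑ w ∈ box (Fin t) P, (weight (fun j => lam (Sum.inr j)) w : ℂ) *
      e (phase h α (Sum.elim v w)) := rfl

theorem continuous_innerSum (v : Fin m ⊕ Fin s → ℕ) : Continuous (innerSum lam h P v) := by
  unfold innerSum
  exact continuous_finsetSum _ fun w _ => continuous_const.mul (continuous_e_phase _ _)

theorem continuous_middleSum (y : Fin m → ℕ) :
    Continuous fun α => middleSum lam g h P α y := by
  unfold middleSum
  exact continuous_finsetSum _ fun z _ => continuous_const.mul
    ((continuous_e_phase _ _).mul (continuous_innerSum _ _ _ _))

theorem conj_innerSum (v : Fin m ⊕ Fin s → ℕ) (α : Fin R → ℝ) :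
    (starRingEnd ℂ) (innerSum lam h P v α) = innerSum lam h P v (-α) := by
  simp only [innerSum_eq, map_sum, map_mul, Complex.conj_ofReal, phase_neg, e_neg]

theorem conj_middleSum (α : Fin R → ℝ) (y : Fin m → ℕ) :
    (starRingEnd ℂ) (middleSum lam g h P α y) = middleSum lam g h P (-α) y := by
  simp only [middleSum, map_sum, map_mul, Complex.conj_ofReal, phase_neg, e_neg, conj_innerSum]

variable {lam g h P}

theorem norm_innerSum_le (hP : 1 ≤ P) (hlam : ∀ j, ∀ x : ℕ, 1 ≤ x → |lam j x| ≤ Real.log x)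
    (v : Fin m ⊕ Fin s → ℕ) (α : Fin R → ℝ) :
    ‖innerSum lam h P v α‖ ≤ (P * Real.log P) ^ t := by
  rw [innerSum_eq]
  refine (norm_sum_le _ _).trans ?_
  simp only [norm_mul, norm_e, mul_one]
  simpa using sum_norm_weight_le (σ := Fin t) hP fun j => hlam (Sum.inr j)

theorem norm_middleSum_le (hP : 1 ≤ P) (hlam : ∀ j, ∀ x : ℕ, 1 ≤ x → |lam j x| ≤ Real.log x)
    (α : Fin R → ℝ) (y : Fin m → ℕ) :
    ‖middleSum lam g h P α y‖ ≤ (P * Real.log P) ^ (s + t) := by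
  have hL := Real.log_nonneg hP
  rw [middleSum]
  calc _ ≤ ∑ z ∈ box (Fin s) P, ‖(weight (fun j => lam (Sum.inl (Sum.inr j))) z : ℂ)‖ *
        (P * Real.log P) ^ t := by
        refine (norm_sum_le _ _).trans (Finset.sum_le_sum fun z _ => ?_)
        rw [norm_mul, norm_mul, norm_e, one_mul]
        gcongr
        exact norm_innerSum_le hP hlam _ _
    _ ≤ (P * Real.log P) ^ s * (P * Real.log P) ^ t := by
        rw [← Finset.sum_mul]
        gcongr
        simpa using sum_norm_weight_le (σ := Fin s) hP fun j => hlam (Sum.inl (Sum.inr j))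
    _ = _ := (pow_add _ _ _).symm

/-- For fixed `w` the phase `h` has degree at most `k` in `(y, z)`, so the sum over `w` combines
admissible phases with coefficients of total mass at most `(P log P)^t`. The substitution `θ` of
degree at most one lets the variables of the outer sum be `y` or `(y, z)`. -/
theorem isTame_innerSum {ι : Type*} (S : Finset (ι → ℕ)) (hP : 1 ≤ P)
    (hlam : ∀ j, ∀ x : ℕ, 1 ≤ x → |lam j x| ≤ Real.log x)
    (hh : ∀ i, (h i).weightedTotalDegree
      (Sum.elim (fun _ => 1) (fun _ => 0) : (Fin m ⊕ Fin s) ⊕ Fin t → ℕ) ≤ k)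
    (α : Fin R → ℝ) {θ : Fin m ⊕ Fin s → MvPolynomial ι ℝ} (hθ : ∀ j, (θ j).totalDegree ≤ 1)
    (η : (ι → ℕ) → Fin m ⊕ Fin s → ℕ)
    (hη : ∀ x j, (η x j : ℝ) = eval (fun i => (x i : ℝ)) (θ j)) :
    IsTame S k ((P * Real.log P) ^ t) fun x => innerSum lam h P (η x) α := by
  simp only [innerSum_eq]
  refine IsTame.mono ?_ (IsTame.sum (box (Fin t) P)
    (M := fun w => ‖(weight (fun j => lam (Sum.inr j)) w : ℂ)‖ * 1) fun w _ =>
      IsTame.const_mul _ ?_)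
  · simpa using sum_norm_weight_le (σ := Fin t) hP fun j => hlam (Sum.inr j)
  · obtain ⟨q, hq, hqe⟩ := exists_eval_eq_phase hh
      (θ := Sum.elim θ fun j => C (w j : ℝ)) (by rintro (j | j); exacts [hθ j, (totalDegree_C _).le]) α
      (fun x => Sum.elim (η x) w) (by rintro x (j | j) <;> simp [hη])
    simp only [← hqe]
    exact IsTame.phase hq

/-- As for the inner sums, now with `z` also fixed: `g` has degree at most `k` in `y`. -/
theorem isTame_middleSum {ι : Type*} (S : Finset (ι → ℕ)) (hP : 1 ≤ P)
    (hlam : ∀ j, ∀ x : ℕ, 1 ≤ x → |lam j x| ≤ Real.log x)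
    (hg : ∀ i, (g i).weightedTotalDegree
      (Sum.elim (fun _ => 1) (fun _ => 0) : Fin m ⊕ Fin s → ℕ) ≤ k)
    (hh : ∀ i, (h i).weightedTotalDegree
      (Sum.elim (fun _ => 1) (fun _ => 0) : (Fin m ⊕ Fin s) ⊕ Fin t → ℕ) ≤ k)
    (α : Fin R → ℝ) {θ : Fin m → MvPolynomial ι ℝ} (hθ : ∀ j, (θ j).totalDegree ≤ 1)
    (η : (ι → ℕ) → Fin m → ℕ)
    (hη : ∀ x j, (η x j : ℝ) = eval (fun i => (x i : ℝ)) (θ j)) :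
    IsTame S k ((P * Real.log P) ^ (s + t)) fun x => middleSum lam g h P α (η x) := by
  have hL := Real.log_nonneg hP
  simp only [middleSum]
  refine IsTame.mono ?_ (IsTame.sum (box (Fin s) P)
    (M := fun z => ‖(weight (fun j => lam (Sum.inl (Sum.inr j))) z : ℂ)‖ *
      (1 * (P * Real.log P) ^ t)) fun z _ => IsTame.const_mul _ (IsTame.mul ?_ ?_))
  · rw [← Finset.sum_mul, one_mul, pow_add]
    gcongr
    simpa using sum_norm_weight_le (σ := Fin s) hP fun j => hlam (Sum.inl (Sum.inr j))
  · obtain ⟨q, hq, hqe⟩ := exists_eval_eq_phase hg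
      (θ := Sum.elim θ fun j => C (z j : ℝ)) (by rintro (j | j); exacts [hθ j, (totalDegree_C _).le]) α
      (fun x => Sum.elim (η x) z) (by rintro x (j | j) <;> simp [hη])
    simp only [← hqe]
    exact IsTame.phase hq
  · exact isTame_innerSum S hP hlam hh α (θ := Sum.elim θ fun j => C (z j : ℝ))
      (by rintro (j | j); exacts [hθ j, (totalDegree_C _).le.trans zero_le_one]) (fun x => Sum.elim (η x) z)
      (by rintro x (j | j) <;> simp [hη])

theorem expSum_eq {d : ℕ} {F : Fin R → MvPolynomial ((Fin m ⊕ Fin s) ⊕ Fin t) ℤ}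
    {f : Fin R → MvPolynomial (Fin m) ℤ} (hsplit : IsSplitting d F f g h) (α : Fin R → ℝ) :
    expSum lam F P α = ∑ y ∈ box (Fin m) P,
      (weight (fun j => lam (Sum.inl (Sum.inl j))) y : ℂ) *
        (e (phase f α y) * middleSum lam g h P α y) := by
  have hphase : ∀ y z w, phase F α (Sum.elim (Sum.elim y z) w) =
      phase f α y + phase g α (Sum.elim y z) + phase h α (Sum.elim (Sum.elim y z) w) := by
    intro y z w
    simp only [phase, ← Finset.sum_add_distrib]
    refine Finset.sum_congr rfl fun i _ => ?_
    rw [hsplit.eq_add i, map_add, map_add, eval_rename, eval_rename]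
    push_cast
    rw [mul_add, mul_add]
    rfl
  rw [expSum, sum_box_sum, sum_box_sum]
  refine Finset.sum_congr rfl fun y _ => ?_
  rw [middleSum, Finset.mul_sum, Finset.mul_sum]
  refine Finset.sum_congr rfl fun z _ => ?_
  rw [innerSum_eq, Finset.mul_sum, Finset.mul_sum, Finset.mul_sum, Finset.mul_sum]
  refine Finset.sum_congr rfl fun w _ => ?_
  rw [hphase, e_add, e_add, Fintype.prod_sum_type, Fintype.prod_sum_type]
  simp only [weight, Sum.elim_inl, Sum.elim_inr]
  push_cast
  ring

end Sums

end
end FormsPrime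

/-! ### Energy estimates -/

namespace FormsPrime
open MvPolynomial MeasureTheory

noncomputable section

theorem norm_sum_mul_sq_le {ι : Type*} (s : Finset ι) (c : ι → ℝ) (I : ι → ℂ) :
    ‖∑ i ∈ s, (c i : ℂ) * I i‖ ^ 2 ≤ (∑ i ∈ s, c i ^ 2) * ∑ i ∈ s, ‖I i‖ ^ 2 := by
  have h1 : ‖∑ i ∈ s, (c i : ℂ) * I i‖ ≤ ∑ i ∈ s, |c i| * ‖I i‖ := by
    refine (norm_sum_le _ _).trans_eq (Finset.sum_congr rfl fun i _ => ?_)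
    rw [norm_mul, Complex.norm_real, Real.norm_eq_abs]
  refine (pow_le_pow_left₀ (norm_nonneg _) h1 2).trans
    ((Finset.sum_mul_sq_le_sq_mul_sq s (fun i => |c i|) fun i => ‖I i‖).trans_eq ?_)
  simp only [sq_abs]

theorem integrableOn_of_continuous {R : ℕ} {𝔫 : Set (Fin R → ℝ)}
    (h𝔫 : 𝔫 ⊆ Set.Icc (fun _ => 0) (fun _ => 2)) {E : Type*} [NormedAddCommGroup E]
    {φ : (Fin R → ℝ) → E} (hφ : Continuous φ) : IntegrableOn φ 𝔫 :=
  (hφ.continuousOn.integrableOn_compact isCompact_Icc).mono_set h𝔫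

section Estimates

variable {m s t R k : ℕ} {lam : (Fin m ⊕ Fin s) ⊕ Fin t → ℕ → ℝ}
  {f : Fin R → MvPolynomial (Fin m) ℤ}
  {g : Fin R → MvPolynomial (Fin m ⊕ Fin s) ℤ}
  {h : Fin R → MvPolynomial ((Fin m ⊕ Fin s) ⊕ Fin t) ℤ} {P : ℝ} {𝔫 : Set (Fin R → ℝ)}

/-- Cauchy–Schwarz in `y` after exchanging sum and integral; this disposes of the arbitrary
coefficients `λ(y)`. -/
theorem norm_integral_expSum_sq_le {d : ℕ} {F : Fin R → MvPolynomial ((Fin m ⊕ Fin s) ⊕ Fin t) ℤ}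
    (hsplit : IsSplitting d F f g h) (hP : 1 ≤ P)
    (hlam : ∀ j, ∀ x : ℕ, 1 ≤ x → |lam j x| ≤ Real.log x)
    (h𝔫 : 𝔫 ⊆ Set.Icc (fun _ => 0) (fun _ => 2)) :
    ‖∫ α in 𝔫, expSum lam F P α‖ ^ 2 ≤ P ^ m * Real.log P ^ (2 * m) *
      ∑ y ∈ box (Fin m) P, ‖∫ α in 𝔫, e (phase f α y) * middleSum lam g h P α y‖ ^ 2 := by
  simp only [expSum_eq hsplit]
  rw [integral_finsetSum]
  swap
  · exact fun y _ => integrableOn_of_continuous h𝔫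
      (continuous_const.mul ((continuous_e_phase f y).mul (continuous_middleSum lam g h P y)))
  simp only [integral_const_mul]
  refine (norm_sum_mul_sq_le _ _ _).trans ?_
  gcongr
  simpa using sum_sq_weight_le (σ := Fin m) hP fun j => hlam (Sum.inl (Sum.inl j))

/-- The mean square of the middle sums. -/
def middleEnergy (lam : (Fin m ⊕ Fin s) ⊕ Fin t → ℕ → ℝ)
    (g : Fin R → MvPolynomial (Fin m ⊕ Fin s) ℤ)
    (h : Fin R → MvPolynomial ((Fin m ⊕ Fin s) ⊕ Fin t) ℤ) (P : ℝ) (𝔫 : Set (Fin R → ℝ)) : ℝ :=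
  ∑ y ∈ box (Fin m) P, ∫ α in 𝔫, ‖middleSum lam g h P α y‖ ^ 2

/-- One of the two factors in `|T_y|²` is opened as a sum over `z`. The energy becomes a sum over
`(y, z)` with the phase `g`, to which Cauchy–Schwarz applies, and `λ(z)` disappears. -/
theorem middleEnergy_sq_le (hP : 1 ≤ P) (hlam : ∀ j, ∀ x : ℕ, 1 ≤ x → |lam j x| ≤ Real.log x)
    (h𝔫 : 𝔫 ⊆ Set.Icc (fun _ => 0) (fun _ => 2)) :
    middleEnergy lam g h P 𝔫 ^ 2 ≤ P ^ m * (P ^ s * Real.log P ^ (2 * s)) *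
      ∑ v ∈ box (Fin m ⊕ Fin s) P, ‖∫ α in 𝔫, e (phase g α v) * (innerSum lam h P v α *
        (starRingEnd ℂ) (middleSum lam g h P α (v ∘ Sum.inl)))‖ ^ 2 := by
  set c : (Fin m ⊕ Fin s → ℕ) → ℝ := fun v =>
    weight (fun j => lam (Sum.inl (Sum.inr j))) (v ∘ Sum.inr)
  set I : (Fin m ⊕ Fin s → ℕ) → ℂ := fun v => ∫ α in 𝔫, e (phase g α v) *
    (innerSum lam h P v α * (starRingEnd ℂ) (middleSum lam g h P α (v ∘ Sum.inl)))
  have h1 : ((middleEnergy lam g h P 𝔫 : ℝ) : ℂ) =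
      ∑ v ∈ box (Fin m ⊕ Fin s) P, (c v : ℂ) * I v := by
    rw [sum_box_sum, middleEnergy]
    push_cast
    refine Finset.sum_congr rfl fun y _ => ?_
    rw [← integral_complex_ofReal]
    simp only [c, I, Sum.elim_comp_inl, Sum.elim_comp_inr, ← integral_const_mul]
    rw [← integral_finsetSum]
    · refine integral_congr_ae (Filter.Eventually.of_forall fun α => ?_)
      simp only [Complex.ofReal_pow]
      rw [← Complex.mul_conj']
      conv_lhs => enter [1]; rw [middleSum]
      rw [Finset.sum_mul]
      refine Finset.sum_congr rfl fun z _ => ?_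
      ring
    · intro z _
      refine integrableOn_of_continuous h𝔫 (continuous_const.mul ((continuous_e_phase _ _).mul
        ((continuous_innerSum _ _ _ _).mul ?_)))
      exact Complex.continuous_conj.comp (continuous_middleSum lam g h P y)
  have h2 : ∑ v ∈ box (Fin m ⊕ Fin s) P, c v ^ 2 ≤ P ^ m * (P ^ s * Real.log P ^ (2 * s)) := by
    rw [sum_box_sum]
    simp only [c, Sum.elim_comp_inr, Finset.sum_const, nsmul_eq_mul]
    have h3 := sum_sq_weight_le (σ := Fin s) hP fun j => hlam (Sum.inl (Sum.inr j))
    have h4 := card_box_le (σ := Fin m) (by linarith : 0 ≤ P)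
    rw [Fintype.card_fin] at h3 h4
    exact mul_le_mul h4 h3 (Finset.sum_nonneg fun _ _ => by positivity) (by positivity)
  have h5 : middleEnergy lam g h P 𝔫 ^ 2 = ‖∑ v ∈ box (Fin m ⊕ Fin s) P, (c v : ℂ) * I v‖ ^ 2 := by
    rw [← h1, Complex.norm_real, Real.norm_eq_abs, sq_abs]
  rw [h5]
  refine (norm_sum_mul_sq_le _ _ _).trans ?_
  gcongr

theorem norm_innerSum_le_supInner (hP : 1 ≤ P)
    (hlam : ∀ j, ∀ x : ℕ, 1 ≤ x → |lam j x| ≤ Real.log x) {α : Fin R → ℝ} (hα : α ∈ 𝔫)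
    {v : Fin m ⊕ Fin s → ℕ} (hv : v ∈ box (Fin m ⊕ Fin s) P) :
    ‖innerSum lam h P v α‖ ≤ supInner lam h P 𝔫 := by
  refine le_csSup ⟨(P * Real.log P) ^ t, ?_⟩ ⟨α, hα, v, hv, rfl⟩
  rintro r ⟨α, -, v, -, rfl⟩
  exact norm_innerSum_le hP hlam v α

theorem supInner_nonneg : 0 ≤ supInner lam h P 𝔫 :=
  Real.sSup_nonneg (by rintro r ⟨α, -, v, -, rfl⟩; exact norm_nonneg _)

/-- The remaining factor depends on `y` only, so the sum over `z` costs `P^s` and the energy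
reappears on the right. -/
theorem sum_integral_innerSum_mul_le (hP : 1 ≤ P)
    (hlam : ∀ j, ∀ x : ℕ, 1 ≤ x → |lam j x| ≤ Real.log x) (h𝔫m : MeasurableSet 𝔫)
    (h𝔫 : 𝔫 ⊆ Set.Icc (fun _ => 0) (fun _ => 2)) :
    ∑ v ∈ box (Fin m ⊕ Fin s) P, ∫ α in 𝔫, ‖innerSum lam h P v α *
        (starRingEnd ℂ) (middleSum lam g h P α (v ∘ Sum.inl))‖ ^ 2 ≤
      supInner lam h P 𝔫 ^ 2 * P ^ s * middleEnergy lam g h P 𝔫 := by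
  have h1 : ∀ v ∈ box (Fin m ⊕ Fin s) P, ∫ α in 𝔫, ‖innerSum lam h P v α *
      (starRingEnd ℂ) (middleSum lam g h P α (v ∘ Sum.inl))‖ ^ 2 ≤
        supInner lam h P 𝔫 ^ 2 * ∫ α in 𝔫, ‖middleSum lam g h P α (v ∘ Sum.inl)‖ ^ 2 := by
    intro v hv
    rw [← integral_const_mul]
    refine setIntegral_mono_on (integrableOn_of_continuous h𝔫 (Continuous.pow
      ((continuous_innerSum lam h P v).mul (Complex.continuous_conj.comp
        (continuous_middleSum lam g h P _))).norm 2)) (integrableOn_of_continuous h𝔫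
      (continuous_const.mul ((continuous_middleSum lam g h P _).norm.pow 2))) h𝔫m fun α hα => ?_
    rw [norm_mul, mul_pow, RCLike.norm_conj]
    gcongr
    exact norm_innerSum_le_supInner hP hlam hα hv
  refine (Finset.sum_le_sum h1).trans ?_
  rw [sum_box_sum, middleEnergy, Finset.mul_sum]
  refine Finset.sum_le_sum fun y _ => ?_
  simp only [Sum.elim_comp_inl, Finset.sum_const, nsmul_eq_mul]
  have h2 := card_box_le (σ := Fin s) (by linarith : 0 ≤ P)
  rw [Fintype.card_fin] at h2
  have h3 : 0 ≤ ∫ α in 𝔫, ‖middleSum lam g h P α y‖ ^ 2 :=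
    integral_nonneg fun _ => by positivity
  calc _ ≤ P ^ s * (supInner lam h P 𝔫 ^ 2 * ∫ α in 𝔫, ‖middleSum lam g h P α y‖ ^ 2) := by
        gcongr
    _ = _ := by ring

end Estimates

/-- If `J > W + V`, then `J² > (W + V) J ≥ W² + V J`. -/
theorem le_add_of_sq_le {J W V : ℝ} (hW : 0 ≤ W) (hV : 0 ≤ V) (h : J ^ 2 ≤ W ^ 2 + V * J) :
    J ≤ W + V := by
  by_contra! hJ
  nlinarith

theorem le_one_add_sq {c : ℝ} (hc : 0 ≤ c) : c ≤ (1 + c) ^ 2 := by nlinarith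

theorem sum_sq_le_sq_sum {a b c : ℝ} (ha : 0 ≤ a) (hb : 0 ≤ b) (hc : 0 ≤ c) :
    a ^ 2 + b ^ 2 + c ^ 2 ≤ (a + b + c) ^ 2 := by
  nlinarith [mul_nonneg ha hb, mul_nonneg ha hc, mul_nonneg hb hc]

/-- Arithmetic of the two sieve bounds. The parameters are roots of the natural quantities: `δ⁴ =
P^(-Rd)`, `ν⁴ = |𝔫|`, `ξ² = X^(R+1)`, `α₁² = X^(R+1-A₁)` and `α₂⁴ = X^(R+1-A₂)`, so that only
integral powers occur. -/
theorem le_of_energy_estimates {m s t : ℕ} {P L I J S α₁ α₂ ξ ν δ C₁ C₂ : ℝ} (hP : 1 ≤ P)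
    (hL : 1 ≤ L) (hS : 0 ≤ S) (hα₁ : 0 ≤ α₁) (hα₂ : 0 ≤ α₂) (hξ : 0 ≤ ξ)
    (hν : 0 ≤ ν) (hδ : 0 ≤ δ) (hC₁ : 0 < C₁) (hC₂ : 0 < C₂)
    (hI : I ^ 2 ≤ P ^ m * L ^ (2 * m) * (C₁ * ((P * L) ^ (2 * (s + t)) * P ^ m * L ^ m *
      (α₁ ^ 2 * δ ^ 4) * ν ^ 4 + ξ ^ 2 * δ ^ 4 * J)))
    (hJ : J ^ 2 ≤ P ^ m * (P ^ s * L ^ (2 * s)) * (C₂ * ((P * L) ^ (2 * (s + 2 * t)) *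
      P ^ (m + s) * L ^ (m + s) * (α₂ ^ 4 * δ ^ 4) * ν ^ 4 +
        ξ ^ 2 * δ ^ 4 * (S ^ 2 * P ^ s * J)))) :
    I ≤ (1 + C₁ * (1 + C₂)) * (P ^ (m + s + t) * L ^ (2 * (m + s + t)) * δ ^ 2 * α₁ * ν ^ 2 +
      P ^ (m + s + t) * L ^ (2 * (m + s + t)) * δ ^ 3 * ξ * α₂ * ν +
      P ^ (m + s) * L ^ (m + s) * δ ^ 4 * ξ ^ 2 * S) := by
  have hP0 : 0 < P := by linarith
  have hL0 : 0 < L := by linarith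
  set t₁ := P ^ (m + s + t) * L ^ (2 * (m + s + t)) * δ ^ 2 * α₁ * ν ^ 2 with ht₁
  set t₂ := P ^ (m + s + t) * L ^ (2 * (m + s + t)) * δ ^ 3 * ξ * α₂ * ν with ht₂
  set t₃ := P ^ (m + s) * L ^ (m + s) * δ ^ 4 * ξ ^ 2 * S with ht₃
  set W := P ^ (m + 2 * s + 2 * t) * L ^ (2 * m + 4 * s + 4 * t) * δ ^ 2 * α₂ ^ 2 * ν ^ 2 with hW
  set V := P ^ (m + 2 * s) * L ^ (2 * s) * ξ ^ 2 * δ ^ 4 * S ^ 2 with hV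
  have hW0 : 0 ≤ W := by positivity
  have hV0 : 0 ≤ V := by positivity
  have hLpow : ∀ {a b : ℕ}, a ≤ b → L ^ a ≤ L ^ b := fun hab => pow_le_pow_right₀ hL hab
  -- The second estimate is quadratic in `J`: its first term is at most `((1 + C₂) W)²`, and its
  -- second equals `C₂ V J`.
  have hJ2 : J ≤ (1 + C₂) * W + (1 + C₂) * V := by
    refine le_trans (le_add_of_sq_le (W := (1 + C₂) * W) (V := C₂ * V) (by positivity)
      (by positivity) (hJ.trans ?_)) ?_
    · have h1 : P ^ m * (P ^ s * L ^ (2 * s)) * (C₂ * ((P * L) ^ (2 * (s + 2 * t)) *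
          P ^ (m + s) * L ^ (m + s) * (α₂ ^ 4 * δ ^ 4) * ν ^ 4)) =
          C₂ * (P ^ (2 * m + 4 * s + 4 * t) * L ^ (m + 5 * s + 4 * t) * δ ^ 4 * α₂ ^ 4 * ν ^ 4) := by
        rw [mul_pow]; ring
      have h2 : C₂ * (P ^ (2 * m + 4 * s + 4 * t) * L ^ (m + 5 * s + 4 * t) * δ ^ 4 * α₂ ^ 4 *
          ν ^ 4) ≤ (1 + C₂) ^ 2 * (P ^ (2 * m + 4 * s + 4 * t) * L ^ (4 * m + 8 * s + 8 * t) *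
            δ ^ 4 * α₂ ^ 4 * ν ^ 4) := by
        have h3 : C₂ ≤ (1 + C₂) ^ 2 := le_one_add_sq hC₂.le
        have h4 := hLpow (by omega : m + 5 * s + 4 * t ≤ 4 * m + 8 * s + 8 * t)
        gcongr
      have h5 : (1 + C₂) ^ 2 * (P ^ (2 * m + 4 * s + 4 * t) * L ^ (4 * m + 8 * s + 8 * t) *
            δ ^ 4 * α₂ ^ 4 * ν ^ 4) = ((1 + C₂) * W) ^ 2 := by
        rw [hW]; ring
      have h6 : P ^ m * (P ^ s * L ^ (2 * s)) * (C₂ * (ξ ^ 2 * δ ^ 4 * (S ^ 2 * P ^ s * J))) =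
          C₂ * V * J := by
        rw [hV]; ring
      rw [← h5, ← h6]
      refine le_trans (le_of_eq ?_) (add_le_add_left (h1.trans_le h2) _)
      ring
    · have : C₂ * V ≤ (1 + C₂) * V := by gcongr; linarith
      linarith
  have hIsq : I ^ 2 ≤ ((1 + C₁ * (1 + C₂)) * (t₁ + t₂ + t₃)) ^ 2 := by
    have h1 : P ^ m * L ^ (2 * m) * ((P * L) ^ (2 * (s + t)) * P ^ m * L ^ m *
        (α₁ ^ 2 * δ ^ 4) * ν ^ 4) ≤ t₁ ^ 2 := by
      have h2 := hLpow (by omega : 3 * m + 2 * s + 2 * t ≤ 4 * (m + s + t))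
      calc _ = P ^ (2 * (m + s + t)) * L ^ (3 * m + 2 * s + 2 * t) * δ ^ 4 * α₁ ^ 2 * ν ^ 4 := by
            rw [mul_pow]; ring
        _ ≤ P ^ (2 * (m + s + t)) * L ^ (4 * (m + s + t)) * δ ^ 4 * α₁ ^ 2 * ν ^ 4 := by gcongr
        _ = _ := by rw [ht₁]; ring
    have h2 : P ^ m * L ^ (2 * m) * (ξ ^ 2 * δ ^ 4 * W) = t₂ ^ 2 := by rw [hW, ht₂]; ring
    have h3 : P ^ m * L ^ (2 * m) * (ξ ^ 2 * δ ^ 4 * V) = t₃ ^ 2 := by rw [hV, ht₃]; ring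
    have ht10 : 0 ≤ t₁ := by positivity
    have ht20 : 0 ≤ t₂ := by positivity
    have ht30 : 0 ≤ t₃ := by positivity
    calc I ^ 2 ≤ _ := hI
      _ ≤ P ^ m * L ^ (2 * m) * (C₁ * ((P * L) ^ (2 * (s + t)) * P ^ m * L ^ m *
            (α₁ ^ 2 * δ ^ 4) * ν ^ 4 + ξ ^ 2 * δ ^ 4 * ((1 + C₂) * W + (1 + C₂) * V))) := by gcongr
      _ = C₁ * (P ^ m * L ^ (2 * m) * ((P * L) ^ (2 * (s + t)) * P ^ m * L ^ m *
            (α₁ ^ 2 * δ ^ 4) * ν ^ 4)) + C₁ * (1 + C₂) * (P ^ m * L ^ (2 * m) *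
              (ξ ^ 2 * δ ^ 4 * W)) + C₁ * (1 + C₂) * (P ^ m * L ^ (2 * m) *
              (ξ ^ 2 * δ ^ 4 * V)) := by ring
      _ ≤ C₁ * (1 + C₂) * t₁ ^ 2 + C₁ * (1 + C₂) * t₂ ^ 2 + C₁ * (1 + C₂) * t₃ ^ 2 := by
          rw [h2, h3]
          have h4 : C₁ ≤ C₁ * (1 + C₂) := le_mul_of_one_le_right hC₁.le (by linarith)
          gcongr
      _ = C₁ * (1 + C₂) * (t₁ ^ 2 + t₂ ^ 2 + t₃ ^ 2) := by ring
      _ ≤ (1 + C₁ * (1 + C₂)) ^ 2 * (t₁ + t₂ + t₃) ^ 2 := by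
          have h5 : 0 < C₁ * (1 + C₂) := by positivity
          exact mul_le_mul (le_one_add_sq h5.le) (sum_sq_le_sq_sum ht10 ht20 ht30)
            (by positivity) (by positivity)
      _ = _ := (mul_pow _ _ _).symm
  exact (le_abs_self I).trans (abs_le_of_sq_le_sq hIsq (by positivity))

end
end FormsPrime

/-! ### The two applications of the large sieve -/

namespace FormsPrime
open MvPolynomial MeasureTheory

noncomputable section

theorem lt_weylExponent {σ : Type*} [Fintype σ] {R k : ℕ} (hR : 1 ≤ R) (hk : 0 < k)
    {G : Fin R → MvPolynomial σ ℤ} {κ : ℝ} (h1 : 2 ^ k * (k : ℝ) * R * (R + 1) < κ)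
    (h2 : κ ≤ Fintype.card σ - affineDim (singularLocus G)) :
    (R : ℝ) + 1 < κ / (2 ^ k * k * R) ∧ κ / (2 ^ k * k * R) ≤ weylExponent k G := by
  have hk' : (0 : ℝ) < k := by exact_mod_cast hk
  have hR' : (0 : ℝ) < R := by exact_mod_cast hR
  constructor
  · rw [lt_div_iff₀ (by positivity)]
    linarith
  · rw [weylExponent]
    gcongr

section Main

variable {m s t R k : ℕ} {f : Fin R → MvPolynomial (Fin m) ℤ}
  {g : Fin R → MvPolynomial (Fin m ⊕ Fin s) ℤ}
  {h : Fin R → MvPolynomial ((Fin m ⊕ Fin s) ⊕ Fin t) ℤ}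

/-- The sieve is applied to `f` with amplitude `T_y` and then to `g` with amplitude `ℰ · conj(T_y)`.
The constant is chosen before `A₁` and `A₂`, hence is independent of `κ₁` and `κ₂`. -/
theorem exists_norm_integral_expSum_le (hR : 1 ≤ R) (hk : 0 < k)
    {F : Fin R → MvPolynomial ((Fin m ⊕ Fin s) ⊕ Fin t) ℤ}
    (hsplit : IsSplitting (k + 1) F f g h) (hf : (R : ℝ) + 1 < weylExponent k f)
    (hg : (R : ℝ) + 1 < weylExponent k g) :
    ∃ C : ℝ, 0 < C ∧ ∀ (A₁ A₂ : ℝ) (_ : (R : ℝ) + 1 < A₁) (_ : A₁ ≤ weylExponent k f)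
      (_ : (R : ℝ) + 1 < A₂) (_ : A₂ ≤ weylExponent k g)
      (lam : (Fin m ⊕ Fin s) ⊕ Fin t → ℕ → ℝ)
      (_ : ∀ j, ∀ x : ℕ, 1 ≤ x → |lam j x| ≤ Real.log x) (P X : ℝ) (_ : 3 ≤ P) (_ : 0 < X)
      (_ : X ^ (R + 1) ≤ P ^ (R * (k + 1))) (𝔫 : Set (Fin R → ℝ)) (_ : MeasurableSet 𝔫)
      (_ : 𝔫 ⊆ Set.Icc (fun _ => 0) (fun _ => 2)) (α₁ α₂ ξ ν δ : ℝ) (_ : 0 ≤ α₁) (_ : 0 ≤ α₂)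
      (_ : 0 ≤ ξ) (_ : 0 ≤ ν) (_ : 0 ≤ δ) (_ : α₁ ^ 2 = X ^ ((R : ℝ) + 1 - A₁))
      (_ : α₂ ^ 4 = X ^ ((R : ℝ) + 1 - A₂)) (_ : ξ ^ 2 = X ^ (R + 1))
      (_ : ν ^ 4 = volume.real 𝔫) (_ : δ ^ 4 = 1 / P ^ (R * (k + 1))),
      ‖∫ α in 𝔫, expSum lam F P α‖ ≤
        C * (P ^ (m + s + t) * Real.log P ^ (2 * (m + s + t)) * δ ^ 2 * α₁ * ν ^ 2 +
          P ^ (m + s + t) * Real.log P ^ (2 * (m + s + t)) * δ ^ 3 * ξ * α₂ * ν +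
          P ^ (m + s) * Real.log P ^ (m + s) * δ ^ 4 * ξ ^ 2 * supInner lam h P 𝔫) := by
  obtain ⟨C₁, hC₁, hsieve₁⟩ := exists_sum_norm_integral_sq_le hR hk f hsplit.homogeneous_f hf
  obtain ⟨C₂, hC₂, hsieve₂⟩ := exists_sum_norm_integral_sq_le hR hk g hsplit.homogeneous_g hg
  refine ⟨1 + C₁ * (1 + C₂), by positivity, ?_⟩
  intro A₁ A₂ hA₁ hA₁' hA₂ hA₂' lam hlam P X hP hX hXP 𝔫 h𝔫m h𝔫 α₁ α₂ ξ ν δ hα₁ hα₂ hξ hν hδ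
    hα₁X hα₂X hξX hνX hδP
  have hP1 : 1 ≤ P := by linarith
  have hL := one_le_log hP
  have hL0 : 0 ≤ Real.log P := by linarith
  have hPL : 0 ≤ P * Real.log P := by positivity
  have hdg : ∀ i, (g i).weightedTotalDegree
      (Sum.elim (fun _ => 1) (fun _ => 0) : Fin m ⊕ Fin s → ℕ) ≤ k := fun i =>
    Nat.lt_succ_iff.mp (hsplit.degree_g i)
  have hdh : ∀ i, (h i).weightedTotalDegree
      (Sum.elim (fun _ => 1) (fun _ => 0) : (Fin m ⊕ Fin s) ⊕ Fin t → ℕ) ≤ k := fun i =>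
    Nat.lt_succ_iff.mp (hsplit.degree_h i)
  refine le_of_energy_estimates (J := middleEnergy lam g h P 𝔫) hP1 hL supInner_nonneg hα₁ hα₂ hξ hν
    hδ hC₁ hC₂ ?_ ?_
  · refine (norm_integral_expSum_sq_le hsplit hP1 hlam h𝔫).trans ?_
    gcongr
    have h1 := hsieve₁ A₁ hA₁ hA₁' P X hP hX hXP 𝔫 h𝔫m h𝔫 (middleSum lam g h P)
      ((P * Real.log P) ^ (s + t) * (P * Real.log P) ^ (s + t)) ((P * Real.log P) ^ (s + t))
      (by positivity) (fun y => (continuous_middleSum lam g h P y).measurable)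
      (fun y _ α => norm_middleSum_le hP1 hlam α y) (fun α β => by
        simp only [conj_middleSum]
        exact IsTame.mul
          (isTame_middleSum _ hP1 hlam hdg hdh _ (θ := MvPolynomial.X) (fun j => (totalDegree_X j).le)
            id (fun x j => by simp))
          (isTame_middleSum _ hP1 hlam hdg hdh _ (θ := MvPolynomial.X) (fun j => (totalDegree_X j).le)
            id (fun x j => by simp)))
    refine h1.trans_eq ?_
    rw [hα₁X, hξX, hνX, hδP, Fintype.card_fin, middleEnergy]
    ring
  · refine (middleEnergy_sq_le hP1 hlam h𝔫).trans ?_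
    gcongr
    have hE : ∀ α, IsTame (box (Fin m ⊕ Fin s) P) k ((P * Real.log P) ^ t)
        fun v => innerSum lam h P v α := fun α =>
      isTame_innerSum _ hP1 hlam hdh α (θ := MvPolynomial.X) (fun j => (totalDegree_X j).le)
        id (fun x j => by simp)
    have hT : ∀ α, IsTame (box (Fin m ⊕ Fin s) P) k ((P * Real.log P) ^ (s + t))
        fun v => middleSum lam g h P α (v ∘ Sum.inl) := fun α =>
      isTame_middleSum _ hP1 hlam hdg hdh α (θ := fun j => MvPolynomial.X (Sum.inl j))
        (fun j => (totalDegree_X _).le) (fun v => v ∘ Sum.inl) (fun x j => by simp)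
    have htame : ∀ α β, IsTame (box (Fin m ⊕ Fin s) P) k
        ((P * Real.log P) ^ t * (P * Real.log P) ^ (s + t) *
          ((P * Real.log P) ^ t * (P * Real.log P) ^ (s + t)))
        fun v => innerSum lam h P v α *
          (starRingEnd ℂ) (middleSum lam g h P α (v ∘ Sum.inl)) *
            (starRingEnd ℂ) (innerSum lam h P v β *
              (starRingEnd ℂ) (middleSum lam g h P β (v ∘ Sum.inl))) := fun α β => by
      -- As the weights are real, conjugation replaces `α` by `-α`, and the conjugate amplitudes are
      -- tame for the same reason.
      simp only [map_mul, conj_middleSum, conj_innerSum, neg_neg]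
      exact IsTame.mul (IsTame.mul (hE _) (hT _)) (IsTame.mul (hE _) (hT _))
    have hbound : ∀ v α, ‖innerSum lam h P v α *
        (starRingEnd ℂ) (middleSum lam g h P α (v ∘ Sum.inl))‖ ≤
          (P * Real.log P) ^ t * (P * Real.log P) ^ (s + t) := fun v α => by
      rw [norm_mul, RCLike.norm_conj]
      exact mul_le_mul (norm_innerSum_le hP1 hlam v α) (norm_middleSum_le hP1 hlam α _)
        (norm_nonneg _) (pow_nonneg hPL _)
    have h1 := hsieve₂ A₂ hA₂ hA₂' P X hP hX hXP 𝔫 h𝔫m h𝔫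
      (fun α v => innerSum lam h P v α * (starRingEnd ℂ) (middleSum lam g h P α (v ∘ Sum.inl)))
      _ _ (by positivity) (fun v => ((continuous_innerSum lam h P v).mul
        (Complex.continuous_conj.comp (continuous_middleSum lam g h P _))).measurable)
      (fun v _ α => hbound v α) htame
    have h2 := sum_integral_innerSum_mul_le (g := g) (h := h) hP1 hlam h𝔫m h𝔫
    refine h1.trans ?_
    rw [hα₂X, hξX, hνX, hδP, Fintype.card_sum, Fintype.card_fin, Fintype.card_fin]
    gcongr ?_ * (?_ + ?_)
    · refine le_of_eq ?_
      ring
    · rw [← mul_one_div]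
      gcongr

end Main

end
end FormsPrime

/-! ### The theorem -/

theorem proposition5p1 (d R m s t : ℕ) (hd : 2 ≤ d) (hR : 1 ≤ R)
    (F : Fin R → MvPolynomial ((Fin m ⊕ Fin s) ⊕ Fin t) ℤ)
    (hF : ∀ i, (F i).IsHomogeneous d)
    (f : Fin R → MvPolynomial (Fin m) ℤ)
    (g : Fin R → MvPolynomial (Fin m ⊕ Fin s) ℤ)
    (h : Fin R → MvPolynomial ((Fin m ⊕ Fin s) ⊕ Fin t) ℤ)
    (hsplit : FormsPrime.IsSplitting d F f g h) :
    ∃ C P₀ : ℝ, ∀ κ₁ κ₂ : ℝ,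
      2 ^ (d - 1) * ((d : ℝ) - 1) * R * (R + 1) < min κ₁ κ₂ →
      κ₁ ≤ (m : ℝ) - FormsPrime.affineDim (FormsPrime.singularLocus f) →
      κ₂ ≤ (m : ℝ) + s - FormsPrime.affineDim (FormsPrime.singularLocus g) →
      ∀ lam : (Fin m ⊕ Fin s) ⊕ Fin t → ℕ → ℝ,
      (∀ j, ∀ x : ℕ, 1 ≤ x → |lam j x| ≤ Real.log x) →
      ∀ P : ℝ, P₀ ≤ P →
      ∀ X : ℝ, 0 < X → X ≤ 1 / 4 * P ^ ((R : ℝ) * d / (R + 1)) →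
      ∀ 𝔫 : Set (Fin R → ℝ), MeasurableSet 𝔫 → 𝔫 ⊆ Set.Icc (fun _ => 0) (fun _ => 2) →
      ‖∫ α in 𝔫, FormsPrime.expSum lam F P α‖ ≤
        C * (P ^ ((m : ℝ) + s + t - 1 / 2 * (R * d)) * Real.log P ^ (2 * (m + s + t)) *
              X ^ (1 / 2 * ((R : ℝ) + 1) - κ₁ / (2 ^ d * ((d : ℝ) - 1) * R)) *
              MeasureTheory.volume.real 𝔫 ^ (1 / 2 : ℝ) +
            P ^ ((m : ℝ) + s + t - 3 / 4 * (R * d)) * Real.log P ^ (2 * (m + s + t)) *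
              X ^ (3 / 4 * ((R : ℝ) + 1) - κ₂ / (2 ^ (d + 1) * ((d : ℝ) - 1) * R)) *
              MeasureTheory.volume.real 𝔫 ^ (1 / 4 : ℝ) +
            P ^ ((m : ℝ) + s - R * d) * Real.log P ^ (m + s) * X ^ ((R : ℝ) + 1) *
              FormsPrime.supInner lam h P 𝔫) := by
  obtain ⟨k, rfl⟩ : ∃ k, d = k + 1 := ⟨d - 1, by omega⟩
  have hk : 0 < k := by omega
  have hk0 : (0 : ℝ) < k := by exact_mod_cast hk
  have hR0 : (0 : ℝ) < R := by exact_mod_cast hR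
  have hexp : ∀ κ₁ κ₂ : ℝ,
      2 ^ (k + 1 - 1) * (((k + 1 : ℕ) : ℝ) - 1) * R * (R + 1) < min κ₁ κ₂ →
      κ₁ ≤ (m : ℝ) - FormsPrime.affineDim (FormsPrime.singularLocus f) →
      κ₂ ≤ (m : ℝ) + s - FormsPrime.affineDim (FormsPrime.singularLocus g) →
      ((R : ℝ) + 1 < κ₁ / (2 ^ k * k * R) ∧
        κ₁ / (2 ^ k * k * R) ≤ FormsPrime.weylExponent k f) ∧
      ((R : ℝ) + 1 < κ₂ / (2 ^ k * k * R) ∧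
        κ₂ / (2 ^ k * k * R) ≤ FormsPrime.weylExponent k g) := by
    intro κ₁ κ₂ hκ h1 h2
    rw [Nat.add_sub_cancel, Nat.cast_add_one, add_sub_cancel_right] at hκ
    exact ⟨FormsPrime.lt_weylExponent hR hk (hκ.trans_le (min_le_left _ _)) (by simpa using h1),
      FormsPrime.lt_weylExponent hR hk (hκ.trans_le (min_le_right _ _)) (by simpa using h2)⟩
  -- If either exponent is at most `R + 1`, no `κ₁, κ₂` satisfy the hypotheses and any constant will
  -- do.
  by_cases hfg : (R : ℝ) + 1 < FormsPrime.weylExponent k f ∧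
      (R : ℝ) + 1 < FormsPrime.weylExponent k g
  swap
  · refine ⟨0, 0, fun κ₁ κ₂ hκ h1 h2 => ?_⟩
    have h3 := hexp κ₁ κ₂ hκ h1 h2
    exact absurd ⟨h3.1.1.trans_le h3.1.2, h3.2.1.trans_le h3.2.2⟩ hfg
  obtain ⟨C, -, hC⟩ := FormsPrime.exists_norm_integral_expSum_le hR hk hsplit hfg.1 hfg.2
  refine ⟨C, 3, fun κ₁ κ₂ hκ h1 h2 lam hlam P hP X hX hXP 𝔫 h𝔫m h𝔫 => ?_⟩
  have h3 := hexp κ₁ κ₂ hκ h1 h2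
  have hP0 : 0 < P := by linarith
  have hX0 := hX.le
  have hv : 0 ≤ MeasureTheory.volume.real 𝔫 := MeasureTheory.measureReal_nonneg
  have hpow : ∀ {x : ℝ} (_ : 0 ≤ x) (a : ℝ) (n : ℕ), (x ^ a) ^ n = x ^ (a * n) := fun hx a n => by
    rw [Real.rpow_mul hx, Real.rpow_natCast]
  have hXP' : X ^ (R + 1) ≤ P ^ (R * (k + 1)) := by
    have h4 : X ≤ P ^ ((R : ℝ) * ((k + 1 : ℕ) : ℝ) / (R + 1)) := by
      have : 0 ≤ P ^ ((R : ℝ) * ((k + 1 : ℕ) : ℝ) / (R + 1)) := by positivity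
      linarith
    refine (pow_le_pow_left₀ hX0 h4 (R + 1)).trans_eq ?_
    rw [hpow hP0.le, ← Real.rpow_natCast]
    congr 1
    push_cast
    field_simp
  -- The square and fourth roots required by the energy estimate, with `A₁` and `A₂` equal to `κ₁`
  -- and `κ₂` divided by `2^k k R`.
  have key := hC _ _ h3.1.1 h3.1.2 h3.2.1 h3.2.2 lam hlam P X hP hX hXP' 𝔫 h𝔫m h𝔫
    (X ^ (((R : ℝ) + 1 - κ₁ / (2 ^ k * k * R)) / 2))
    (X ^ (((R : ℝ) + 1 - κ₂ / (2 ^ k * k * R)) / 4))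
    (X ^ (((R : ℝ) + 1) / 2)) (MeasureTheory.volume.real 𝔫 ^ (1 / 4 : ℝ))
    (P ^ (-((R : ℝ) * (k + 1)) / 4)) (by positivity) (by positivity) (by positivity)
    (by positivity) (by positivity)
    (by rw [hpow hX0]; congr 1; push_cast; ring) (by rw [hpow hX0]; congr 1; push_cast; ring)
    (by rw [hpow hX0, ← Real.rpow_natCast]; congr 1; push_cast; ring)
    (by rw [hpow hv]; norm_num)
    (by
      rw [hpow hP0.le, one_div, ← Real.rpow_natCast P, ← Real.rpow_neg hP0.le]
      congr 1
      push_cast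
      ring)
  refine key.trans_eq ?_
  have hd1 : ((k + 1 : ℕ) : ℝ) - 1 = k := by push_cast; ring
  rw [hd1]
  congr 2
  · congr 1
    · rw [hpow hP0.le, hpow hv]
      have e1 : P ^ ((m : ℝ) + s + t - 1 / 2 * (R * ((k + 1 : ℕ) : ℝ))) =
          P ^ (m + s + t) * P ^ (-((R : ℝ) * (k + 1)) / 4 * (2 : ℕ)) := by
        rw [← Real.rpow_natCast P (m + s + t), ← Real.rpow_add hP0]
        congr 1
        push_cast
        ring
      have e2 : 1 / 2 * ((R : ℝ) + 1) - κ₁ / (2 ^ (k + 1) * k * R) =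
          ((R : ℝ) + 1 - κ₁ / (2 ^ k * k * R)) / 2 := by
        field_simp
        ring
      have e3 : (1 / 4 : ℝ) * (2 : ℕ) = 1 / 2 := by norm_num
      rw [e1, e2, e3]
      ring
    · rw [hpow hP0.le]
      have e1 : P ^ ((m : ℝ) + s + t - 3 / 4 * (R * ((k + 1 : ℕ) : ℝ))) =
          P ^ (m + s + t) * P ^ (-((R : ℝ) * (k + 1)) / 4 * (3 : ℕ)) := by
        rw [← Real.rpow_natCast P (m + s + t), ← Real.rpow_add hP0]
        congr 1
        push_cast
        ring
      have e2 : X ^ (3 / 4 * ((R : ℝ) + 1) - κ₂ / (2 ^ (k + 1 + 1) * k * R)) =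
          X ^ (((R : ℝ) + 1) / 2) * X ^ (((R : ℝ) + 1 - κ₂ / (2 ^ k * k * R)) / 4) := by
        rw [← Real.rpow_add hX]
        congr 1
        field_simp
        ring
      rw [e1, e2]
      ring
  · rw [hpow hP0.le, hpow hX0]
    have e1 : P ^ ((m : ℝ) + s - R * ((k + 1 : ℕ) : ℝ)) =
        P ^ (m + s) * P ^ (-((R : ℝ) * (k + 1)) / 4 * (4 : ℕ)) := by
      rw [← Real.rpow_natCast P (m + s), ← Real.rpow_add hP0]
      congr 1
      push_cast
      ring
    have e2 : ((R : ℝ) + 1) / 2 * (2 : ℕ) = R + 1 := by push_cast; ring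
    rw [e1, e2]
    ring
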